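/- **Theorem 1 (Inversion formula for the conical Radon transform).** Let $\Xi=\Xi_1\cup\Xi_2\cup\Xi_3\subset\mathbb R^3$ with $\Xi_j=\{t e_j: t\in[0,1]\}$, and $\operatorname{conv}(\Xi)=\{x\in[0,1]^3: x_1+x_2+x_3\le 1\}$. For $\bar\beta=(\beta_1,\beta_2)\in S^1$ and a vertex $u\in\Xi_j$ put $\beta_u=(\beta_1,0,\beta_2)$ if $j\in\{1,3\}$ and $\beta_u=(0,\beta_1,\beta_2)$ if $j=2$. For $w\in\mathbb R^3$ put $\bar w_u=(w_1,w_3)$, $w_u=w_2$ if $j\in\{1,3\}$, and $\bar w_u=(w_2,w_3)$, $w_u=w_1$ if $j=2$ (at the common end point $0$ of the segments, $j$ is part of the data). For an integer $k\ge 1$ the conical Radon transform is $$C_kf(u,\bar\beta,s)=\int_{S^2}\int_0^\infty f(u+r\alpha)\,r^k\,\delta(\alpha\cdot\beta_u-s)\,dr\,dS(\alpha)\quad(|s|\le 1),\qquad C_kf(u,\bar\beta,s)=0\quad(|s|>1),$$ where the integral against $\delta$ is the integral over the angle $\varphi\in[0,2\pi]$ around the axis in $\alpha=s\beta_u+\sqrt{1-s^2}\,(\cos\varphi\,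 e+\sin\varphi\, e')$, with $(e,e')$ an orthonormal basis of $\beta_u^\perp$. Let $H_sg(s)=\frac1\pi\,\mathrm{p.v.}\!\int_{\mathbb R}\frac{g(t)}{s-t}\,dt$ be the Hilbert transform, and let $\partial_{u_j}$ be the derivative in the vertex along $\Xi_j$ (one-sided at the end points). Let $f\in C^\infty(\mathbb R^3)$ be real valued with support contained in $\operatorname{conv}(\Xi)$, and let $$c_k=-\frac{1}{2^2(2\pi)^3(k-2)!}\quad(k\ge2),\qquad c_1=-\frac1{2^2(2\pi)^3}.$$ For $x\in\operatorname{conv}(\Xi)$ and $n\in S^2$ the plane $\{y:(x-y)\cdot n=0\}$ meets $\Xi$; let $\Lambda(x,n)$ be any point of the intersection and $j=j(x,n)$ any index with $\Lambda(x,n)\in\Xi_j$. For $\alpha\in S^2$ let $w=w(\alpha,\omega)$ be $\alpha$ with the component $\alpha_j$ replaced by $\omega$ (the omitted component $w_\Lambda=\alpha_\Lambda$ is not changed by this), and write $t_+=\max(t,0)$. Then, for $k\ge2$, the function $$F(x)=\int_{S^2}\int_{n^\perp\cap S^2}\int_{-\infty}^{\alpha_j}\int_{S^1}\frac{(w_{\Lambda})_+\,(\alpha_j-\omega)^{k-2}}{|w|^{k+2}}\,\bigl(\partial_{u_j}^{k-1}H_s\partial_sC_kf\bigr)\Bigl(\Lambda(x,n),\bar\beta,\frac{\bar\beta\cdot\bar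 w_{\Lambda}}{|w|}\Bigr)\,dS(\bar\beta)\,d\omega\,dS(\alpha)\,dS(n)$$ is well defined on $\operatorname{conv}(\Xi)$ (the derivatives and the Hilbert transform exist and each of the iterated integrals converges absolutely) and of class $C^2$ there, and $$f(x)=c_k\,\Delta F(x)\qquad\text{for all }x\in\operatorname{conv}(\Xi),$$ where at boundary points $\Delta$ is formed with the derivatives relative to $\operatorname{conv}(\Xi)$. For $k=1$ the same holds with $k-1=0$ integrations in $\omega$, that is, with $$F(x)=\int_{S^2}\int_{n^\perp\cap S^2}\int_{S^1}(\alpha_{\Lambda})_+\,\bigl(H_s\partial_sC_1f\bigr)\bigl(\Lambda(x,n),\bar\beta,\bar\beta\cdot\bar \alpha_{\Lambda}\bigr)\,dS(\bar\beta)\,dS(\alpha)\,dS(n).$$ -/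

import Mathlib

open MeasureTheory Filter Topology Set Laplacian
open scoped ContDiff RealInnerProductSpace InnerProductSpace

noncomputable section

namespace TripleLine

/-- Euclidean space of dimension three. -/
abbrev E3 := EuclideanSpace ℝ (Fin 3)

/-- Euclidean plane. -/
abbrev E2 := EuclideanSpace ℝ (Fin 2)

/-- The unit sphere of three-dimensional space. -/
abbrev S2 := Metric.sphere (0 : E3) 1

/-- The unit circle of the plane. -/
abbrev S1 := Metric.sphere (0 : E2) 1

/-- The area measure of the unit sphere (total mass `4 * π`). -/
def areaS2 : Measure S2 := (volume : Measure E3).toSphere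

/-- The arc length measure of the unit circle (total mass `2 * π`). -/
def arcS1 : Measure S1 := (volume : Measure E2).toSphere

/-- The plane through the origin that is orthogonal to `n`. -/
abbrev perp (n : S2) : Submodule ℝ E3 := (Submodule.span ℝ {(n : E3)})ᗮ

/-- The great circle of unit vectors orthogonal to `n`. -/
abbrev GreatCircle (n : S2) := Metric.sphere (0 : perp n) 1

/-- The arc length measure of the great circle; `volume` is the Lebesgue measure of the
two-dimensional Euclidean space `perp n`. -/
def arcGreatCircle (n : S2) : Measure (GreatCircle n) :=
  (@volume (perp n) measureSpaceOfInnerProductSpace).toSphere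

/-- The three unit segments of the triple line sensor; the index `j` is counted from zero. -/
def sensorLine (j : Fin 3) : Set E3 := {y | y j ∈ Icc (0 : ℝ) 1 ∧ ∀ i, i ≠ j → y i = 0}

/-- The convex hull of the triple line sensor. -/
def simplex : Set E3 := {x | (∀ i, x i ∈ Icc (0 : ℝ) 1) ∧ x 0 + x 1 + x 2 ≤ 1}

/-- The cone axis in space that belongs to the segment `j` and to a vector of the plane. -/
def axis : Fin 3 → E2 → E3
  | 0, b => !₂[b 0, 0, b 1]
  | 1, b => !₂[0, b 0, b 1]
  | 2, b => !₂[b 0, 0, b 1]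

/-- The two components of `w` that lie in the plane of the axes of the segment `j`. -/
def bar : Fin 3 → E3 → E2
  | 0, w => !₂[w 0, w 2]
  | 1, w => !₂[w 1, w 2]
  | 2, w => !₂[w 0, w 2]

/-- The index of the component that `bar j` leaves out. -/
def missing : Fin 3 → Fin 3
  | 0 => 1
  | 1 => 0
  | 2 => 1

/-- The point with longitude `φ` on the circle of unit vectors `α` with `⟪α, axis j b⟫ = s`
(for a unit vector `b` and `s ∈ [-1, 1]`). -/
def conePoint (j : Fin 3) (b : E2) (s φ : ℝ) : E3 :=
  s • axis j b + √(1 - s ^ 2) •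
    (Real.cos φ • EuclideanSpace.single (missing j) (1 : ℝ) +
      Real.sin φ • axis j !₂[-b 1, b 0])

/-- The conical Radon transform with weight `r ^ k`, vertex `u`, an axis of the segment `j` and the
cosine `s` of the opening angle. In the cylindrical coordinates `(s, φ)` around the axis the
area element of the unit sphere is `ds dφ`, so integration against `δ (⟪α, axis j b⟫ - s)` over the
sphere is integration over `φ`. -/
def conicalRadon (k : ℕ) (f : E3 → ℝ) (j : Fin 3) (u : E3) (b : S1) (s : ℝ) : ℝ :=
  open Classical in
  if s ∈ Icc (-1 : ℝ) 1 then
    ∫ φ in (0 : ℝ)..(2 * Real.pi), ∫ r in Ioi (0 : ℝ), f (u + r • conePoint j b s φ) * r ^ k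
  else 0

/-- The truncations whose limit as `ε` decreases to `0` is the Hilbert transform. -/
def truncatedHilbert (g : ℝ → ℝ) (s ε : ℝ) : ℝ :=
  (1 / Real.pi) * ∫ t in {t : ℝ | ε < |s - t|}, g t / (s - t)

/-- The Hilbert transform, as a principal value. -/
def hilbert (g : ℝ → ℝ) (s : ℝ) : ℝ := limUnder (𝓝[>] (0 : ℝ)) (truncatedHilbert g s)

/-- `H_s ∂_s C_k f` at the vertex `u`. -/
def filteredData (k : ℕ) (f : E3 → ℝ) (j : Fin 3) (u : E3) (b : S1) (s : ℝ) : ℝ :=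
  hilbert (deriv (conicalRadon k f j u b)) s

/-- The partial derivative of order `k - 1` of `H_s ∂_s C_k f` in the vertex along the segment `j`
(one-sided at the end points). -/
def filteredDataDeriv (k : ℕ) (f : E3 → ℝ) (j : Fin 3) (u : E3) (b : S1) (s : ℝ) : ℝ :=
  iteratedDerivWithin (k - 1)
    (fun t => filteredData k f j (EuclideanSpace.single j t) b s) (Icc 0 1) (u j)

/-- The vector `α` with the component `j` replaced by `q`. -/
def setCoord (j : Fin 3) (α : E3) (q : ℝ) : E3 := WithLp.toLp 2 (Function.update (fun i => α i) j q)

/-- The integrand of the integral over the axes, at the direction `w`. -/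
def axisIntegrand (k : ℕ) (f : E3 → ℝ) (j : Fin 3) (u w : E3) (b : S1) : ℝ :=
  max (w (missing j)) 0 / ‖w‖ ^ (k + 2) * filteredDataDeriv k f j u b (⟪(b : E2), bar j w⟫_ℝ / ‖w‖)

/-- The integral over the axes. -/
def axisIntegral (k : ℕ) (f : E3 → ℝ) (j : Fin 3) (u w : E3) : ℝ :=
  ∫ b, axisIntegrand k f j u w b ∂arcS1

/-- The integrand of the Cauchy repeated integral in the component `j` of the direction. -/
def lineIntegrand (k : ℕ) (f : E3 → ℝ) (j : Fin 3) (u α : E3) (q : ℝ) : ℝ :=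
  (α j - q) ^ (k - 2) * axisIntegral k f j u (setCoord j α q)

/-- The Cauchy repeated integral, without the factor `1 / (k - 2)!`. It stands for `k - 1`
integrations, so for `k = 1` there is no integration. -/
def lineIntegral (k : ℕ) (f : E3 → ℝ) (j : Fin 3) (u α : E3) : ℝ :=
  if k = 1 then axisIntegral k f j u α else ∫ q in Iio (α j), lineIntegrand k f j u α q

/-- The integral over the unit directions orthogonal to `n`. -/
def planeIntegral (k : ℕ) (f : E3 → ℝ) (j : Fin 3) (u : E3) (n : S2) : ℝ :=
  ∫ α : GreatCircle n, lineIntegral k f j u ((α : perp n) : E3) ∂(arcGreatCircle n)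

/-- The integral over the normals, where `Λ x n` is the vertex chosen for the plane through `x` with
normal `n`, and `J x n` is the index of a segment that contains it. -/
def backprojection (k : ℕ) (f : E3 → ℝ) (J : E3 → S2 → Fin 3) (Λ : E3 → S2 → E3) (x : E3) : ℝ :=
  ∫ n, planeIntegral k f (J x n) (Λ x n) n ∂areaS2

/-- `Λ x n` is a point in which the plane through `x` with normal `n` meets the sensor, and
`J x n` is the index of a segment that contains it, for all `x` in the simplex. -/
def IsVertexChoice (J : E3 → S2 → Fin 3) (Λ : E3 → S2 → E3) : Prop :=
  ∀ x ∈ simplex, ∀ n : S2, Λ x n ∈ sensorLine (J x n) ∧ ⟪x - Λ x n, (n : E3)⟫_ℝ = 0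

/-- The constant of the inversion formula. For `k = 1` it is read with `0! = 1`. -/
def inversionConst (k : ℕ) : ℝ :=
  -1 / (2 ^ 2 * (2 * Real.pi) ^ 3 * ((k - 2).factorial : ℝ))

end TripleLine

end

/-! Fix a vertex `u` on the segment `j`. As `f` vanishes where the coordinate `missing j` is
nonpositive, only directions `(z, h)` with `z` in the plane of the axes, `‖z‖ < 1` and `h = √(1 -
‖z‖²) > 0` matter. A circle of directions around an axis `b` projects to the chord `⟪b, z⟫ = s` of
the unit disc, and `h dφ = dτ` for the coordinate `τ` on the chord. Hence the conical transform is
the planar Radon transform of `z ↦ h⁻¹ * rayIntegral` (`conicalRadon_eq`). This function is smooth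
across the unit circle, since `f` is flat on the plane of the axes: a flat function can be divided
by `p`, and stays smooth after substituting a square root (`contDiff_compSqrt`).

Planar filtered backprojection (`radon_inversion`) then recovers `4π` times the ray integral of
`∂_j^(k-1) f` with weight `r^k` (`axisIntegral_eq`). Cauchy's formula for repeated integration in
the component `j` of the direction undoes the `k - 1` derivatives and takes away `k - 1` powers of
`r`, with a factor `(k-2)!` (`lineIntegral_eq`). The remaining weight `r` is the area density of
polar coordinates in a plane, so the integral over a great circle is the integral of `f` over the
plane through `u` with normal `n` (`planeIntegral_eq`). That is also the plane through `x`, so the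
choice of the vertex drops out.

Finally, the integrals over all planes through `x` add up to `2π` times the convolution of `f` with
`‖y‖⁻¹` (`integral_planeRadon`), whose Laplacian is `-4π f` (`laplacian_newton`). The product of `4π
(k-2)!`, `2π` and `-4π` is the inverse of `inversionConst k`. -/

namespace TripleLine

/-! ### Smooth dependence of integrals on parameters -/

section ParametricIntegrals

variable {E W : Type} [NormedAddCommGroup E] [NormedSpace ℝ E] [FiniteDimensional ℝ E]
  [NormedAddCommGroup W] [NormedSpace ℝ W]

theorem hasFDerivAt_intervalIntegral_of_contDiff {F : E × ℝ → W} (hF : ContDiff ℝ 1 F) (a b : ℝ)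
    (x : E) : HasFDerivAt (fun x => ∫ t in a..b, F (x, t))
      (∫ t in a..b, (fderiv ℝ F (x, t)).comp (ContinuousLinearMap.inl ℝ E ℝ)) x := by
  have hc : Continuous fun p : E × ℝ =>
      (fderiv ℝ F p).comp (ContinuousLinearMap.inl ℝ E ℝ) :=
    (hF.continuous_fderiv one_ne_zero).clm_comp continuous_const
  -- Closed balls of `E` are compact, so the derivative is bounded near `x` uniformly in `t`, and a
  -- constant dominates.
  obtain ⟨C, hC⟩ := ((isCompact_closedBall x 1).prod (isCompact_uIcc (a := a) (b := b))).bddAbove_image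
    hc.norm.continuousOn
  refine intervalIntegral.hasFDerivAt_integral_of_dominated_of_fderiv_le (bound := fun _ => C)
    (F' := fun x t => (fderiv ℝ F (x, t)).comp (ContinuousLinearMap.inl ℝ E ℝ))
    (Metric.closedBall_mem_nhds x one_pos) ?_ ?_ ?_ ?_ ?_ ?_
  · exact .of_forall fun y => (hF.continuous.comp (by fun_prop)).aestronglyMeasurable
  · exact (hF.continuous.comp (by fun_prop)).intervalIntegrable _ _
  · exact (hc.comp (by fun_prop : Continuous fun t : ℝ => (x, t))).aestronglyMeasurable
  · refine .of_forall fun t ht y hy => hC ⟨(y, t), ⟨hy, uIoc_subset_uIcc ht⟩, rfl⟩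
  · exact intervalIntegrable_const
  · refine .of_forall fun t _ y _ => ?_
    exact ((hF.differentiable one_ne_zero).differentiableAt (x := (y, t))).hasFDerivAt.comp y
      (hasFDerivAt_prodMk_left y t)

/-- The target space is quantified inside the induction because the derivative of the integral takes
values in `E →L[ℝ] W`. -/
theorem contDiff_intervalIntegral_nat (n : ℕ) : ∀ {W : Type} [NormedAddCommGroup W]
    [NormedSpace ℝ W] {F : E × ℝ → W}, ContDiff ℝ ∞ F → ∀ a b : ℝ,
    ContDiff ℝ n (fun x => ∫ t in a..b, F (x, t)) := by
  induction n with
  | zero =>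
    intro W _ _ F hF a b
    refine contDiff_zero.2 ?_
    exact intervalIntegral.continuous_parametric_intervalIntegral_of_continuous'
      (f := fun x t => F (x, t)) hF.continuous a b
  | succ n ih =>
    intro W _ _ F hF a b
    refine contDiff_succ_iff_hasFDerivAt.2 ⟨_, ?_,
      hasFDerivAt_intervalIntegral_of_contDiff (hF.of_le (by simp)) a b⟩
    exact ih (F := fun p => (fderiv ℝ F p).comp (ContinuousLinearMap.inl ℝ E ℝ))
      ((hF.fderiv_right (by simp)).clm_comp contDiff_const) a b

/-- Integrals of smooth functions over a compact interval are smooth in the parameter. -/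
theorem contDiff_intervalIntegral {F : E × ℝ → W} (hF : ContDiff ℝ ∞ F) (a b : ℝ) :
    ContDiff ℝ ∞ (fun x => ∫ t in a..b, F (x, t)) :=
  contDiff_infty.2 fun n => contDiff_intervalIntegral_nat n hF a b

theorem hasDerivAt_intervalIntegral_of_contDiff {F : ℝ × ℝ → ℝ} (hF : ContDiff ℝ 1 F)
    (a b x : ℝ) : HasDerivAt (fun x => ∫ t in a..b, F (x, t))
      (∫ t in a..b, deriv (fun y => F (y, t)) x) x := by
  have h := (hasFDerivAt_intervalIntegral_of_contDiff hF a b x).hasDerivAt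
  have hc : Continuous fun t : ℝ =>
      (fderiv ℝ F (x, t)).comp (ContinuousLinearMap.inl ℝ ℝ ℝ) :=
    ((hF.continuous_fderiv one_ne_zero).comp (by fun_prop)).clm_comp continuous_const
  rw [ContinuousLinearMap.intervalIntegral_apply (hc.intervalIntegrable _ _)] at h
  refine h.congr_deriv (intervalIntegral.integral_congr fun t _ => ?_)
  have h2 : HasDerivAt (fun y : ℝ => (y, t)) (1, 0) x :=
    (hasDerivAt_id x).prodMk (hasDerivAt_const x t)
  exact (((hF.differentiable one_ne_zero).differentiableAt
    (x := (x, t))).hasFDerivAt.comp_hasDerivAt x h2).deriv.symm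

theorem contDiff_deriv_fst {E' : Type} [NormedAddCommGroup E'] [NormedSpace ℝ E']
    {F : ℝ × E' → ℝ} (hF : ContDiff ℝ ∞ F) :
    ContDiff ℝ ∞ fun p : ℝ × E' => deriv (fun y => F (y, p.2)) p.1 := by
  have : (fun p : ℝ × E' => deriv (fun y => F (y, p.2)) p.1) =
      fun p => fderiv ℝ F p (1, 0) := by
    ext ⟨x, t⟩
    have h2 : HasDerivAt (fun y : ℝ => (y, t)) (1, 0) x :=
      (hasDerivAt_id x).prodMk (hasDerivAt_const x t)
    exact (((hF.differentiable (by simp)).differentiableAt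
      (x := (x, t))).hasFDerivAt.comp_hasDerivAt x h2).deriv
  rw [this]
  exact (hF.fderiv_right (by simp)).clm_apply contDiff_const

theorem iteratedDeriv_intervalIntegral (m : ℕ) : ∀ {F : ℝ × ℝ → ℝ}, ContDiff ℝ ∞ F →
    ∀ a b : ℝ, iteratedDeriv m (fun x => ∫ t in a..b, F (x, t)) =
      fun x => ∫ t in a..b, iteratedDeriv m (fun y => F (y, t)) x := by
  induction m with
  | zero => intro F hF a b; simp
  | succ m ih =>
    intro F hF a b
    rw [iteratedDeriv_succ']
    have h : deriv (fun x => ∫ t in a..b, F (x, t)) =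
        fun x => ∫ t in a..b, deriv (fun y => F (y, t)) x :=
      funext fun x => (hasDerivAt_intervalIntegral_of_contDiff (hF.of_le (by simp)) a b x).deriv
    rw [h, ih (F := fun p => deriv (fun y => F (y, p.2)) p.1) (contDiff_deriv_fst hF) a b]
    simp_rw [iteratedDeriv_succ']

end ParametricIntegrals

/-! ### Flat functions and substitution of a square root -/

section SquareRoot

set_option linter.unusedSectionVars false

variable {V : Type} [NormedAddCommGroup V] [NormedSpace ℝ V] [FiniteDimensional ℝ V]

/-- Smooth functions that vanish where the second variable is not positive. -/
structure IsFlat {W : Type} [NormedAddCommGroup W] [NormedSpace ℝ W] (F : V × ℝ → W) : Prop where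
  contDiff : ContDiff ℝ ∞ F
  eq_zero : ∀ y p, p ≤ 0 → F (y, p) = 0

variable {W : Type} [NormedAddCommGroup W] [NormedSpace ℝ W]

/-- Hadamard's quotient of `F` by the second variable. -/
noncomputable def hadamard (F : V × ℝ → W) (x : V × ℝ) : W :=
  ∫ θ in (0 : ℝ)..1, fderiv ℝ F (x.1, θ * x.2) (0, 1)

namespace IsFlat

variable {F : V × ℝ → W}

/-- For `p < 0` the function is locally zero; the boundary value `p = 0` follows by continuity of
the derivative. -/
theorem fderiv_eq_zero (hF : IsFlat F) (y : V) (p : ℝ) (hp : p ≤ 0) : fderiv ℝ F (y, p) = 0 := by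
  have hneg : ∀ p < 0, fderiv ℝ F (y, p) = 0 := by
    intro p hp
    have : F =ᶠ[𝓝 (y, p)] fun _ => 0 := by
      filter_upwards [continuous_snd.continuousAt.eventually_lt_const hp] with z hz
      exact hF.eq_zero z.1 z.2 hz.le
    rw [this.fderiv_eq]; simp
  have hcl : p ∈ closure (Iio (0 : ℝ)) := by rw [closure_Iio]; exact hp
  have hc : Continuous fun p : ℝ => fderiv ℝ F (y, p) :=
    (hF.contDiff.continuous_fderiv (by simp)).comp (by fun_prop)
  exact (isClosed_singleton.preimage hc).closure_subset_iff.2 (fun q hq => hneg q hq) hcl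

theorem fderiv (hF : IsFlat F) : IsFlat (fderiv ℝ F) :=
  ⟨hF.contDiff.fderiv_right (by simp), hF.fderiv_eq_zero⟩

theorem hadamard (hF : IsFlat F) : IsFlat (hadamard F) := by
  constructor
  · refine contDiff_intervalIntegral
      (F := fun x : (V × ℝ) × ℝ => _root_.fderiv ℝ F (x.1.1, x.2 * x.1.2) (0, 1)) ?_ 0 1
    refine ContDiff.clm_apply ?_ contDiff_const
    exact (hF.contDiff.fderiv_right (m := ∞) (by simp)).comp (by fun_prop)
  · intro y p hp
    unfold TripleLine.hadamard
    rw [intervalIntegral.integral_congr (g := fun _ => 0)]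
    · simp
    · intro θ hθ
      simp only [zero_le_one, uIcc_of_le, mem_Icc] at hθ
      simp [hF.fderiv_eq_zero y (θ * p) (mul_nonpos_of_nonneg_of_nonpos hθ.1 hp)]

theorem smul_hadamard [CompleteSpace W] (hF : IsFlat F) (y : V) (p : ℝ) :
    p • TripleLine.hadamard F (y, p) = F (y, p) := by
  unfold TripleLine.hadamard
  have hd : ∀ θ : ℝ, HasDerivAt (fun θ : ℝ => F (y, θ * p))
      (p • _root_.fderiv ℝ F (y, θ * p) (0, 1)) θ := by
    intro θ
    have h1 := ((hF.contDiff.differentiable (by simp)).differentiableAt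
      (x := (y, θ * p))).hasFDerivAt
    have h2 : HasDerivAt (fun θ : ℝ => (y, θ * p)) (0, p) θ := by
      simpa using (hasDerivAt_const θ y).prodMk ((hasDerivAt_id θ).mul_const p)
    have h3 : p • _root_.fderiv ℝ F (y, θ * p) (0, 1) = _root_.fderiv ℝ F (y, θ * p) (0, p) := by
      rw [← map_smul]; simp
    rw [h3]
    exact h1.comp_hasDerivAt θ h2
  have hc : Continuous fun θ : ℝ => p • _root_.fderiv ℝ F (y, θ * p) (0, 1) := by
    refine continuous_const.smul (Continuous.clm_apply ?_ continuous_const)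
    exact (hF.contDiff.continuous_fderiv (by simp)).comp (by fun_prop)
  rw [← intervalIntegral.integral_smul,
    intervalIntegral.integral_eq_sub_of_hasDerivAt (fun θ _ => hd θ) (hc.intervalIntegrable _ _)]
  simp [hF.eq_zero y 0 le_rfl]

end IsFlat

/-- Substitution of the square root in the second variable. -/
noncomputable def compSqrt (F : V × ℝ → W) (x : V × ℝ) : W := F (x.1, √x.2)

theorem compSqrt_of_nonpos {F : V × ℝ → W} (hF : IsFlat F) {x : V × ℝ} (hx : x.2 ≤ 0) :
    compSqrt F x = 0 := by
  rw [compSqrt, Real.sqrt_eq_zero_of_nonpos hx, hF.eq_zero _ _ le_rfl]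

/-- The derivative of `compSqrt F` is `compSqrt` of this function. -/
noncomputable def sqrtFDeriv (F : V × ℝ → W) (x : V × ℝ) : V × ℝ →L[ℝ] W :=
  (fderiv ℝ F x).comp ((ContinuousLinearMap.inl ℝ V ℝ).comp (ContinuousLinearMap.fst ℝ V ℝ)) +
    (1 / 2 : ℝ) • (hadamard (fderiv ℝ F) x).comp
      ((ContinuousLinearMap.inr ℝ V ℝ).comp (ContinuousLinearMap.snd ℝ V ℝ))

/-- The singular factor `1 / (2√p)` of the chain rule is absorbed by Hadamard's quotient of the
derivative. Since the result is flat again, differentiation can be iterated. -/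
theorem IsFlat.sqrtFDeriv {F : V × ℝ → W} (hF : IsFlat F) : IsFlat (sqrtFDeriv F) := by
  constructor
  · unfold TripleLine.sqrtFDeriv
    exact (hF.fderiv.contDiff.clm_comp contDiff_const).add
      ((hF.fderiv.hadamard.contDiff.clm_comp contDiff_const).const_smul (1 / 2 : ℝ))
  · intro y p hp
    simp [TripleLine.sqrtFDeriv, hF.fderiv.eq_zero y p hp, hF.fderiv.hadamard.eq_zero y p hp]

theorem continuous_compSqrt {F : V × ℝ → W} (hF : IsFlat F) : Continuous (compSqrt F) :=
  hF.contDiff.continuous.comp (by fun_prop)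

theorem hasFDerivAt_compSqrt [CompleteSpace W] {F : V × ℝ → W} (hF : IsFlat F) (x : V × ℝ) :
    HasFDerivAt (compSqrt F) (compSqrt (sqrtFDeriv F) x) x := by
  rcases le_or_gt x.2 0 with hx | hx
  · rw [compSqrt_of_nonpos hF.sqrtFDeriv hx]
    -- Dividing twice by `√p` produces a full factor `p`, with a cofactor that tends to zero at `p =
    -- 0`; so the derivative there is zero.
    have key : ∀ z : V × ℝ, compSqrt F z = z.2 • compSqrt (hadamard (hadamard F)) z := by
      intro z
      rcases le_or_gt z.2 0 with hz | hz
      · rw [compSqrt_of_nonpos hF hz, compSqrt_of_nonpos hF.hadamard.hadamard hz, smul_zero]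
      · unfold compSqrt
        rw [← hF.smul_hadamard, ← hF.hadamard.smul_hadamard, smul_smul, Real.mul_self_sqrt hz.le]
    rcases hx.lt_or_eq with hx | hx
    · have : compSqrt F =ᶠ[𝓝 x] fun _ => 0 := by
        filter_upwards [continuous_snd.continuousAt.eventually_lt_const hx] with z hz
        exact compSqrt_of_nonpos hF hz.le
      exact (hasFDerivAt_const (0 : W) x).congr_of_eventuallyEq this
    · refine HasFDerivAtFilter.of_isLittleO ?_
      rw [Asymptotics.isLittleO_iff]
      intro c hc
      have h0 : Tendsto (fun z => ‖compSqrt (hadamard (hadamard F)) z‖) (𝓝 x) (𝓝 0) := by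
        have := (continuous_compSqrt hF.hadamard.hadamard).norm.tendsto x
        rwa [compSqrt_of_nonpos hF.hadamard.hadamard hx.le, norm_zero] at this
      have h1 : ∀ᶠ z in 𝓝 x, ‖compSqrt F z - compSqrt F x - (0 : V × ℝ →L[ℝ] W) (z - x)‖ ≤
          c * ‖z - x‖ := by
        filter_upwards [h0.eventually_lt_const hc] with z hz
        rw [compSqrt_of_nonpos hF hx.le, key z]
        simp only [sub_zero, zero_apply, norm_smul]
        rw [mul_comm]
        have : ‖z.2‖ ≤ ‖z - x‖ := by
          have := norm_snd_le (z - x)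
          simpa [hx] using this
        gcongr
      simpa [Filter.prod_pure] using h1
  · have hs := Real.sqrt_pos.2 hx
    have h1 := ((hF.contDiff.differentiable (by simp)).differentiableAt
      (x := (x.1, √x.2))).hasFDerivAt
    have h2 : HasFDerivAt (fun z : V × ℝ => (z.1, √z.2)) _ x :=
      (hasFDerivAt_fst (𝕜 := ℝ) (p := x)).prodMk ((hasFDerivAt_snd (𝕜 := ℝ) (p := x)).sqrt hx.ne')
    have h5 : compSqrt (sqrtFDeriv F) x = (fderiv ℝ F (x.1, √x.2)).comp
        ((ContinuousLinearMap.fst ℝ V ℝ).prod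
          ((1 / (2 * √x.2)) • ContinuousLinearMap.snd ℝ V ℝ)) := by
     ext v
     · simp [compSqrt, sqrtFDeriv, show ((0 : V), (0 : ℝ)) = 0 from rfl]
     · have h3 := hF.fderiv.smul_hadamard x.1 √x.2
       have h4 : hadamard (fderiv ℝ F) (x.1, √x.2) = (√x.2)⁻¹ • fderiv ℝ F (x.1, √x.2) := by
         rw [← h3, smul_smul, inv_mul_cancel₀ hs.ne', one_smul]
       simp only [compSqrt, sqrtFDeriv, h4]
       simp only [ContinuousLinearMap.coe_comp, Function.comp_apply, ContinuousLinearMap.inr_apply,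
         add_apply, ContinuousLinearMap.coe_fst', ContinuousLinearMap.inl_apply,
         smul_apply, ContinuousLinearMap.coe_snd',
         ContinuousLinearMap.prod_apply, smul_eq_mul, mul_one]
       rw [show ((0 : V), 1 / (2 * √x.2)) = (1 / (2 * √x.2)) • ((0 : V), (1 : ℝ)) by simp, map_smul,
         show ((0 : V), (0 : ℝ)) = 0 from rfl, map_zero, zero_add, smul_smul]
       congr 1
       field_simp
    rw [h5]
    exact h1.comp x h2

theorem contDiff_compSqrt_nat (n : ℕ) : ∀ {W : Type} [NormedAddCommGroup W] [NormedSpace ℝ W]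
    [CompleteSpace W] {F : V × ℝ → W}, IsFlat F → ContDiff ℝ n (compSqrt F) := by
  induction n with
  | zero => intro W _ _ _ F hF; exact contDiff_zero.2 (continuous_compSqrt hF)
  | succ n ih =>
    intro W _ _ _ F hF
    exact contDiff_succ_iff_hasFDerivAt.2 ⟨_, ih hF.sqrtFDeriv, hasFDerivAt_compSqrt hF⟩

/-- A flat function vanishes to infinite order at `p = 0`, which outweighs the singularity of the
root. -/
theorem contDiff_compSqrt [CompleteSpace W] {F : V × ℝ → W} (hF : IsFlat F) :
    ContDiff ℝ ∞ (compSqrt F) :=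
  contDiff_infty.2 fun n => contDiff_compSqrt_nat n hF

end SquareRoot

/-! ### The Hilbert transform without a principal value -/

section Hilbert

variable {g : ℝ → ℝ}

/-- The symmetric difference quotient in the folded principal value is an average of `g'`, which has
no singularity at `v = 0`. -/
theorem integral_deriv_symm (hg : ContDiff ℝ 1 g) (s : ℝ) {v : ℝ} (hv : v ≠ 0) :
    ∫ θ in (-1 : ℝ)..1, deriv g (s + v * θ) = (g (s + v) - g (s - v)) / v := by
  rw [intervalIntegral.integral_comp_add_mul _ hv,
    intervalIntegral.integral_deriv_eq_sub (fun x _ => hg.differentiable one_ne_zero x)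
      ((hg.continuous_deriv le_rfl).intervalIntegrable _ _), smul_eq_mul]
  rw [show s + v * 1 = s + v by ring, show s + v * -1 = s - v by ring]
  field_simp

/-- The Hilbert transform of a function with support in `[-1, 1]`, as an integral over a box. -/
noncomputable def hilbertBox (g : ℝ → ℝ) (R s : ℝ) : ℝ :=
  -(1 / Real.pi) * ∫ v in (0 : ℝ)..R, ∫ θ in (-1 : ℝ)..1, deriv g (s + v * θ)

/-- The two half-lines `|s - t| > ε` are folded onto `v > ε` by `t = s ± v`. The bound on `R` puts
both `s + v` and `s - v` outside `[-1, 1]` once `v > R`. -/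
theorem truncatedHilbert_eq (hg : ContDiff ℝ 1 g) (h0 : ∀ t, 1 < |t| → g t = 0) {R s ε : ℝ}
    (hR : |s| + 1 ≤ R) (hε : 0 < ε) (hεR : ε < R) : truncatedHilbert g s ε =
      -(1 / Real.pi) * ∫ v in ε..R, ∫ θ in (-1 : ℝ)..1, deriv g (s + v * θ) := by
  have hcs : HasCompactSupport g := by
    refine HasCompactSupport.of_support_subset_isCompact (isCompact_Icc (a := -1) (b := 1)) ?_
    intro t ht
    by_contra h
    exact ht (h0 t (by rw [mem_Icc, ← abs_le] at h; exact not_le.1 h))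
  have hint : Integrable fun v => g (s - v) :=
    (hg.continuous.integrable_of_hasCompactSupport hcs).comp_sub_left s
  have hmeas : Measurable fun v => g (s - v) / v :=
    (hg.continuous.comp (by fun_prop : Continuous fun v : ℝ => s - v)).measurable.div measurable_id
  have hbound : ∀ A : Set ℝ, MeasurableSet A → (∀ v ∈ A, ε ≤ |v|) →
      IntegrableOn (fun v => g (s - v) / v) A := by
    intro A hA h
    refine Integrable.mono' (g := fun v => ‖g (s - v)‖ * ε⁻¹) ?_ hmeas.aestronglyMeasurable ?_
    · exact (hint.norm.mul_const _).integrableOn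
    · refine (ae_restrict_iff' hA).2 (.of_forall fun v hv => ?_)
      rw [norm_div, div_eq_mul_inv]
      have := h v hv
      gcongr
      exact this
  have e1 : ∫ t in {t : ℝ | ε < |s - t|}, g t / (s - t) =
      ∫ v in {v : ℝ | ε < |v|}, g (s - v) / v := by
    rw [← integral_indicator (measurableSet_lt measurable_const (by fun_prop)),
      ← integral_indicator (measurableSet_lt measurable_const (by fun_prop)),
      ← integral_sub_left_eq_self _ volume s]
    congr 1
    ext v
    simp [indicator]
  have e2 : {v : ℝ | ε < |v|} = Iio (-ε) ∪ Ioi ε := by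
    ext v
    simp only [mem_ofPred_eq, lt_abs, mem_union, mem_Iio, mem_Ioi]
    constructor
    · rintro (h | h)
      · exact Or.inr h
      · exact Or.inl (by linarith)
    · rintro (h | h)
      · exact Or.inr (by linarith)
      · exact Or.inl h
  have hdis : Disjoint (Iio (-ε)) (Ioi ε) := by
    rw [Set.disjoint_left]
    intro v h1 h2
    simp only [mem_Iio, mem_Ioi] at h1 h2
    linarith
  have i1 : IntegrableOn (fun v => g (s - v) / v) (Iio (-ε)) :=
    hbound _ measurableSet_Iio fun v hv => by
      rw [mem_Iio] at hv; rw [abs_of_neg (by linarith)]; linarith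
  have i2 : IntegrableOn (fun v => g (s - v) / v) (Ioi ε) :=
    hbound _ measurableSet_Ioi fun v hv => by
      rw [mem_Ioi] at hv; rw [abs_of_pos (by linarith)]; linarith
  have e3 : ∫ v in Iio (-ε), g (s - v) / v = ∫ v in Ioi ε, -(g (s + v) / v) := by
    rw [← integral_Iic_eq_integral_Iio, ← integral_comp_neg_Ioi]
    congr 1; ext v; rw [sub_neg_eq_add, div_neg]
  have i3 : IntegrableOn (fun v => -(g (s + v) / v)) (Ioi ε) := by
    have := ((Measure.measurePreserving_neg (volume : Measure ℝ)).integrableOn_comp_preimage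
      (Homeomorph.neg ℝ).measurableEmbedding).2 i1
    simpa [Function.comp_def, div_neg] using this
  have hz : ∀ v, R < v → g (s + v) = 0 ∧ g (s - v) = 0 := by
    intro v hv
    have := neg_abs_le s
    have := le_abs_self s
    exact ⟨h0 _ (lt_abs.2 (Or.inl (by linarith))), h0 _ (lt_abs.2 (Or.inr (by linarith)))⟩
  have e4 : ∫ v in Ioc ε R, (-(g (s + v) / v) + g (s - v) / v) =
      ∫ v in Ioi ε, (-(g (s + v) / v) + g (s - v) / v) := by
    refine (setIntegral_eq_of_subset_of_forall_sdiff_eq_zero measurableSet_Ioi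
      (fun v hv => hv.1) fun v hv => ?_).symm
    have : R < v := by
      by_contra h
      exact hv.2 ⟨hv.1, not_lt.1 h⟩
    simp [hz v this]
  rw [truncatedHilbert, e1, e2, setIntegral_union hdis measurableSet_Ioi i1 i2, e3,
    ← integral_add i3 i2, ← e4, intervalIntegral.integral_of_le hεR.le, neg_mul, ← mul_neg,
    ← integral_neg]
  congr 1
  refine setIntegral_congr_fun measurableSet_Ioc fun v hv => ?_
  rw [integral_deriv_symm hg s (hε.trans hv.1).ne']
  ring

theorem tendsto_truncatedHilbert (hg : ContDiff ℝ 1 g) (h0 : ∀ t, 1 < |t| → g t = 0) {R s : ℝ}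
    (hR : |s| + 1 ≤ R) : Tendsto (truncatedHilbert g s) (𝓝[>] 0) (𝓝 (hilbertBox g R s)) := by
  have hRp : 0 < R := by have := abs_nonneg s; linarith
  have hc : Continuous fun v : ℝ => ∫ θ in (-1 : ℝ)..1, deriv g (s + v * θ) := by
    refine intervalIntegral.continuous_parametric_intervalIntegral_of_continuous'
      (f := fun v θ => deriv g (s + v * θ)) ?_ _ _
    exact (hg.continuous_deriv le_rfl).comp (by fun_prop)
  have hp : Continuous fun ε : ℝ => -(1 / Real.pi) *
      ∫ v in ε..R, ∫ θ in (-1 : ℝ)..1, deriv g (s + v * θ) := by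
    refine continuous_const.mul ?_
    simp_rw [intervalIntegral.integral_symm R]
    exact (intervalIntegral.continuous_primitive (fun a b => hc.intervalIntegrable a b) R).neg
  refine ((hp.tendsto 0).mono_left nhdsWithin_le_nhds).congr' ?_
  filter_upwards [Ioo_mem_nhdsGT hRp] with ε hε
  exact (truncatedHilbert_eq hg h0 hR hε.1 hε.2).symm

theorem hilbert_eq (hg : ContDiff ℝ 1 g) (h0 : ∀ t, 1 < |t| → g t = 0) {R s : ℝ}
    (hR : |s| + 1 ≤ R) : hilbert g s = hilbertBox g R s :=
  (tendsto_truncatedHilbert hg h0 hR).limUnder_eq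

end Hilbert

/-! ### Polar coordinates for `toSphere` -/

section Polar

variable {E : Type*} [NormedAddCommGroup E] [NormedSpace ℝ E] [MeasurableSpace E] [BorelSpace E]
  [FiniteDimensional ℝ E] [Nontrivial E] (μ : Measure E) [μ.IsAddHaarMeasure]

theorem integral_volumeIoiPow (n : ℕ) (ρ : ℝ → ℝ) :
    ∫ r : Ioi (0 : ℝ), ρ r ∂(Measure.volumeIoiPow n) = ∫ r in Ioi (0 : ℝ), r ^ n * ρ r := by
  simp only [Measure.volumeIoiPow, ENNReal.ofReal]
  rw [integral_withDensity_eq_integral_smul,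
    integral_subtype_comap measurableSet_Ioi fun a ↦ Real.toNNReal (a ^ n) • ρ a,
    setIntegral_congr_fun measurableSet_Ioi fun x hx ↦ ?_]
  · rw [NNReal.smul_def, Real.coe_toNNReal _ (pow_nonneg hx.out.le _), smul_eq_mul]
  · exact (measurable_subtype_coe.pow_const _).real_toNNReal

/-- No integrability is needed, since a measure preserving homeomorphism transports all Bochner
integrals. -/
theorem integral_polar_prod (h ρ : E → ℝ) :
    ∫ x, h (‖x‖⁻¹ • x) * ρ x ∂μ =
      ∫ p, h p.1 * ρ ((p.2 : ℝ) • (p.1 : E)) ∂(μ.toSphere.prod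
        (Measure.volumeIoiPow (Module.finrank ℝ E - 1))) := by
  have := μ.measurePreserving_homeomorphUnitSphereProd.integral_comp
        (Homeomorph.measurableEmbedding _)
        (fun p => h p.1 * ρ ((p.2 : ℝ) • (p.1 : E)))
  have e : ∫ x, h (‖x‖⁻¹ • x) * ρ x ∂μ =
      ∫ x : ({0}ᶜ : Set E), h (‖(x : E)‖⁻¹ • (x : E)) * ρ x ∂(μ.comap (↑)) := by
    rw [integral_subtype_comap (measurableSet_singleton _).compl fun x ↦ h (‖x‖⁻¹ • x) * ρ x,
      restrict_compl_singleton]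
  rw [← this, e]
  refine congrArg (fun F : ({0}ᶜ : Set E) → ℝ => ∫ x, F x ∂(μ.comap (↑))) (funext fun x => ?_)
  simp [smul_smul, mul_inv_cancel₀ (norm_ne_zero_iff.2 x.2)]

/-- Polar coordinates, for a product of a function of the direction and a function of the norm. -/
theorem integral_direction_mul_norm (h : E → ℝ) (ρ : ℝ → ℝ) :
    ∫ x, h (‖x‖⁻¹ • x) * ρ ‖x‖ ∂μ = (∫ n, h n ∂μ.toSphere) *
      ∫ r in Ioi (0 : ℝ), r ^ (Module.finrank ℝ E - 1) * ρ r := by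
  rw [integral_polar_prod μ h fun x => ρ ‖x‖, ← integral_volumeIoiPow,
    ← integral_prod_mul]
  refine integral_congr_ae (.of_forall fun p => ?_)
  have : ‖(p.1 : E)‖ = 1 := norm_eq_of_mem_sphere p.1
  simp [norm_smul, this, abs_of_pos p.2.2.out]

/-- Polar coordinates. -/
theorem integral_polar {H : E → ℝ} (hH : Integrable H μ) :
    ∫ x, H x ∂μ = ∫ n : Metric.sphere (0 : E) 1, (∫ r in Ioi (0 : ℝ),
      r ^ (Module.finrank ℝ E - 1) * H (r • (n : E))) ∂μ.toSphere := by
  have h1 := integral_polar_prod μ (fun _ => 1) H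
  simp only [one_mul] at h1
  have hi : Integrable (fun p : Metric.sphere (0 : E) 1 × Ioi (0 : ℝ) => H ((p.2 : ℝ) • (p.1 : E)))
      (μ.toSphere.prod (Measure.volumeIoiPow (Module.finrank ℝ E - 1))) := by
    rw [← μ.measurePreserving_homeomorphUnitSphereProd.integrable_comp_emb
      (Homeomorph.measurableEmbedding _)]
    have := hH.integrableOn (s := {0}ᶜ)
    rw [integrableOn_iff_comap_subtypeVal (measurableSet_singleton _).compl] at this
    refine this.congr (.of_forall fun x => ?_)
    simp [smul_smul, mul_inv_cancel₀ (norm_ne_zero_iff.2 x.2)]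
  rw [h1, integral_prod _ hi]
  refine integral_congr_ae (.of_forall fun n => ?_)
  exact integral_volumeIoiPow _ fun r => H (r • (n : E))

end Polar

/-! ### Arc length in terms of the angle -/

section Circle

/-- The unit vector with a given angle. -/
noncomputable def circ (θ : ℝ) : E2 := !₂[Real.cos θ, Real.sin θ]

theorem integral_plane (H : E2 → ℝ) :
    ∫ x, H x = ∫ p : ℝ × ℝ, H !₂[p.1, p.2] := by
  rw [← (EuclideanSpace.volume_preserving_symm_measurableEquiv_toLp (Fin 2)).symm.integral_comp
    (MeasurableEquiv.measurableEmbedding _),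
    ← (volume_preserving_finTwoArrow ℝ).symm.integral_comp (MeasurableEquiv.measurableEmbedding _)]
  rfl

/-- The integral of `h (x / ‖x‖) * exp (-‖x‖²)` over the plane is computed twice, in the abstract
polar coordinates of `toSphere` and in the explicit ones; both contain the same radial factor `1 /
2`, which cancels. -/
theorem integral_arcS1 (h : E2 → ℝ) :
    ∫ b, h b ∂arcS1 = ∫ θ in (-Real.pi)..Real.pi, h (circ θ) := by
  have h1 := integral_direction_mul_norm (volume : Measure E2) h (fun r => Real.exp (-r ^ 2))
  rw [integral_plane, ← integral_comp_polarCoord_symm] at h1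
  have hK : ∫ r in Ioi (0 : ℝ), r * Real.exp (-r ^ 2) = 1 / 2 := by
    have := integral_rpow_mul_exp_neg_rpow (p := 2) (q := 1) (by norm_num) (by norm_num)
    simpa using this
  have h2 : ∫ p in polarCoord.target, p.1 • (h (‖(!₂[(polarCoord.symm p).1,
      (polarCoord.symm p).2] : E2)‖⁻¹ • !₂[(polarCoord.symm p).1, (polarCoord.symm p).2]) *
      Real.exp (-‖(!₂[(polarCoord.symm p).1, (polarCoord.symm p).2] : E2)‖ ^ 2)) =
      ∫ p in Ioi (0 : ℝ) ×ˢ Ioo (-Real.pi) Real.pi,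
        (p.1 * Real.exp (-p.1 ^ 2)) * h (circ p.2) := by
    refine setIntegral_congr_fun (measurableSet_Ioi.prod measurableSet_Ioo) fun p hp => ?_
    have hp1 : 0 < p.1 := hp.1
    have e : (!₂[(polarCoord.symm p).1, (polarCoord.symm p).2] : E2) = p.1 • circ p.2 := by
      ext i; fin_cases i <;> simp [circ]
    have hc : ‖circ p.2‖ = 1 := by
      simp [circ, EuclideanSpace.norm_eq]
    simp only [e, norm_smul, hc, Real.norm_eq_abs, abs_of_pos hp1, mul_one, smul_smul,
      inv_mul_cancel₀ hp1.ne', one_smul, smul_eq_mul]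
    ring
  rw [h2, Measure.volume_eq_prod, ← Measure.prod_restrict,
    integral_prod_mul (fun r : ℝ => r * Real.exp (-r ^ 2)) (fun θ => h (circ θ)), hK] at h1
  simp only [finrank_euclideanSpace, Fintype.card_fin, Nat.add_one_sub_one, pow_one, hK] at h1
  rw [arcS1, intervalIntegral.integral_of_le (by linarith [Real.pi_pos]),
    integral_Ioc_eq_integral_Ioo]
  linarith

end Circle

theorem intervalIntegral_swap {f : ℝ → ℝ → ℝ} (hf : Continuous (Function.uncurry f)) {a b c d : ℝ}
    (hab : a ≤ b) (hcd : c ≤ d) :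
    ∫ x in a..b, ∫ y in c..d, f x y = ∫ y in c..d, ∫ x in a..b, f x y := by
  simp only [intervalIntegral.integral_of_le hab, intervalIntegral.integral_of_le hcd]
  refine integral_integral_swap ?_
  rw [Measure.prod_restrict]
  exact (hf.continuousOn.integrableOn_compact (isCompact_Icc.prod isCompact_Icc)).mono_set
    (prod_mono Ioc_subset_Icc_self Ioc_subset_Icc_self)

/-! ### The radial integral behind filtered backprojection -/

section Radial

variable {A : ℝ → ℝ}

/-- The quotient of the derivative of an even function by the variable. -/
noncomputable def radialQuotient (A : ℝ → ℝ) (ρ : ℝ) : ℝ :=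
  ∫ θ in (0 : ℝ)..1, deriv (deriv A) (ρ * θ)

theorem continuous_radialQuotient (hA : ContDiff ℝ 2 A) : Continuous (radialQuotient A) := by
  refine intervalIntegral.continuous_parametric_intervalIntegral_of_continuous'
    (f := fun ρ θ => deriv (deriv A) (ρ * θ)) ?_ 0 1
  have : ContDiff ℝ 1 (deriv A) := hA.deriv'
  exact (this.continuous_deriv le_rfl).comp (by fun_prop)

/-- Evenness forces `A' 0 = 0`, so `A'` is divisible by its variable. -/
theorem mul_radialQuotient (hA : ContDiff ℝ 2 A) (hev : ∀ ρ, A (-ρ) = A ρ) (ρ : ℝ) :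
    ρ * radialQuotient A ρ = deriv A ρ := by
  have h1 : ContDiff ℝ 1 (deriv A) := hA.deriv'
  have h0 : deriv A 0 = 0 := by
    have : deriv (fun ρ => A (-ρ)) 0 = -deriv A (-0) := deriv_comp_neg ..
    simp only [hev, neg_zero] at this
    have h : deriv (fun ρ => A ρ) 0 = deriv A 0 := rfl
    linarith
  rcases eq_or_ne ρ 0 with rfl | hρ
  · simp [h0]
  · rw [radialQuotient, intervalIntegral.integral_comp_mul_left _ hρ, mul_zero, mul_one,
      intervalIntegral.integral_deriv_eq_sub (fun x _ => h1.differentiable one_ne_zero x)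
        ((h1.continuous_deriv le_rfl).intervalIntegrable _ _), h0, smul_eq_mul, sub_zero,
      mul_inv_cancel_left₀ hρ]

theorem radialQuotient_eq_zero (hA : ContDiff ℝ 2 A) (hev : ∀ ρ, A (-ρ) = A ρ) {L : ℝ}
    (hL : 0 < L) (h0 : ∀ ρ, L ≤ ρ → A ρ = 0) {ρ : ℝ} (hρ : L < ρ) : radialQuotient A ρ = 0 := by
  have h1 := mul_radialQuotient hA hev ρ
  have h2 : A =ᶠ[𝓝 ρ] fun _ => 0 := by
    filter_upwards [eventually_gt_nhds hρ] with x hx using h0 x hx.le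
  rw [h2.deriv_eq, deriv_const] at h1
  exact (mul_eq_zero.1 h1).resolve_left (hL.trans hρ).ne'

theorem hasDerivAt_radial (hA : ContDiff ℝ 2 A) (hev : ∀ ρ, A (-ρ) = A ρ) (L : ℝ) {v : ℝ}
    (hv : 0 < v) : HasDerivAt (fun v => ∫ τ in (-L)..L, A √(v ^ 2 + τ ^ 2))
      (∫ τ in (-L)..L, v * radialQuotient A √(v ^ 2 + τ ^ 2)) v := by
  have hE := continuous_radialQuotient hA
  have hc : Continuous fun p : ℝ × ℝ => p.1 * radialQuotient A √(p.1 ^ 2 + p.2 ^ 2) := by fun_prop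
  obtain ⟨C, hC⟩ := ((isCompact_Icc (a := v / 2) (b := 2 * v)).prod
    (isCompact_uIcc (a := -L) (b := L))).bddAbove_image hc.norm.continuousOn
  have hAc := hA.continuous
  refine (intervalIntegral.hasDerivAt_integral_of_dominated_loc_of_deriv_le (bound := fun _ => C)
    (F := fun v τ => A √(v ^ 2 + τ ^ 2))
    (F' := fun v τ => v * radialQuotient A √(v ^ 2 + τ ^ 2)) (s := Icc (v / 2) (2 * v))
    (Icc_mem_nhds (by linarith) (by linarith)) ?_ ?_ ?_ ?_ ?_ ?_).2
  · exact .of_forall fun w => (by fun_prop : Continuous _).aestronglyMeasurable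
  · exact (by fun_prop : Continuous _).intervalIntegrable _ _
  · exact (by fun_prop : Continuous _).aestronglyMeasurable
  · exact .of_forall fun τ hτ w hw => hC ⟨(w, τ), ⟨hw, uIoc_subset_uIcc hτ⟩, rfl⟩
  · exact intervalIntegrable_const
  · refine .of_forall fun τ _ w hw => ?_
    have hw0 : 0 < w := by linarith [hw.1]
    have hp : 0 < w ^ 2 + τ ^ 2 := by positivity
    have h1 : HasDerivAt (fun w => √(w ^ 2 + τ ^ 2)) (w / √(w ^ 2 + τ ^ 2)) w := by
      refine (((hasDerivAt_pow 2 w).add_const (τ ^ 2)).sqrt hp.ne').congr_deriv ?_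
      rw [pow_one, Nat.cast_ofNat, mul_div_mul_left _ _ two_ne_zero]
    have h2 := ((hA.differentiable (by simp)) √(w ^ 2 + τ ^ 2)).hasDerivAt.comp w h1
    refine h2.congr_deriv ?_
    rw [← mul_radialQuotient hA hev]
    have := (Real.sqrt_pos.2 hp).ne'
    field_simp

/-- This is a radial integral over a half-plane. In polar coordinates the quotient `A' ρ / ρ` loses
its denominator to the area density, which leaves `π ∫ A' = -π A 0`. -/
theorem integral_radialQuotient (hA : ContDiff ℝ 2 A) (hev : ∀ ρ, A (-ρ) = A ρ) {L : ℝ}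
    (hL : 0 < L) (h0 : ∀ ρ, L ≤ ρ → A ρ = 0) {R : ℝ} (hR : L ≤ R) :
    ∫ v in (0 : ℝ)..R, ∫ τ in (-L)..L, radialQuotient A √(v ^ 2 + τ ^ 2) = -Real.pi * A 0 := by
  have hE := continuous_radialQuotient hA
  have hz := fun ρ => radialQuotient_eq_zero hA hev hL h0 (ρ := ρ)
  have hvol : (volume : Measure E2).real (Metric.ball 0 1) = Real.pi := by
    simp [Measure.real, InnerProductSpace.volume_ball_of_dim_even (k := 1) (E := E2) (by simp),
      Real.pi_pos.le]
  have h1 := integral_fun_norm_addHaar (volume : Measure E2) (radialQuotient A)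
  rw [hvol, integral_plane] at h1
  have hn : ∀ p : ℝ × ℝ, ‖(!₂[p.1, p.2] : E2)‖ = √(p.1 ^ 2 + p.2 ^ 2) := by
    intro p; simp [EuclideanSpace.norm_eq]
  simp only [hn] at h1
  have hsupp : ∀ v τ, L < |v| ∨ L < |τ| → radialQuotient A √(v ^ 2 + τ ^ 2) = 0 := by
    intro v τ h
    apply hz
    rcases h with h | h
    · exact h.trans_le (Real.abs_le_sqrt (by nlinarith [sq_nonneg τ]))
    · exact h.trans_le (Real.abs_le_sqrt (by nlinarith [sq_nonneg v]))
  have hint : Integrable fun p : ℝ × ℝ => radialQuotient A √(p.1 ^ 2 + p.2 ^ 2) := by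
    refine Continuous.integrable_of_hasCompactSupport (by fun_prop) ?_
    refine HasCompactSupport.of_support_subset_isCompact
      ((isCompact_Icc (a := -L) (b := L)).prod (isCompact_Icc (a := -L) (b := L))) ?_
    intro p hp
    by_contra h
    refine hp (hsupp _ _ ?_)
    by_contra h'
    push Not at h'
    exact h ⟨abs_le.1 h'.1, abs_le.1 h'.2⟩
  have hP : ∀ v, ∫ τ, radialQuotient A √(v ^ 2 + τ ^ 2) =
      ∫ τ in (-L)..L, radialQuotient A √(v ^ 2 + τ ^ 2) := by
    intro v
    rw [intervalIntegral.integral_of_le (by linarith), ← integral_Icc_eq_integral_Ioc]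
    refine (setIntegral_eq_integral_of_forall_compl_eq_zero fun τ hτ => ?_).symm
    refine hsupp _ _ (Or.inr ?_)
    rwa [mem_Icc, ← abs_le, not_le] at hτ
  rw [Measure.volume_eq_prod, integral_prod _ hint] at h1
  simp only [hP] at h1
  have h2 := integral_comp_abs
    (f := fun v => ∫ τ in (-L)..L, radialQuotient A √(v ^ 2 + τ ^ 2))
  simp only [sq_abs] at h2
  have h3 : ∫ v in Ioi 0, ∫ τ in (-L)..L, radialQuotient A √(v ^ 2 + τ ^ 2) =
      ∫ v in (0 : ℝ)..R, ∫ τ in (-L)..L, radialQuotient A √(v ^ 2 + τ ^ 2) := by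
    rw [intervalIntegral.integral_of_le (hL.le.trans hR)]
    refine setIntegral_eq_of_subset_of_forall_sdiff_eq_zero measurableSet_Ioi
      (fun v hv => hv.1) fun v hv => ?_
    have : R < v := by
      by_contra h
      exact hv.2 ⟨hv.1, not_lt.1 h⟩
    rw [← hP]
    have h4 : ∀ τ, radialQuotient A √(v ^ 2 + τ ^ 2) = 0 := fun τ =>
      hsupp _ _ (Or.inl (by linarith [le_abs_self v]))
    simp [h4]
  have h5 : ∫ y in Ioi (0 : ℝ), y ^ (Module.finrank ℝ E2 - 1) • radialQuotient A y = -A 0 := by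
    have : ∀ y, y ^ (Module.finrank ℝ E2 - 1) • radialQuotient A y = deriv A y := by
      intro y
      simp [mul_radialQuotient hA hev]
    simp only [this]
    have hd : Continuous (deriv A) := hA.continuous_deriv (by simp)
    have h6 : ∫ y in Ioi (0 : ℝ), deriv A y = ∫ y in (0 : ℝ)..L, deriv A y := by
      rw [intervalIntegral.integral_of_le hL.le]
      refine setIntegral_eq_of_subset_of_forall_sdiff_eq_zero measurableSet_Ioi
        (fun v hv => hv.1) fun v hv => ?_
      have : L < v := by
        by_contra h
        exact hv.2 ⟨hv.1, not_lt.1 h⟩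
      rw [← mul_radialQuotient hA hev, hz v this, mul_zero]
    rw [h6, intervalIntegral.integral_deriv_eq_sub (fun x _ => hA.differentiable (by simp) x)
      (hd.intervalIntegrable _ _), h0 L le_rfl, zero_sub]
  rw [h5, h2, h3] at h1
  simp only [finrank_euclideanSpace, Fintype.card_fin, smul_eq_mul, nsmul_eq_mul] at h1
  push_cast at h1
  linarith

/-- `N` is even, so the numerator is `2 * deriv N v`. Differentiation under the integral gives a
factor `v`, which cancels the denominator. -/
theorem integral_deriv_radial (hA : ContDiff ℝ 2 A) (hev : ∀ ρ, A (-ρ) = A ρ) {L : ℝ}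
    (hL : 0 < L) (h0 : ∀ ρ, L ≤ ρ → A ρ = 0) {R : ℝ} (hR : L ≤ R) {N : ℝ → ℝ}
    (hN : ∀ v, N v = ∫ τ in (-L)..L, A √(v ^ 2 + τ ^ 2)) :
    ∫ v in (0 : ℝ)..R, (deriv N v - deriv N (-v)) / v = -2 * Real.pi * A 0 := by
  have hd : ∀ v, 0 < v → (deriv N v - deriv N (-v)) / v =
      2 * ∫ τ in (-L)..L, radialQuotient A √(v ^ 2 + τ ^ 2) := by
    intro v hv
    have hN' : N = fun v => ∫ τ in (-L)..L, A √(v ^ 2 + τ ^ 2) := funext hN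
    have h1 : deriv (fun v => N (-v)) v = -deriv N (-v) := deriv_comp_neg ..
    have h2 : (fun v => N (-v)) = N := by
      ext v; simp [hN]
    rw [h2] at h1
    have h3 : deriv N v = v * ∫ τ in (-L)..L, radialQuotient A √(v ^ 2 + τ ^ 2) := by
      rw [hN', (hasDerivAt_radial hA hev L hv).deriv, intervalIntegral.integral_const_mul]
    rw [show deriv N v - deriv N (-v) = 2 * deriv N v by linarith, h3]
    field_simp
  have : ∫ v in (0 : ℝ)..R, (deriv N v - deriv N (-v)) / v =
      ∫ v in (0 : ℝ)..R, 2 * ∫ τ in (-L)..L, radialQuotient A √(v ^ 2 + τ ^ 2) := by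
    rw [intervalIntegral.integral_of_le (hL.le.trans hR),
      intervalIntegral.integral_of_le (hL.le.trans hR)]
    exact setIntegral_congr_fun measurableSet_Ioc fun v hv => hd v hv.1
  rw [this, intervalIntegral.integral_const_mul, integral_radialQuotient hA hev hL h0 hR]
  ring

end Radial

/-! ### Inversion of the Radon transform in the plane -/

section RadonTransform

/-- The rotation of a plane vector by a right angle. -/
noncomputable def perp2 (b : E2) : E2 := !₂[-b 1, b 0]

/-- The Radon transform of a function of the plane with support in the unit disc. -/
noncomputable def radon (G : E2 → ℝ) (b : E2) (s : ℝ) : ℝ :=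
  ∫ τ in (-1 : ℝ)..1, G (s • b + τ • perp2 b)

theorem norm_perp2 (b : E2) : ‖perp2 b‖ = ‖b‖ := by
  simp [perp2, EuclideanSpace.norm_eq, add_comm]

theorem inner_perp2 (b : E2) : ⟪b, perp2 b⟫_ℝ = 0 := by
  simp [perp2, PiLp.inner_apply, Fin.sum_univ_two]; ring

theorem norm_frame_sq {b : E2} (hb : ‖b‖ = 1) (s τ : ℝ) :
    ‖s • b + τ • perp2 b‖ ^ 2 = s ^ 2 + τ ^ 2 := by
  rw [norm_add_sq_real, inner_smul_left, inner_smul_right, inner_perp2, norm_smul, norm_smul,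
    norm_perp2, hb]
  simp

theorem frame_eq {b : E2} (hb : ‖b‖ = 1) (z : E2) : ⟪b, z⟫_ℝ • b + ⟪perp2 b, z⟫_ℝ • perp2 b = z := by
  have h : b 0 ^ 2 + b 1 ^ 2 = 1 := by
    have := EuclideanSpace.norm_sq_eq b
    rw [hb] at this
    simpa [Fin.sum_univ_two] using this.symm
  ext i
  fin_cases i
  · simp [perp2, PiLp.inner_apply, Fin.sum_univ_two]
    linear_combination (z 0) * h
  · simp [perp2, PiLp.inner_apply, Fin.sum_univ_two]
    linear_combination (z 1) * h

theorem norm_circ (θ : ℝ) : ‖circ θ‖ = 1 := by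
  simp [circ, EuclideanSpace.norm_eq]

theorem contDiff_circ : ContDiff ℝ ∞ circ := by
  refine (contDiff_piLp 2).2 fun i => ?_
  fin_cases i
  · exact Real.contDiff_cos
  · exact Real.contDiff_sin

theorem contDiff_perp2 : ContDiff ℝ ∞ perp2 := by
  refine (contDiff_piLp 2).2 fun i => ?_
  fin_cases i
  · exact ((contDiff_piLp 2).1 contDiff_id 1).neg
  · exact (contDiff_piLp 2).1 contDiff_id 0

variable {G : E2 → ℝ}

theorem radon_eq_zero (h0 : ∀ z, 1 ≤ ‖z‖ → G z = 0) {b : E2} (hb : ‖b‖ = 1) {s : ℝ}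
    (hs : 1 ≤ |s|) : radon G b s = 0 := by
  rw [radon, intervalIntegral.integral_congr (g := fun _ => 0), intervalIntegral.integral_zero]
  intro τ _
  refine h0 _ ?_
  have := norm_frame_sq hb s τ
  have h1 : 1 ≤ s ^ 2 := by rw [← sq_abs]; nlinarith
  nlinarith [sq_nonneg τ, norm_nonneg (s • b + τ • perp2 b)]

/-- The line is parametrized from the foot `z + v • b` instead of `v' • b`. This translates `τ` by
at most `‖z‖`, hence the wider limits. -/
theorem radon_shift (h0 : ∀ z, 1 ≤ ‖z‖ → G z = 0) {b : E2} (hb : ‖b‖ = 1) (z : E2) (v : ℝ) :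
    radon G b (⟪b, z⟫_ℝ + v) =
      ∫ τ in (-(‖z‖ + 1))..(‖z‖ + 1), G (z + v • b + τ • perp2 b) := by
  have h1 : radon G b (⟪b, z⟫_ℝ + v) = ∫ τ : ℝ, G ((⟪b, z⟫_ℝ + v) • b + τ • perp2 b) := by
    rw [radon, intervalIntegral.integral_of_le (by norm_num), ← integral_Icc_eq_integral_Ioc]
    refine setIntegral_eq_integral_of_forall_compl_eq_zero fun τ hτ => h0 _ ?_
    rw [mem_Icc, ← abs_le, not_le] at hτ
    have := norm_frame_sq hb (⟪b, z⟫_ℝ + v) τ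
    have h1 : 1 ≤ τ ^ 2 := by rw [← sq_abs]; nlinarith
    nlinarith [sq_nonneg (⟪b, z⟫_ℝ + v), norm_nonneg ((⟪b, z⟫_ℝ + v) • b + τ • perp2 b)]
  rw [h1, ← integral_add_right_eq_self _ ⟪perp2 b, z⟫_ℝ,
    intervalIntegral.integral_of_le (by linarith [norm_nonneg z]), ← integral_Icc_eq_integral_Ioc]
  have h2 : ∀ τ : ℝ, (⟪b, z⟫_ℝ + v) • b + (τ + ⟪perp2 b, z⟫_ℝ) • perp2 b =
      z + v • b + τ • perp2 b := by
    intro τ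
    conv_rhs => rw [← frame_eq hb z]
    module
  simp only [h2]
  refine (setIntegral_eq_integral_of_forall_compl_eq_zero fun τ hτ => h0 _ ?_).symm
  rw [mem_Icc, ← abs_le, not_le] at hτ
  have h3 := norm_frame_sq hb v τ
  have h4 : |τ| ≤ ‖v • b + τ • perp2 b‖ := by
    refine abs_le_of_sq_le_sq ?_ (norm_nonneg _) |> fun h => abs_le.2 (abs_le.1 (by simpa using h))
    nlinarith [sq_nonneg v]
  have h5 : ‖v • b + τ • perp2 b‖ ≤ ‖z + v • b + τ • perp2 b‖ + ‖z‖ := by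
    have := norm_sub_le (z + v • b + τ • perp2 b) z
    rwa [show z + v • b + τ • perp2 b - z = v • b + τ • perp2 b by abel] at this
  linarith

/-- The circular mean of `G` around `z`, times `2 * π`. -/
noncomputable def circularMean (G : E2 → ℝ) (z : E2) (ρ : ℝ) : ℝ :=
  ∫ θ in (-Real.pi)..Real.pi, G (z + ρ • circ θ)

theorem contDiff_circularMean (hG : ContDiff ℝ ∞ G) (z : E2) :
    ContDiff ℝ ∞ (circularMean G z) := by
  refine contDiff_intervalIntegral (F := fun p : ℝ × ℝ => G (z + p.1 • circ p.2)) ?_ _ _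
  exact hG.comp (contDiff_const.add (contDiff_fst.smul (contDiff_circ.comp contDiff_snd)))

theorem circ_add_pi (θ : ℝ) : circ (θ + Real.pi) = -circ θ := by
  ext i; fin_cases i <;> simp [circ]

theorem integral_circ_add (G : E2 → ℝ) (z : E2) (ρ ψ : ℝ) :
    ∫ θ in (-Real.pi)..Real.pi, G (z + ρ • circ (θ + ψ)) = circularMean G z ρ := by
  have hper : Function.Periodic (fun θ => G (z + ρ • circ θ)) (2 * Real.pi) := by
    intro θ
    have : circ (θ + 2 * Real.pi) = circ θ := by
      ext i; fin_cases i <;> simp [circ]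
    simp only [this]
  rw [intervalIntegral.integral_comp_add_right (fun θ => G (z + ρ • circ θ)), circularMean]
  have := hper.intervalIntegral_add_eq (-Real.pi + ψ) (-Real.pi)
  rw [show -Real.pi + ψ + 2 * Real.pi = Real.pi + ψ by ring,
    show -Real.pi + 2 * Real.pi = Real.pi by ring] at this
  exact this

theorem circularMean_neg (z : E2) (ρ : ℝ) : circularMean G z (-ρ) = circularMean G z ρ := by
  rw [← integral_circ_add G z ρ Real.pi, circularMean]
  simp [circ_add_pi]

/-- If `v + iτ = ρ e^(iψ)`, then `v • circ θ + τ • perp2 (circ θ) = ρ • circ (θ + ψ)`, and the shift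
`ψ` is invisible over a full period. -/
theorem integral_frame_circ (G : E2 → ℝ) (z : E2) (v τ : ℝ) :
    ∫ θ in (-Real.pi)..Real.pi, G (z + v • circ θ + τ • perp2 (circ θ)) =
      circularMean G z √(v ^ 2 + τ ^ 2) := by
  set c : ℂ := ⟨v, τ⟩ with hc
  have hn : ‖c‖ = √(v ^ 2 + τ ^ 2) := by
    rw [Complex.norm_def, Complex.normSq_apply]; congr 1; simp [hc]; ring
  have hv : v = √(v ^ 2 + τ ^ 2) * Real.cos c.arg := by
    rw [← hn, Complex.norm_mul_cos_arg]
  have hτ : τ = √(v ^ 2 + τ ^ 2) * Real.sin c.arg := by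
    rw [← hn, Complex.norm_mul_sin_arg]
  rw [← integral_circ_add G z _ c.arg]
  refine intervalIntegral.integral_congr fun θ _ => ?_
  refine congrArg G ?_
  rw [add_assoc]
  congr 1
  generalize √(v ^ 2 + τ ^ 2) = ρ at hv hτ
  rw [hv, hτ]
  ext i; fin_cases i
  · simp [circ, perp2, Real.cos_add]; ring
  · simp [circ, perp2, Real.sin_add]; ring

theorem contDiff_radon (hG : ContDiff ℝ ∞ G) :
    ContDiff ℝ ∞ fun p : ℝ × E2 => radon G p.2 p.1 := by
  refine contDiff_intervalIntegral
    (F := fun p : (ℝ × E2) × ℝ => G (p.1.1 • p.1.2 + p.2 • perp2 p.1.2)) ?_ _ _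
  exact hG.comp (ContDiff.add (contDiff_fst.fst.smul contDiff_fst.snd)
    (contDiff_snd.smul (contDiff_perp2.comp contDiff_fst.snd)))

theorem continuous_boxIntegral {D : ℝ × ℝ → ℝ} (hD : Continuous D) {s : ℝ → ℝ} (hs : Continuous s) :
    Continuous (Function.uncurry fun θ v => ∫ η in (-1 : ℝ)..1, D (s θ + v * η, θ)) := by
  have h : Continuous (Function.uncurry fun (p : ℝ × ℝ) (η : ℝ) => D (s p.1 + p.2 * η, p.1)) := by
    unfold Function.uncurry
    fun_prop
  exact intervalIntegral.continuous_parametric_intervalIntegral_of_continuous' h (-1) 1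

set_option maxHeartbeats 1000000 in
/-- The filtered backprojection formula in the plane. -/
theorem radon_inversion (hG : ContDiff ℝ ∞ G) (h0 : ∀ z, 1 ≤ ‖z‖ → G z = 0) (z : E2) {R : ℝ}
    (hR : ‖z‖ + 1 ≤ R) :
    ∫ θ in (-Real.pi)..Real.pi, hilbertBox (deriv (radon G (circ θ))) R ⟪circ θ, z⟫_ℝ =
      4 * Real.pi * G z := by
  have hpi := Real.pi_pos
  set s : ℝ → ℝ := fun θ => ⟪circ θ, z⟫_ℝ with hs
  have hsd : ContDiff ℝ ∞ s := contDiff_circ.inner ℝ contDiff_const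
  have hr : ContDiff ℝ ∞ fun p : ℝ × ℝ => radon G (circ p.2) p.1 :=
    (contDiff_radon hG).comp (contDiff_fst.prodMk (contDiff_circ.comp contDiff_snd))
  have hr1 : ContDiff ℝ ∞ fun p : ℝ × ℝ => deriv (radon G (circ p.2)) p.1 := contDiff_deriv_fst hr
  have hr2 : ContDiff ℝ ∞ fun p : ℝ × ℝ => deriv (deriv (radon G (circ p.2))) p.1 :=
    contDiff_deriv_fst hr1
  have hg : ∀ θ, ContDiff ℝ 1 (deriv (radon G (circ θ))) := fun θ =>
    (hr1.comp (contDiff_id.prodMk contDiff_const)).of_le (by simp)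
  have hRp : 0 ≤ R := by linarith [norm_nonneg z]
  -- `N v` averages the data over all lines at signed distance `v` from `z`; by rotation it depends
  -- on `G` only through the circular means around `z`.
  set N : ℝ → ℝ := fun v => ∫ θ in (-Real.pi)..Real.pi, radon G (circ θ) (s θ + v) with hN
  have hNd : ∀ v, deriv N v = ∫ θ in (-Real.pi)..Real.pi, deriv (radon G (circ θ)) (s θ + v) := by
    intro v
    have h := hasDerivAt_intervalIntegral_of_contDiff
      (F := fun p : ℝ × ℝ => radon G (circ p.2) (s p.2 + p.1)) 
      ((hr.comp (((hsd.comp contDiff_snd).add contDiff_fst).prodMk contDiff_snd)).of_le (by simp))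
      (-Real.pi) Real.pi v
    rw [hN, h.deriv]
    refine intervalIntegral.integral_congr fun θ _ => ?_
    exact deriv_comp_const_add (f := radon G (circ θ)) (s θ) v
  have hA := integral_deriv_radial (contDiff_infty.1 (contDiff_circularMean hG z) 2)
    (fun ρ => circularMean_neg z ρ) (L := ‖z‖ + 1) (by positivity) ?_ hR (N := N) ?_
  -- The constants are `2π` from the mean at radius zero, `-2π` from `integral_deriv_radial` and
  -- `-1/π` from the Hilbert transform; their product is `4π`.
  · have e0 : circularMean G z 0 = 2 * Real.pi * G z := by
      simp only [circularMean, zero_smul, add_zero, intervalIntegral.integral_const, smul_eq_mul]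
      ring
    rw [e0] at hA
    have e1 : ∫ θ in (-Real.pi)..Real.pi, hilbertBox (deriv (radon G (circ θ))) R (s θ) =
        -(1 / Real.pi) * ∫ v in (0 : ℝ)..R, (deriv N v - deriv N (-v)) / v := by
      unfold hilbertBox
      rw [intervalIntegral.integral_const_mul, intervalIntegral_swap _ (by linarith) hRp]
      · congr 1
        rw [intervalIntegral.integral_of_le hRp, intervalIntegral.integral_of_le hRp]
        refine setIntegral_congr_fun measurableSet_Ioc fun v hv => ?_
        simp only [integral_deriv_symm (hg _) _ hv.1.ne']
        rw [intervalIntegral.integral_div, intervalIntegral.integral_sub, hNd, hNd]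
        · rfl
        · exact (hr1.continuous.comp
            ((hsd.continuous.add continuous_const).prodMk continuous_id)).intervalIntegrable _ _
        · exact (hr1.continuous.comp
            ((hsd.continuous.sub continuous_const).prodMk continuous_id)).intervalIntegrable _ _
      · exact continuous_boxIntegral hr2.continuous hsd.continuous
    rw [e1, hA]
    field_simp
    ring
  · intro ρ hρ
    rw [circularMean, intervalIntegral.integral_congr (g := fun _ => 0),
      intervalIntegral.integral_zero]
    intro θ _
    refine h0 _ ?_
    have h1 : ‖ρ • circ θ‖ = ρ := by
      rw [norm_smul, norm_circ, mul_one, Real.norm_of_nonneg (by linarith [norm_nonneg z])]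
    have h2 := norm_sub_le (z + ρ • circ θ) z
    rw [add_sub_cancel_left, h1] at h2
    linarith
  · intro v
    simp only [hN, hs]
    simp only [radon_shift h0 (norm_circ _)]
    rw [intervalIntegral_swap _ (by linarith) (by linarith [norm_nonneg z])]
    · refine intervalIntegral.integral_congr fun τ _ => ?_
      exact integral_frame_circ G z v τ
    · have := contDiff_circ.continuous
      have := contDiff_perp2.continuous
      exact hG.continuous.comp (by fun_prop)

end RadonTransform

/-! ### Coordinates adapted to a segment: plane of the axes and normal -/

section Frame

/-- `axis j` as a continuous linear map. -/
noncomputable def axisL (j : Fin 3) : E2 →L[ℝ] E3 :=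
  LinearMap.toContinuousLinearMap
    { toFun := axis j
      map_add' := fun a b => by
        ext i; fin_cases j <;> fin_cases i <;> simp [axis]
      map_smul' := fun a b => by
        ext i; fin_cases j <;> fin_cases i <;> simp [axis] }

@[simp] theorem axisL_apply (j : Fin 3) (b : E2) : axisL j b = axis j b := rfl

/-- The unit vector that is orthogonal to all axes of the segment `j`. -/
noncomputable abbrev normalVec (j : Fin 3) : E3 := EuclideanSpace.single (missing j) (1 : ℝ)

theorem axis_bar (j : Fin 3) (w : E3) : axis j (bar j w) + w (missing j) • normalVec j = w := by
  ext i; fin_cases j <;> fin_cases i <;> simp [axis, bar, missing]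

theorem axis_missing (j : Fin 3) (b : E2) : axis j b (missing j) = 0 := by
  fin_cases j <;> simp [axis, missing]

theorem frame_missing (j : Fin 3) (b : E2) (p : ℝ) :
    (axis j b + p • normalVec j) (missing j) = p := by
  simp [axis_missing]

theorem norm_axis_add_sq (j : Fin 3) (b : E2) (p : ℝ) :
    ‖axis j b + p • normalVec j‖ ^ 2 = ‖b‖ ^ 2 + p ^ 2 := by
  simp only [EuclideanSpace.norm_sq_eq, Fin.sum_univ_three, Fin.sum_univ_two]
  fin_cases j <;> simp [axis, missing] <;> ring

theorem norm_axis (j : Fin 3) (b : E2) : ‖axis j b‖ = ‖b‖ := by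
  have := norm_axis_add_sq j b 0
  simp only [zero_smul, add_zero] at this
  have h : ‖axis j b‖ ^ 2 = ‖b‖ ^ 2 := by simpa using this
  exact (sq_eq_sq₀ (norm_nonneg _) (norm_nonneg _)).1 h

theorem norm_sq_eq_bar (j : Fin 3) (w : E3) : ‖w‖ ^ 2 = ‖bar j w‖ ^ 2 + w (missing j) ^ 2 := by
  conv_lhs => rw [← axis_bar j w]
  exact norm_axis_add_sq j _ _

theorem missing_ne (j : Fin 3) : missing j ≠ j := by
  fin_cases j <;> simp [missing]

/-- Since `missing j ≠ j`, the segment `j` lies in the plane of its axes. -/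
theorem axis_bar_single (j : Fin 3) (t : ℝ) :
    axis j (bar j (EuclideanSpace.single j t)) = EuclideanSpace.single j t := by
  have := axis_bar j (EuclideanSpace.single j t)
  simpa [missing_ne j] using this

theorem norm_bar_single (j : Fin 3) (t : ℝ) : ‖bar j (EuclideanSpace.single j t)‖ = |t| := by
  rw [← norm_axis j, axis_bar_single]; simp

theorem bar_single_eq (j : Fin 3) (t : ℝ) :
    bar j (EuclideanSpace.single j t) = t • bar j (EuclideanSpace.single j 1) := by
  ext i; fin_cases j <;> fin_cases i <;> simp [bar]

theorem eq_single_of_mem_sensorLine {j : Fin 3} {u : E3} (hu : u ∈ sensorLine j) :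
    u = EuclideanSpace.single j (u j) := by
  ext i
  by_cases h : i = j
  · subst h; simp
  · simp [h, hu.2 i h]

end Frame

/-! ### Functions supported in the simplex -/

section Test

/-- Smooth functions with support in the simplex. -/
structure IsTest (f : E3 → ℝ) : Prop where
  contDiff : ContDiff ℝ ∞ f
  support : tsupport f ⊆ simplex

namespace IsTest

variable {f : E3 → ℝ}

theorem mem_simplex (hf : IsTest f) {y : E3} (h : f y ≠ 0) : y ∈ simplex :=
  hf.support (subset_tsupport _ h)

/-- Off the simplex `f` is zero, and the face `y i = 0` is a limit of outside points. This is the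
source of all flatness. -/
theorem eq_zero_of_nonpos (hf : IsTest f) (i : Fin 3) {y : E3} (hy : y i ≤ 0) : f y = 0 := by
  have h1 : ∀ t : ℝ, y i - t < 0 → f (y - t • EuclideanSpace.single i 1) = 0 := by
    intro t ht
    by_contra h
    have := ((hf.mem_simplex h).1 i).1
    simp at this
    linarith
  have hc : Continuous fun t : ℝ => f (y - t • EuclideanSpace.single i 1) :=
    hf.contDiff.continuous.comp (by fun_prop)
  have h2 : (0 : ℝ) ∈ closure (Ioi (0 : ℝ)) := by rw [closure_Ioi]; exact self_mem_Ici
  have := (isClosed_singleton.preimage hc).closure_subset_iff.2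
    (fun t (ht : 0 < t) => h1 t (by linarith)) h2
  simpa using this

theorem norm_le_one_of_mem_simplex {y : E3} (hy : y ∈ simplex) : ‖y‖ ≤ 1 := by
  obtain ⟨h, hs⟩ := hy
  have h0 := h 0; have h1 := h 1; have h2 := h 2
  simp only [mem_Icc] at h0 h1 h2
  have : ‖y‖ ^ 2 ≤ 1 := by
    rw [EuclideanSpace.norm_sq_eq, Fin.sum_univ_three]
    simp only [Real.norm_eq_abs, sq_abs]
    nlinarith
  nlinarith [norm_nonneg y]

theorem eq_zero_of_one_lt_norm (hf : IsTest f) {y : E3} (hy : 1 < ‖y‖) : f y = 0 := by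
  by_contra h
  linarith [norm_le_one_of_mem_simplex (hf.mem_simplex h)]

theorem hasCompactSupport (hf : IsTest f) : HasCompactSupport f :=
  HasCompactSupport.of_support_subset_isCompact (isCompact_closedBall (0 : E3) 1) fun y hy => by
    simpa using norm_le_one_of_mem_simplex (hf.mem_simplex hy)

end IsTest

end Test

/-! ### The conical transform as a planar Radon transform -/

section Profile

variable {f : E3 → ℝ}

/-- The integral of `f` over the ray from `u` in the direction `w`, with the weight `r ^ k`. -/
noncomputable def rayIntegral (k : ℕ) (f : E3 → ℝ) (u w : E3) : ℝ :=
  ∫ r in Ioi (0 : ℝ), f (u + r • w) * r ^ k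

theorem rayIntegral_eq_zero (hf : IsTest f) (k : ℕ) {i : Fin 3} {u w : E3} (hu : u i = 0)
    (hw : w i ≤ 0) : rayIntegral k f u w = 0 := by
  rw [rayIntegral, setIntegral_congr_fun measurableSet_Ioi (g := fun _ => 0)]
  · simp
  · intro r hr
    have : f (u + r • w) = 0 := by
      refine hf.eq_zero_of_nonpos i ?_
      have := mul_nonpos_of_nonneg_of_nonpos (le_of_lt hr) hw
      simpa [hu] using this
    simp [this]

/-- The function `f` in the coordinates of the segment `j`. -/
noncomputable def frameFun (f : E3 → ℝ) (j : Fin 3) (x : E2 × ℝ) : ℝ :=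
  f (axis j x.1 + x.2 • normalVec j)

theorem isFlat_frameFun (hf : IsTest f) (j : Fin 3) : IsFlat (frameFun f j) := by
  constructor
  · exact hf.contDiff.comp
      (((axisL j).contDiff.comp contDiff_fst).add (contDiff_snd.smul contDiff_const))
  · intro y p hp
    exact hf.eq_zero_of_nonpos (missing j) (by rwa [frame_missing])

/-- The function of the plane whose Radon transform is the conical Radon transform. The vertex is
`axis j q`. -/
noncomputable def profile (k : ℕ) (f : E3 → ℝ) (j : Fin 3) (q z : E2) : ℝ :=
  ∫ r in (0 : ℝ)..4, compSqrt (hadamard (frameFun f j))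
    (q + r • z, r ^ 2 * (1 - ‖z‖ ^ 2)) * r ^ (k + 1)

/-- Smoothness across `‖z‖ = 1`, where `√(1 - ‖z‖²)` is singular, comes from `contDiff_compSqrt` and
the flatness of `f` on the plane of the axes. -/
theorem contDiff_profile (hf : IsTest f) (k : ℕ) (j : Fin 3) :
    ContDiff ℝ ∞ fun p : E2 × E2 => profile k f j p.1 p.2 := by
  refine contDiff_intervalIntegral (F := fun p : (E2 × E2) × ℝ =>
    compSqrt (hadamard (frameFun f j))
      (p.1.1 + p.2 • p.1.2, p.2 ^ 2 * (1 - ‖p.1.2‖ ^ 2)) * p.2 ^ (k + 1)) ?_ _ _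
  refine ContDiff.mul ((contDiff_compSqrt (isFlat_frameFun hf j).hadamard).comp ?_)
    (contDiff_snd.pow _)
  exact (contDiff_fst.fst.add (contDiff_snd.smul contDiff_fst.snd)).prodMk
    ((contDiff_snd.pow 2).mul (contDiff_const.sub (contDiff_fst.snd.norm_sq ℝ)))

theorem profile_eq_zero (hf : IsTest f) (k : ℕ) (j : Fin 3) (q : E2) {z : E2} (hz : 1 ≤ ‖z‖) :
    profile k f j q z = 0 := by
  rw [profile, intervalIntegral.integral_congr (g := fun _ => 0), intervalIntegral.integral_zero]
  intro r _
  have : r ^ 2 * (1 - ‖z‖ ^ 2) ≤ 0 :=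
    mul_nonpos_of_nonneg_of_nonpos (sq_nonneg r) (by nlinarith)
  simp only
  rw [compSqrt_of_nonpos (isFlat_frameFun hf j).hadamard (by exact this), zero_mul]

theorem rayIntegral_eq_interval (hf : IsTest f) (k : ℕ) {u w : E3} {R : ℝ} (hR : 0 ≤ R)
    (hw : 1 + ‖u‖ ≤ R * ‖w‖) :
    rayIntegral k f u w = ∫ r in (0 : ℝ)..R, f (u + r • w) * r ^ k := by
  rw [rayIntegral, intervalIntegral.integral_of_le hR]
  refine setIntegral_eq_of_subset_of_forall_sdiff_eq_zero measurableSet_Ioi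
    (fun v hv => hv.1) fun r hr => ?_
  have hr1 : R < r := by
    by_contra h
    exact hr.2 ⟨hr.1, not_lt.1 h⟩
  have hw0 : 0 < ‖w‖ := by
    by_contra h
    have : ‖w‖ = 0 := le_antisymm (not_lt.1 h) (norm_nonneg w)
    rw [this] at hw
    linarith [norm_nonneg u]
  rw [hf.eq_zero_of_one_lt_norm, zero_mul]
  have h1 : ‖r • w‖ ≤ ‖u + r • w‖ + ‖u‖ := by
    simpa using norm_sub_le (u + r • w) u
  rw [norm_smul, Real.norm_of_nonneg (hR.trans hr1.le)] at h1
  nlinarith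

/-- The square root inside `profile` equals `r * h`, and Hadamard's quotient divides by it. The
factor `h` on the left and the additional power of `r` in `profile` restore `f` with the weight `r ^
k`. The bound `2` on `‖q‖` leaves room around the vertices of the sensor for derivatives at the end
points. -/
theorem mul_profile (hf : IsTest f) (k : ℕ) (j : Fin 3) {q z : E2} (hq : ‖q‖ ≤ 2) {h : ℝ}
    (h0 : 0 < h) (hz : ‖z‖ ^ 2 + h ^ 2 = 1) :
    h * profile k f j q z = rayIntegral k f (axis j q) (axis j z + h • normalVec j) := by
  have hn : ‖axis j z + h • normalVec j‖ = 1 := by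
    have := norm_axis_add_sq j z h
    rw [hz] at this
    exact (pow_eq_one_iff_of_nonneg (norm_nonneg _) two_ne_zero).1 this
  -- On a unit direction the support of `f` is left by `r = 1 + ‖q‖ ≤ 3`, so the limit `4` is large
  -- enough.
  rw [rayIntegral_eq_interval hf k (R := 4) (by norm_num) (by rw [hn, norm_axis]; linarith),
    profile, ← intervalIntegral.integral_const_mul]
  refine intervalIntegral.integral_congr fun r hr => ?_
  rw [uIcc_of_le (by norm_num)] at hr
  have hs : √(r ^ 2 * (1 - ‖z‖ ^ 2)) = r * h := by
    rw [show r ^ 2 * (1 - ‖z‖ ^ 2) = (r * h) ^ 2 by rw [← hz]; ring]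
    exact Real.sqrt_sq (mul_nonneg hr.1 h0.le)
  have h1 := (isFlat_frameFun hf j).smul_hadamard (q + r • z) (r * h)
  have h2 : axis j q + r • (axis j z + h • normalVec j) =
      axis j (q + r • z) + (r * h) • normalVec j := by
    simp only [← axisL_apply, map_add, map_smul]
    module
  simp only [compSqrt, hs]
  rw [h2, show f (axis j (q + r • z) + (r * h) • normalVec j) =
    frameFun f j (q + r • z, r * h) from rfl, ← h1, smul_eq_mul]
  ring

-- With `c = √(1 - s²)`, the direction of longitude `φ` has plane part `s • b + τ • perp2 b` and
-- height `h`, where `τ = c sin φ` and `h = c cos φ`. Where `cos φ > 0` the ray integral is `h`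
-- times the profile, and `h dφ = dτ`; where `cos φ ≤ 0` the ray misses the support.
set_option maxHeartbeats 1000000 in
theorem conicalRadon_eq (hf : IsTest f) (k : ℕ) (j : Fin 3) {q : E2} (hq : ‖q‖ ≤ 1) (b : S1)
    (s : ℝ) : conicalRadon k f j (axis j q) b s = radon (profile k f j q) b s := by
  have hb : ‖(b : E2)‖ = 1 := norm_eq_of_mem_sphere b
  have hz := fun z => profile_eq_zero hf k j q (z := z)
  rcases lt_or_ge |s| 1 with hs | hs
  · have hs2 : 0 < 1 - s ^ 2 := by rw [← sq_abs]; nlinarith [abs_nonneg s]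
    set c := √(1 - s ^ 2) with hc
    have hc0 : 0 < c := Real.sqrt_pos.2 hs2
    have hcs : c ^ 2 = 1 - s ^ 2 := Real.sq_sqrt hs2.le
    have hc1 : c ≤ 1 := by nlinarith [sq_nonneg s]
    set K : ℝ → ℝ := fun τ => profile k f j q (s • (b : E2) + τ • perp2 b) with hK
    have hKc : Continuous K :=
      (contDiff_profile hf k j).continuous.comp
        (f := fun τ => (q, s • (b : E2) + τ • perp2 b)) (by fun_prop)
    have hX : ∀ φ, ∫ r in Ioi (0 : ℝ), f (axis j q + r • conePoint j b s φ) * r ^ k =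
        K (c * Real.sin φ) * (c * max (Real.cos φ) 0) := by
      intro φ
      have e : conePoint j b s φ = axis j (s • (b : E2) + (c * Real.sin φ) • perp2 b) +
          (c * Real.cos φ) • normalVec j := by
        rw [conePoint, ← axisL_apply, ← axisL_apply, ← axisL_apply, map_add, map_smul, map_smul,
          ← hc]
        simp only [perp2]
        module
      change rayIntegral k f (axis j q) _ = _
      rw [e]
      rcases lt_or_ge 0 (Real.cos φ) with hφ | hφ
      · rw [max_eq_left hφ.le, ← mul_profile hf k j (hq.trans one_le_two) (mul_pos hc0 hφ), mul_comm]
        rw [norm_frame_sq hb]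
        nlinarith [Real.sin_sq_add_cos_sq φ]
      · rw [max_eq_right hφ, mul_zero, mul_zero]
        refine rayIntegral_eq_zero hf k (i := missing j) (axis_missing j q) ?_
        rw [frame_missing]
        exact mul_nonpos_of_nonneg_of_nonpos hc0.le hφ
    have hYc : Continuous fun φ => K (c * Real.sin φ) * (c * max (Real.cos φ) 0) := by fun_prop
    have hper : Function.Periodic (fun φ => K (c * Real.sin φ) * (c * max (Real.cos φ) 0))
        (2 * Real.pi) := by
      intro φ; simp
    have hmem : s ∈ Icc (-1 : ℝ) 1 := abs_le.1 hs.le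
    rw [conicalRadon, if_pos hmem]
    simp only [hX]
    -- Starting the period at `-π/2` separates the two signs of the cosine.
    have e1 := hper.intervalIntegral_add_eq 0 (-(Real.pi / 2))
    rw [zero_add] at e1
    rw [e1, ← intervalIntegral.integral_add_adjacent_intervals (b := Real.pi / 2)
      (hYc.intervalIntegrable _ _) (hYc.intervalIntegrable _ _)]
    have hpi := Real.pi_pos
    have e2 : ∫ φ in (Real.pi / 2)..(-(Real.pi / 2) + 2 * Real.pi),
        K (c * Real.sin φ) * (c * max (Real.cos φ) 0) = 0 := by
      rw [intervalIntegral.integral_congr (g := fun _ => 0), intervalIntegral.integral_zero]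
      intro φ hφ
      rw [uIcc_of_le (by linarith)] at hφ
      simp only
      rw [max_eq_right (Real.cos_nonpos_of_pi_div_two_le_of_le hφ.1 (by linarith [hφ.2]))]
      simp
    have e3 : ∫ φ in (-(Real.pi / 2))..(Real.pi / 2),
        K (c * Real.sin φ) * (c * max (Real.cos φ) 0) =
        ∫ φ in (-(Real.pi / 2))..(Real.pi / 2),
        (K ∘ fun φ => c * Real.sin φ) φ * (c * Real.cos φ) := by
      refine intervalIntegral.integral_congr fun φ hφ => ?_
      rw [uIcc_of_le (by linarith)] at hφ
      simp only [Function.comp_apply]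
      rw [max_eq_left (Real.cos_nonneg_of_mem_Icc hφ)]
    rw [e2, add_zero, e3, intervalIntegral.integral_comp_mul_deriv
      (fun φ _ => (Real.hasDerivAt_sin φ).const_mul c) (by fun_prop) hKc]
    simp only [Real.sin_neg, Real.sin_pi_div_two, mul_one, mul_neg]
    rw [radon, intervalIntegral.integral_of_le (by linarith),
      intervalIntegral.integral_of_le (by norm_num)]
    -- The chord ends at `|τ| = c`, beyond which the profile is zero.
    refine (setIntegral_eq_of_subset_of_forall_sdiff_eq_zero measurableSet_Ioc
      (Ioc_subset_Ioc (by linarith) hc1) fun τ hτ => hz _ ?_).symm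
    have h1 : c ≤ |τ| := by
      by_contra h
      have := abs_lt.1 (not_le.1 h)
      exact hτ.2 ⟨this.1, this.2.le⟩
    have h2 : c ^ 2 ≤ τ ^ 2 := by rw [← sq_abs τ]; gcongr
    have h3 := norm_frame_sq hb s τ
    nlinarith [norm_nonneg (s • (b : E2) + τ • perp2 b)]
  · rw [radon_eq_zero hz hb hs, conicalRadon]
    split_ifs with h
    · have hs1 : s ^ 2 = 1 := by
        have h' := abs_le.2 h
        rw [← sq_abs, le_antisymm h' hs, one_pow]
      -- For `s = ±1` the cone is a single ray in the plane of the axes, where `f` vanishes.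
      have hcp : ∀ φ, conePoint j b s φ = s • axis j b := by
        intro φ
        simp [conePoint, hs1]
      rw [intervalIntegral.integral_congr (g := fun _ => 0), intervalIntegral.integral_zero]
      intro φ _
      simp only [hcp]
      exact rayIntegral_eq_zero hf k (i := missing j) (axis_missing j q)
        (by simp [axis_missing])
    · rfl

end Profile

/-! ### Existence and smoothness of the filtered data -/

section FilteredData

variable {f : E3 → ℝ}

/-- The filtered data for the vertex `axis j q`, as an integral over a box. -/
noncomputable def boxData (k : ℕ) (f : E3 → ℝ) (j : Fin 3) (R : ℝ) (q b : E2) (s : ℝ) : ℝ :=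
  hilbertBox (deriv (radon (profile k f j q) b)) R s

theorem contDiff_radon_profile (hf : IsTest f) (k : ℕ) (j : Fin 3) :
    ContDiff ℝ ∞ fun p : ℝ × (E2 × E2) => radon (profile k f j p.2.1) p.2.2 p.1 := by
  refine contDiff_intervalIntegral (F := fun p : (ℝ × (E2 × E2)) × ℝ =>
    profile k f j p.1.2.1 (p.1.1 • p.1.2.2 + p.2 • perp2 p.1.2.2)) ?_ _ _
  exact (contDiff_profile hf k j).comp (contDiff_fst.snd.fst.prodMk
    (ContDiff.add (contDiff_fst.fst.smul contDiff_fst.snd.snd)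
    (contDiff_snd.smul (contDiff_perp2.comp contDiff_fst.snd.snd))))

theorem contDiff_section {E' : Type} [NormedAddCommGroup E'] [NormedSpace ℝ E']
    {H : ℝ × E' → ℝ} (hH : ContDiff ℝ ∞ H) (e : E') : ContDiff ℝ ∞ fun s => H (s, e) :=
  hH.comp (contDiff_id.prodMk contDiff_const)

theorem contDiff_deriv_radon_profile (hf : IsTest f) (k : ℕ) (j : Fin 3) (q b : E2) :
    ContDiff ℝ ∞ (deriv (radon (profile k f j q) b)) :=
  contDiff_section (contDiff_deriv_fst (contDiff_radon_profile hf k j)) (q, b)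

/-- For fixed `R` there is no singular integral left, so the data are jointly smooth in `s`, vertex
and axis. This permits vertex derivatives under the integral over the axes. -/
theorem contDiff_boxData (hf : IsTest f) (k : ℕ) (j : Fin 3) (R : ℝ) :
    ContDiff ℝ ∞ fun p : ℝ × (E2 × E2) => boxData k f j R p.2.1 p.2.2 p.1 := by
  have h2 := contDiff_deriv_fst (contDiff_deriv_fst (contDiff_radon_profile hf k j))
  refine contDiff_const.mul ?_
  refine contDiff_intervalIntegral (F := fun p : (ℝ × (E2 × E2)) × ℝ => ∫ θ in (-1 : ℝ)..1,
    deriv (deriv (radon (profile k f j p.1.2.1) p.1.2.2)) (p.1.1 + p.2 * θ)) ?_ _ _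
  refine contDiff_intervalIntegral (F := fun p : ((ℝ × (E2 × E2)) × ℝ) × ℝ =>
    deriv (deriv (radon (profile k f j p.1.1.2.1) p.1.1.2.2)) (p.1.1.1 + p.1.2 * p.2)) ?_ _ _
  exact h2.comp ((contDiff_fst.fst.fst.add (contDiff_fst.snd.mul contDiff_snd)).prodMk
    contDiff_fst.fst.snd)

theorem conicalRadon_eq' (hf : IsTest f) (k : ℕ) (j : Fin 3) {q : E2} (hq : ‖q‖ ≤ 1) (b : S1) :
    conicalRadon k f j (axis j q) b = radon (profile k f j q) b :=
  funext fun s => conicalRadon_eq hf k j hq b s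

theorem deriv_radon_profile_eq_zero (hf : IsTest f) (k : ℕ) (j : Fin 3) (q : E2) (b : S1) {t : ℝ}
    (ht : 1 < |t|) : deriv (radon (profile k f j q) b) t = 0 := by
  have : radon (profile k f j q) b =ᶠ[𝓝 t] fun _ => 0 := by
    filter_upwards [continuous_abs.continuousAt.eventually_const_lt ht] with x hx
    exact radon_eq_zero (fun z => profile_eq_zero hf k j q) (norm_eq_of_mem_sphere b) hx.le
  rw [this.deriv_eq, deriv_const]

theorem filteredData_eq (hf : IsTest f) (k : ℕ) (j : Fin 3) {q : E2} (hq : ‖q‖ ≤ 1) (b : S1)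
    {s R : ℝ} (hR : |s| + 1 ≤ R) :
    filteredData k f j (axis j q) b s = boxData k f j R q b s := by
  rw [filteredData, conicalRadon_eq' hf k j hq b]
  exact hilbert_eq ((contDiff_deriv_radon_profile hf k j q b).of_le (by simp))
    (fun t => deriv_radon_profile_eq_zero hf k j q b) hR

theorem differentiable_conicalRadon (hf : IsTest f) (k : ℕ) (j : Fin 3) {q : E2} (hq : ‖q‖ ≤ 1)
    (b : S1) : Differentiable ℝ (conicalRadon k f j (axis j q) b) := by
  rw [conicalRadon_eq' hf k j hq b]
  have : ContDiff ℝ ∞ (radon (profile k f j q) b) :=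
    contDiff_section (contDiff_radon_profile hf k j) (q, b)
  exact this.differentiable (by simp)

theorem tendsto_filteredData (hf : IsTest f) (k : ℕ) (j : Fin 3) {q : E2} (hq : ‖q‖ ≤ 1)
    (b : S1) (s : ℝ) :
    Tendsto (truncatedHilbert (deriv (conicalRadon k f j (axis j q) b)) s)
        (𝓝[>] (0 : ℝ)) (𝓝 (filteredData k f j (axis j q) b s)) := by
  rw [filteredData_eq hf k j hq b le_rfl, conicalRadon_eq' hf k j hq b]
  exact tendsto_truncatedHilbert ((contDiff_deriv_radon_profile hf k j q b).of_le (by simp))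
    (fun t => deriv_radon_profile_eq_zero hf k j q b) le_rfl

end FilteredData

instance : IsFiniteMeasure arcS1 := by unfold arcS1; infer_instance

/-! ### Derivatives along a segment -/

section DirectionalDerivative

/-- The partial derivative in the direction of the segment `j`. -/
noncomputable def dirDeriv (j : Fin 3) (f : E3 → ℝ) (y : E3) : ℝ :=
  fderiv ℝ f y (EuclideanSpace.single j 1)

variable {f : E3 → ℝ}

theorem IsTest.dirDeriv (hf : IsTest f) (j : Fin 3) : IsTest (dirDeriv j f) := by
  constructor
  · exact (hf.contDiff.fderiv_right (by simp)).clm_apply contDiff_const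
  · refine subset_trans (closure_minimal ?_ isClosed_closure)
      ((tsupport_fderiv_subset ℝ (f := f)).trans hf.support)
    intro y hy
    refine subset_tsupport _ ?_
    intro h
    exact hy (by simp [TripleLine.dirDeriv, h])

theorem IsTest.dirDeriv_iterate (hf : IsTest f) (j : Fin 3) (m : ℕ) :
    IsTest ((TripleLine.dirDeriv j)^[m] f) := by
  induction m with
  | zero => exact hf
  | succ m ih => rw [Function.iterate_succ_apply']; exact ih.dirDeriv j

theorem IsTest.hasDerivAt_line (hf : IsTest f) (j : Fin 3) (y : E3) (t : ℝ) :
    HasDerivAt (fun t : ℝ => f (y + t • EuclideanSpace.single j (1 : ℝ)))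
      (TripleLine.dirDeriv j f (y + t • EuclideanSpace.single j (1 : ℝ))) t := by
  have h1 := ((hf.contDiff.differentiable (by simp))
    (y + t • EuclideanSpace.single j (1 : ℝ))).hasFDerivAt
  have h2 : HasDerivAt (fun t : ℝ => y + t • EuclideanSpace.single j (1 : ℝ))
      (EuclideanSpace.single j (1 : ℝ)) t := by
    simpa using ((hasDerivAt_id t).smul_const (EuclideanSpace.single j (1 : ℝ))).const_add y
  exact h1.comp_hasDerivAt t h2

theorem iteratedDeriv_line (m : ℕ) : ∀ {f : E3 → ℝ}, IsTest f → ∀ (j : Fin 3) (y : E3),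
    iteratedDeriv m (fun t : ℝ => f (y + t • EuclideanSpace.single j (1 : ℝ))) =
      fun t => (dirDeriv j)^[m] f (y + t • EuclideanSpace.single j (1 : ℝ)) := by
  induction m with
  | zero => intro f hf j y; simp
  | succ m ih =>
    intro f hf j y
    rw [iteratedDeriv_succ', funext fun t => (hf.hasDerivAt_line j y t).deriv,
      ih (hf.dirDeriv j) j y]
    simp only [Function.iterate_succ_apply]

end DirectionalDerivative

/-! ### The integral over the axes -/

section AxisIntegral

variable {f : E3 → ℝ}

theorem contDiff_iteratedDeriv_fst {E' : Type} [NormedAddCommGroup E'] [NormedSpace ℝ E']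
    (m : ℕ) : ∀ {H : ℝ × E' → ℝ}, ContDiff ℝ ∞ H →
    ContDiff ℝ ∞ fun p : ℝ × E' => iteratedDeriv m (fun t => H (t, p.2)) p.1 := by
  induction m with
  | zero => intro H hH; simpa using hH
  | succ m ih =>
    intro H hH
    simp only [iteratedDeriv_succ']
    exact ih (H := fun p => deriv (fun t => H (t, p.2)) p.1) (contDiff_deriv_fst hH)

/-- The unit vector of the plane of the axes along the segment `j`; it is zero for no segment. -/
noncomputable abbrev planeDir (j : Fin 3) : E2 := bar j (EuclideanSpace.single j 1)

theorem axis_smul_planeDir (j : Fin 3) (t : ℝ) :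
    axis j (t • planeDir j) = EuclideanSpace.single j t := by
  rw [← bar_single_eq, axis_bar_single]

theorem norm_smul_planeDir (j : Fin 3) (t : ℝ) : ‖t • planeDir j‖ = |t| := by
  rw [← bar_single_eq, norm_bar_single]

/-- The filtered data for the vertices on the line of the segment `j`. -/
noncomputable def lineData (k : ℕ) (f : E3 → ℝ) (j : Fin 3) (R : ℝ) (b : E2) (s t : ℝ) : ℝ :=
  boxData k f j R (t • planeDir j) b s

theorem contDiff_lineData (hf : IsTest f) (k : ℕ) (j : Fin 3) (R : ℝ) :
    ContDiff ℝ ∞ fun p : ℝ × (E2 × ℝ) => lineData k f j R p.2.1 p.2.2 p.1 :=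
  (contDiff_boxData hf k j R).comp
    (g := fun p : ℝ × (E2 × E2) => boxData k f j R p.2.1 p.2.2 p.1)
    (f := fun p : ℝ × (E2 × ℝ) => (p.2.2, (p.1 • planeDir j, p.2.1)))
    (contDiff_snd.snd.prodMk ((contDiff_fst.smul contDiff_const).prodMk contDiff_snd.fst))

theorem filteredData_single (hf : IsTest f) (k : ℕ) (j : Fin 3) (b : S1) {s R : ℝ}
    (hR : |s| + 1 ≤ R) : EqOn (fun t => filteredData k f j (EuclideanSpace.single j t) b s)
      (lineData k f j R b s) (Icc 0 1) := by
  intro t ht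
  have h := filteredData_eq hf k j (q := t • planeDir j)
    (by rw [norm_smul_planeDir, abs_of_nonneg ht.1]; exact ht.2) b hR
  rw [axis_smul_planeDir] at h
  exact h

theorem contDiff_lineData_right (hf : IsTest f) (k : ℕ) (j : Fin 3) (R : ℝ) (b : E2) (s : ℝ) :
    ContDiff ℝ ∞ (lineData k f j R b s) :=
  contDiff_section (contDiff_lineData hf k j R) (b, s)

theorem contDiffOn_filteredData (hf : IsTest f) (k : ℕ) (j : Fin 3) (b : S1) (s : ℝ) (n : ℕ) :
    ContDiffOn ℝ n (fun t => filteredData k f j (EuclideanSpace.single j t) b s) (Icc 0 1) :=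
  ((contDiff_infty.1 (contDiff_lineData_right hf k j (|s| + 1) b s) n).contDiffOn).congr
    (filteredData_single hf k j b le_rfl)

/-- On `[0, 1]` the data agree with `lineData`, which is smooth on the whole line; so one-sided
derivatives are ordinary derivatives of this extension. -/
theorem filteredDataDeriv_eq (hf : IsTest f) (k : ℕ) {j : Fin 3} {u : E3}
    (hu : u ∈ sensorLine j) (b : S1) {s R : ℝ} (hR : |s| + 1 ≤ R) :
    filteredDataDeriv k f j u b s = iteratedDeriv (k - 1) (lineData k f j R b s) (u j) := by
  rw [filteredDataDeriv, iteratedDerivWithin_congr (filteredData_single hf k j b hR) hu.1]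
  exact iteratedDerivWithin_eq_iteratedDeriv (uniqueDiffOn_Icc one_pos)
    (contDiff_infty.1 (contDiff_lineData_right hf k j R b s) _).contDiffAt hu.1

theorem abs_inner_bar_div_le (j : Fin 3) (w : E3) (b : E2) (hb : ‖b‖ = 1) :
    |⟪b, bar j w⟫_ℝ / ‖w‖| ≤ 1 := by
  have h1 : ‖bar j w‖ ≤ ‖w‖ := by
    have := norm_sq_eq_bar j w
    nlinarith [norm_nonneg w, norm_nonneg (bar j w), sq_nonneg (w (missing j))]
  have h2 := abs_real_inner_le_norm b (bar j w)
  rw [hb, one_mul] at h2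
  rw [abs_div, abs_norm]
  exact div_le_one_of_le₀ (h2.trans h1) (norm_nonneg w)

/-- `filteredDataDeriv`, as a function on the plane that contains the axes. -/
noncomputable def axisData (k : ℕ) (f : E3 → ℝ) (j : Fin 3) (t : ℝ) (w : E3) (b : E2) : ℝ :=
  iteratedDeriv (k - 1) (lineData k f j 2 b (⟪b, bar j w⟫_ℝ / ‖w‖)) t

theorem continuous_axisData (hf : IsTest f) (k : ℕ) (j : Fin 3) (t : ℝ) (w : E3) :
    Continuous (axisData k f j t w) := by
  have h := (contDiff_iteratedDeriv_fst (k - 1) (contDiff_lineData hf k j 2)).continuous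
  exact h.comp (f := fun b => (t, (b, ⟪b, bar j w⟫_ℝ / ‖w‖))) (by fun_prop)

theorem axisIntegrand_eq (hf : IsTest f) (k : ℕ) {j : Fin 3} {u : E3} (hu : u ∈ sensorLine j)
    (w : E3) (b : S1) : axisIntegrand k f j u w b =
      max (w (missing j)) 0 / ‖w‖ ^ (k + 2) * axisData k f j (u j) w b := by
  -- `R = 2` works for all axes at once, because the argument `s` has absolute value at most `1`.
  rw [axisIntegrand, axisData, filteredDataDeriv_eq hf k hu b (R := 2)]
  linarith [abs_inner_bar_div_le j w b (norm_eq_of_mem_sphere b)]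

theorem integrable_axisIntegrand (hf : IsTest f) (k : ℕ) {j : Fin 3} {u : E3}
    (hu : u ∈ sensorLine j) (w : E3) : Integrable (axisIntegrand k f j u w) arcS1 := by
  have hc : Continuous (axisIntegrand k f j u w) := by
    rw [funext (axisIntegrand_eq hf k hu w)]
    exact continuous_const.mul ((continuous_axisData hf k j (u j) w).comp continuous_subtype_val)
  exact hc.integrable_of_hasCompactSupport (HasCompactSupport.of_compactSpace _)

theorem rayIntegral_smul (k : ℕ) (f : E3 → ℝ) (u w : E3) {c : ℝ} (hc : 0 < c) :
    rayIntegral k f u (c⁻¹ • w) = c ^ (k + 1) * rayIntegral k f u w := by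
  have h := integral_comp_mul_left_Ioi (fun x => f (u + x • w) * (c * x) ^ k) 0 (inv_pos.2 hc)
  rw [mul_zero, inv_inv, smul_eq_mul] at h
  rw [rayIntegral, rayIntegral, pow_succ, mul_assoc, mul_left_comm, ← integral_const_mul]
  have e : ∀ r : ℝ, c * (c⁻¹ * r) = r := fun r => mul_inv_cancel_left₀ hc.ne' r
  calc ∫ r in Ioi 0, f (u + r • c⁻¹ • w) * r ^ k
      = ∫ x in Ioi 0, f (u + (c⁻¹ * x) • w) * (c ^ k * (c⁻¹ * x) ^ k) := by
        refine setIntegral_congr_fun measurableSet_Ioi fun r _ => ?_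
        rw [← mul_pow, e, smul_smul, mul_comm r]
    _ = _ := by
        simp only [mul_pow] at h ⊢
        rw [h]
        congr 2
        ext x
        ring

theorem iteratedDeriv_rayIntegral (hf : IsTest f) (k m : ℕ) (j : Fin 3) {t : ℝ} (ht : |t| < 2)
    {w : E3} (hw : ‖w‖ = 1) :
    iteratedDeriv m (fun t => rayIntegral k f (EuclideanSpace.single j t) w) t =
      rayIntegral k ((dirDeriv j)^[m] f) (EuclideanSpace.single j t) w := by
  have hn : ∀ t : ℝ, |t| < 2 → 1 + ‖(EuclideanSpace.single j t : E3)‖ ≤ 4 * ‖w‖ := by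
    intro t ht
    rw [hw, PiLp.norm_single, Real.norm_eq_abs]
    linarith
  have hs : ∀ t : ℝ, EuclideanSpace.single j t = t • (EuclideanSpace.single j (1 : ℝ) : E3) := by
    intro t; ext i; simp
  have e : (fun t => rayIntegral k f (EuclideanSpace.single j t) w) =ᶠ[𝓝 t] fun t =>
      ∫ r in (0 : ℝ)..4, f (r • w + t • EuclideanSpace.single j (1 : ℝ)) * r ^ k := by
    filter_upwards [continuous_abs.continuousAt.eventually_lt_const ht] with x hx
    rw [rayIntegral_eq_interval hf k (by norm_num) (hn x hx)]
    simp only [hs x, add_comm]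
  rw [e.iteratedDeriv_eq, rayIntegral_eq_interval (hf.dirDeriv_iterate j m) k (by norm_num)
    (hn t ht)]
  rw [iteratedDeriv_intervalIntegral m (F := fun p : ℝ × ℝ =>
    f (p.2 • w + p.1 • EuclideanSpace.single j (1 : ℝ)) * p.2 ^ k)]
  · refine intervalIntegral.integral_congr fun r _ => ?_
    simp only
    have h := iteratedDeriv_line m hf j (r • w)
    rw [iteratedDeriv_mul_const_field, h, hs t, add_comm]
  · exact (hf.contDiff.comp ((contDiff_snd.smul contDiff_const).add
      (contDiff_fst.smul contDiff_const))).mul (contDiff_snd.pow k)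

/-- Write `w = ‖w‖ (z, h)`. Backprojection at `z` gives `4π` times the profile, derivatives in the
vertex pass through it, and multiplication by `h` turns it into a ray integral. Of the power `‖w‖ ^
(k + 2)`, one factor normalizes `h` and the others account for the homogeneity of degree `-(k + 1)`
of the ray integral. -/
theorem integral_axisData (hf : IsTest f) (k : ℕ) {j : Fin 3} {t : ℝ} (ht : |t| < 2)
    {w : E3} (hw : 0 < w (missing j)) :
    w (missing j) / ‖w‖ ^ (k + 2) *
      ∫ θ in (-Real.pi)..Real.pi, axisData k f j t w (circ θ) =
      4 * Real.pi * rayIntegral k ((dirDeriv j)^[k - 1] f) (EuclideanSpace.single j t) w := by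
  have hw0 : 0 < ‖w‖ := norm_pos_iff.2 fun h => by simp [h] at hw
  set z : E2 := ‖w‖⁻¹ • bar j w with hz
  set h : ℝ := ‖w‖⁻¹ * w (missing j) with hh
  have hh0 : 0 < h := by positivity
  have hzh : ‖z‖ ^ 2 + h ^ 2 = 1 := by
    rw [hz, hh, norm_smul, norm_inv, norm_norm, mul_pow, mul_pow, ← mul_add, ← norm_sq_eq_bar,
      inv_pow, inv_mul_cancel₀ (by positivity)]
  have hz1 : ‖z‖ ≤ 1 := by nlinarith [norm_nonneg z]
  have hin : ∀ b : E2, ⟪b, bar j w⟫_ℝ / ‖w‖ = ⟪b, z⟫_ℝ := by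
    intro b
    rw [hz, inner_smul_right, div_eq_inv_mul]
  have hwz : axis j z + h • normalVec j = ‖w‖⁻¹ • w := by
    have hb := axis_bar j w
    rw [hz, hh, ← axisL_apply, map_smul, axisL_apply, mul_smul, ← smul_add, hb]
  have e1 : ∫ θ in (-Real.pi)..Real.pi, axisData k f j t w (circ θ) =
      iteratedDeriv (k - 1) (fun t => 4 * Real.pi * profile k f j (t • planeDir j) z) t := by
    have hi := iteratedDeriv_intervalIntegral (k - 1) (F := fun p : ℝ × ℝ =>
      lineData k f j 2 (circ p.2) ⟪circ p.2, z⟫_ℝ p.1)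
      ((contDiff_lineData hf k j 2).comp
        (g := fun p : ℝ × (E2 × ℝ) => lineData k f j 2 p.2.1 p.2.2 p.1)
        (f := fun p : ℝ × ℝ => (p.1, (circ p.2, ⟪circ p.2, z⟫_ℝ)))
        (contDiff_fst.prodMk ((contDiff_circ.comp contDiff_snd).prodMk
          ((contDiff_circ.comp contDiff_snd).inner ℝ contDiff_const)))) (-Real.pi) Real.pi
    have hr : (fun t => 4 * Real.pi * profile k f j (t • planeDir j) z) = fun t =>
        ∫ θ in (-Real.pi)..Real.pi, lineData k f j 2 (circ θ) ⟪circ θ, z⟫_ℝ t := by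
      ext t
      refine (radon_inversion (G := profile k f j (t • planeDir j)) ?_
        (fun z => profile_eq_zero hf k j _) z (by linarith)).symm
      exact (contDiff_profile hf k j).comp (g := fun p : E2 × E2 => profile k f j p.1 p.2)
        (f := fun z => (t • planeDir j, z)) (contDiff_const.prodMk contDiff_id)
    rw [hr, hi]
    simp only [axisData, hin]
  have e2 : h * iteratedDeriv (k - 1) (fun t => profile k f j (t • planeDir j) z) t =
      rayIntegral k ((dirDeriv j)^[k - 1] f) (EuclideanSpace.single j t) (‖w‖⁻¹ • w) := by
    rw [← iteratedDeriv_rayIntegral hf k (k - 1) j ht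
      (by rw [norm_smul, norm_inv, norm_norm, inv_mul_cancel₀ hw0.ne']),
      ← iteratedDeriv_const_mul_field]
    refine Filter.EventuallyEq.iteratedDeriv_eq _ ?_
    filter_upwards [continuous_abs.continuousAt.eventually_lt_const ht] with x hx
    rw [mul_profile hf k j (by rw [norm_smul_planeDir]; exact hx.le) hh0 hzh, hwz,
      axis_smul_planeDir]
  rw [e1, iteratedDeriv_const_mul_field]
  rw [rayIntegral_smul k _ _ w hw0] at e2
  have e3 : w (missing j) / ‖w‖ ^ (k + 2) = h / ‖w‖ ^ (k + 1) := by
    rw [hh]; field_simp; ring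
  rw [e3]
  calc _ = 4 * Real.pi * (h * iteratedDeriv (k - 1)
        (fun t => profile k f j (t • planeDir j) z) t) / ‖w‖ ^ (k + 1) := by ring
    _ = _ := by rw [e2]; field_simp

/-- Directions with nonpositive missing component contribute zero on both sides: on the left by the
positive part, on the right by the support of `f`. -/
theorem axisIntegral_eq (hf : IsTest f) (k : ℕ) {j : Fin 3} {u : E3} (hu : u ∈ sensorLine j)
    (w : E3) : axisIntegral k f j u w =
      4 * Real.pi * rayIntegral k ((dirDeriv j)^[k - 1] f) u w := by
  rw [axisIntegral]
  simp only [axisIntegrand_eq hf k hu w]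
  rcases lt_or_ge 0 (w (missing j)) with hw | hw
  · rw [integral_const_mul, integral_arcS1 (axisData k f j (u j) w), max_eq_left hw.le,
      integral_axisData hf k _ hw, ← eq_single_of_mem_sensorLine hu]
    rw [abs_of_nonneg hu.1.1]
    linarith [hu.1.2]
  · rw [max_eq_right hw, rayIntegral_eq_zero (hf.dirDeriv_iterate j _) k
      (hu.2 _ (missing_ne j)) hw]
    simp

end AxisIntegral

/-! ### Repeated integration in the component along the segment -/

section LineIntegral

variable {f : E3 → ℝ}

theorem setIntegral_Ioi_eq_interval {φ : ℝ → ℝ} {L : ℝ} (hL : 0 ≤ L) (h : ∀ x, L < x → φ x = 0) :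
    ∫ x in Ioi (0 : ℝ), φ x = ∫ x in (0 : ℝ)..L, φ x := by
  rw [intervalIntegral.integral_of_le hL]
  refine setIntegral_eq_of_subset_of_forall_sdiff_eq_zero measurableSet_Ioi
    (fun v hv => hv.1) fun x hx => h x ?_
  by_contra hx'
  exact hx.2 ⟨hx.1, not_lt.1 hx'⟩

theorem IsTest.hasDerivAt_line_neg (hf : IsTest f) (j : Fin 3) (y : E3) (p : ℝ) :
    HasDerivAt (fun p : ℝ => f (y - p • EuclideanSpace.single j (1 : ℝ)))
      (-TripleLine.dirDeriv j f (y - p • EuclideanSpace.single j (1 : ℝ))) p := by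
  have h := (hf.hasDerivAt_line j y (-p)).comp p (hasDerivAt_neg p)
  simpa [Function.comp_def, sub_eq_add_neg] using h

theorem IsTest.continuous_line (hf : IsTest f) (j : Fin 3) (y : E3) :
    Continuous fun p : ℝ => f (y - p • EuclideanSpace.single j (1 : ℝ)) :=
  hf.contDiff.continuous.comp (by fun_prop)

/-- Cauchy's formula for repeated integration, for the derivatives of `f` along a line. -/
theorem integral_pow_mul_dirDeriv (hf : IsTest f) (j : Fin 3) (y : E3) (m : ℕ) :
    ∫ p in Ioi (0 : ℝ), p ^ m * (dirDeriv j)^[m + 1] f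
      (y - p • EuclideanSpace.single j (1 : ℝ)) = m.factorial * f y := by
  set e : E3 := EuclideanSpace.single j (1 : ℝ) with he
  have hz : ∀ {g : E3 → ℝ}, IsTest g → ∀ p : ℝ, ‖y‖ + 1 < p → g (y - p • e) = 0 := by
    intro g hg p hp
    refine hg.eq_zero_of_one_lt_norm ?_
    have h1 : ‖p • e‖ ≤ ‖y‖ + ‖y - p • e‖ := by
      simpa using norm_sub_le y (y - p • e)
    rw [norm_smul, he, PiLp.norm_single, norm_one, mul_one,
      Real.norm_of_nonneg (by linarith [norm_nonneg y])] at h1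
    linarith
  have hL : 0 ≤ ‖y‖ + 2 := by positivity
  have hz' : ∀ {g : E3 → ℝ}, IsTest g → ∀ n : ℕ, ∀ p : ℝ, ‖y‖ + 2 < p → p ^ n * g (y - p • e) = 0 := by
    intro g hg n p hp
    rw [hz hg p (by linarith), mul_zero]
  induction m with
  | zero =>
    rw [setIntegral_Ioi_eq_interval hL (hz' (hf.dirDeriv_iterate j _) _)]
    simp only [pow_zero, one_mul, zero_add, Function.iterate_one, Nat.factorial_zero, Nat.cast_one]
    have h := intervalIntegral.integral_eq_sub_of_hasDerivAt (a := 0) (b := ‖y‖ + 2)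
      (fun p _ => hf.hasDerivAt_line_neg j y p)
      (((hf.dirDeriv j).continuous_line j y).neg.intervalIntegrable _ _)
    rw [intervalIntegral.integral_neg, ← he, hz hf _ (by linarith), zero_smul, sub_zero] at h
    linarith
  | succ m ih =>
    have hg := hf.dirDeriv_iterate j (m + 1)
    rw [setIntegral_Ioi_eq_interval hL (hz' hg _)] at ih
    rw [setIntegral_Ioi_eq_interval hL (hz' (hf.dirDeriv_iterate j _) _)]
    -- Integration by parts: the boundary term vanishes at `p = 0` by the positive power and at the
    -- upper limit by the support.
    have hd : ∀ p : ℝ, HasDerivAt (fun p : ℝ => p ^ (m + 1) * (dirDeriv j)^[m + 1] f (y - p • e))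
        ((m + 1) * (p ^ m * (dirDeriv j)^[m + 1] f (y - p • e)) -
          p ^ (m + 1) * (dirDeriv j)^[m + 1 + 1] f (y - p • e)) p := by
      intro p
      have h1 := (hasDerivAt_pow (m + 1) p).mul (hg.hasDerivAt_line_neg j y p)
      rw [Function.iterate_succ_apply' _ (m + 1)]
      refine h1.congr_deriv ?_
      push_cast
      ring
    have hc1 : Continuous fun p : ℝ => (m + 1) * (p ^ m * (dirDeriv j)^[m + 1] f (y - p • e)) :=
      continuous_const.mul ((continuous_pow m).mul (hg.continuous_line j y))
    have hc2 : Continuous fun p : ℝ => p ^ (m + 1) * (dirDeriv j)^[m + 1 + 1] f (y - p • e) :=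
      (continuous_pow _).mul ((hf.dirDeriv_iterate j _).continuous_line j y)
    have h := intervalIntegral.integral_eq_sub_of_hasDerivAt (a := 0) (b := ‖y‖ + 2)
      (fun p _ => hd p) ((hc1.sub hc2).intervalIntegrable _ _)
    rw [intervalIntegral.integral_sub (hc1.intervalIntegrable _ _) (hc2.intervalIntegrable _ _),
      intervalIntegral.integral_const_mul, ih, hz hg _ (by linarith), zero_pow (by simp)] at h
    rw [Nat.factorial_succ]
    push_cast
    linarith

theorem setCoord_eq (j : Fin 3) (α : E3) (q : ℝ) :
    setCoord j α q = α - (α j - q) • EuclideanSpace.single j (1 : ℝ) := by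
  ext i
  by_cases h : i = j
  · subst h; simp [setCoord]
  · simp [setCoord, h]

/-- The integrand of `lineIntegral` in the coordinates `r` along the rays and `σ = α j - q`. -/
noncomputable def fanIntegrand (m : ℕ) (g : E3 → ℝ) (j : Fin 3) (u α : E3) (r σ : ℝ) : ℝ :=
  σ ^ m * (g (u + r • (α - σ • EuclideanSpace.single j (1 : ℝ))) * r ^ (m + 2))

theorem continuous_fanIntegrand {g : E3 → ℝ} (hg : IsTest g) (m : ℕ) (j : Fin 3) (u α : E3) :
    Continuous (Function.uncurry (fanIntegrand m g j u α)) := by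
  have := hg.contDiff.continuous
  unfold fanIntegrand Function.uncurry
  fun_prop

/-- In the simplex the missing coordinate is at most `1`, so `r ≤ ρ = 1 / α (missing j)`. The
coordinate `j` is nonnegative and `u j ≤ 1`, so `r * σ ≤ K = 1 + ρ |α j|`. The bound uses `σ ^ m * r
^ (m + 2) = (r * σ) ^ m * r ^ 2`. -/
theorem fanIntegrand_bound {g : E3 → ℝ} (hg : IsTest g) (m : ℕ) {j : Fin 3} {u α : E3}
    (hu : u ∈ sensorLine j) (hα : 0 < α (missing j)) : ∃ C K ρ : ℝ, 0 ≤ C ∧ 0 ≤ K ∧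
      ∀ r σ : ℝ, 0 < r → 0 < σ → ‖fanIntegrand m g j u α r σ‖ ≤ C * r ^ 2 ∧
        (ρ < r → fanIntegrand m g j u α r σ = 0) ∧
        (K < r * σ → fanIntegrand m g j u α r σ = 0) := by
  obtain ⟨C, hC⟩ := hg.contDiff.continuous.bounded_above_of_compact_support hg.hasCompactSupport
  have hC0 : 0 ≤ C := (norm_nonneg _).trans (hC 0)
  set ρ := 1 / α (missing j) with hρ
  have hρ0 : 0 < ρ := by positivity
  set K := 1 + ρ * |α j| with hK
  have hK0 : 0 ≤ K := by positivity
  have hne : ∀ r σ : ℝ, 0 < r → 0 < σ →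
      g (u + r • (α - σ • EuclideanSpace.single j (1 : ℝ))) ≠ 0 → r ≤ ρ ∧ r * σ ≤ K := by
    intro r σ hr hσ h
    have hs := (hg.mem_simplex h).1
    have h1 := (hs (missing j)).2
    have h2 := (hs j).1
    simp [missing_ne j, hu.2 _ (missing_ne j)] at h1
    simp at h2
    have h3 : r ≤ ρ := by rw [hρ, le_div_iff₀ hα]; exact h1
    refine ⟨h3, ?_⟩
    have h4 : r * α j ≤ ρ * |α j| := by
      have := le_abs_self (α j)
      have := abs_nonneg (α j)
      nlinarith
    have := hu.1.2
    rw [hK]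
    nlinarith
  have hzero : ∀ r σ : ℝ, g (u + r • (α - σ • EuclideanSpace.single j (1 : ℝ))) = 0 →
      fanIntegrand m g j u α r σ = 0 := by
    intro r σ h
    rw [fanIntegrand, h, zero_mul, mul_zero]
  refine ⟨C * K ^ m, K, ρ, by positivity, hK0, fun r σ hr hσ => ⟨?_, fun h => ?_, fun h => ?_⟩⟩
  · by_cases h : g (u + r • (α - σ • EuclideanSpace.single j (1 : ℝ))) = 0
    · rw [hzero r σ h, norm_zero]; positivity
    · have h1 := (hne r σ hr hσ h).2
      rw [fanIntegrand, show σ ^ m * (g (u + r • (α - σ • EuclideanSpace.single j (1 : ℝ))) *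
        r ^ (m + 2)) = g (u + r • (α - σ • EuclideanSpace.single j (1 : ℝ))) *
          ((r * σ) ^ m * r ^ 2) by ring, norm_mul, mul_assoc,
        Real.norm_of_nonneg (r := (r * σ) ^ m * r ^ 2) (by positivity)]
      gcongr
      exact hC _
  · by_contra h'
    have := (hne r σ hr hσ fun h0 => h' (hzero r σ h0)).1
    linarith
  · by_contra h'
    have := (hne r σ hr hσ fun h0 => h' (hzero r σ h0)).2
    linarith

/-- For fixed `r` the integrand is at most `C r²` on a `σ`-interval of length `K / r`. The inner
integral is therefore at most `C K r`, which is integrable on `(0, ρ]`. -/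
theorem integrable_fanIntegrand {g : E3 → ℝ} (hg : IsTest g) (m : ℕ) {j : Fin 3} {u α : E3}
    (hu : u ∈ sensorLine j) (hα : 0 < α (missing j)) :
    Integrable (Function.uncurry (fanIntegrand m g j u α))
      ((volume.restrict (Ioi 0)).prod (volume.restrict (Ioi 0))) := by
  obtain ⟨C, K, ρ, hC0, hK0, hb⟩ := fanIntegrand_bound hg m hu hα
  have hcont := continuous_fanIntegrand hg m j u α
  have hz : ∀ r : ℝ, 0 < r → ∀ σ ∈ Ioi (0 : ℝ) \ Ioc 0 (K / r), fanIntegrand m g j u α r σ = 0 := by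
    intro r hr σ hσ
    have h1 : K / r < σ := by
      by_contra h
      exact hσ.2 ⟨hσ.1, not_lt.1 h⟩
    refine (hb r σ hr hσ.1).2.2 ?_
    rwa [div_lt_iff₀ hr, mul_comm] at h1
  have hsub : ∀ r : ℝ, Ioc 0 (K / r) ⊆ Ioi 0 := fun r σ hσ => hσ.1
  refine (integrable_prod_iff hcont.aestronglyMeasurable).2 ⟨?_, ?_⟩
  · refine (ae_restrict_iff' measurableSet_Ioi).2 (.of_forall fun r hr => ?_)
    refine IntegrableOn.of_forall_sdiff_eq_zero (s := Ioc 0 (K / r)) ?_ measurableSet_Ioi (hz r hr)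
    have hc : Continuous fun σ => fanIntegrand m g j u α r σ := 
      hcont.comp (f := fun σ => (r, σ)) (Continuous.prodMk_right r)
    exact (hc.integrableOn_Icc (a := 0) (b := K / r)).mono_set Ioc_subset_Icc_self
  · have hm := (hcont.norm.aestronglyMeasurable
      (μ := (volume.restrict (Ioi (0 : ℝ))).prod (volume.restrict (Ioi 0)))).integral_prod_right'
    have hpt : ∀ r ∈ Ioi (0 : ℝ), ‖∫ σ in Ioi (0 : ℝ), ‖fanIntegrand m g j u α r σ‖‖ ≤
        C * r * K := by
      intro r hr
      have e := setIntegral_eq_of_subset_of_forall_sdiff_eq_zero (μ := volume) measurableSet_Ioi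
        (hsub r) (f := fun σ => ‖fanIntegrand m g j u α r σ‖)
        (fun σ hσ => by simp [hz r hr σ hσ])
      rw [e]
      have hr' : (0 : ℝ) < r := hr
      refine (norm_setIntegral_le_of_norm_le_const (C := C * r ^ 2) measure_Ioc_lt_top
        fun σ hσ => ?_).trans ?_
      · rw [norm_norm]; exact (hb r σ hr hσ.1).1
      · rw [Real.volume_real_Ioc_of_le (by positivity), sub_zero]
        apply le_of_eq
        field_simp
    refine IntegrableOn.of_forall_sdiff_eq_zero (s := Ioc 0 ρ) ?_ measurableSet_Ioi ?_
    · refine Integrable.mono' (g := fun r => C * r * K) ?_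
        (hm.mono_measure (Measure.restrict_mono (fun r hr => hr.1) le_rfl)) ?_
      · exact ((by fun_prop : Continuous fun r : ℝ => C * r * K).integrableOn_Icc
          (a := 0) (b := ρ)).mono_set Ioc_subset_Icc_self
      · exact (ae_restrict_iff' measurableSet_Ioc).2 (.of_forall fun r hr => hpt r hr.1)
    · intro r hr
      have h1 : ρ < r := by
        by_contra h
        exact hr.2 ⟨hr.1, not_lt.1 h⟩
      have : ∫ σ in Ioi (0 : ℝ), ‖fanIntegrand m g j u α r σ‖ = ∫ σ in Ioi (0 : ℝ), (0 : ℝ) :=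
        setIntegral_congr_fun measurableSet_Ioi fun σ hσ => by
          simp [(hb r σ hr.1 hσ).2.1 h1]
      simpa using this

/-- The substitution `p = r σ` turns `r ^ (m + 2) σ ^ m dσ` into `r p ^ m dp`; Cauchy's formula then
removes all `m + 1` derivatives. -/
theorem integral_fanIntegrand (hf : IsTest f) (m : ℕ) (j : Fin 3) (u α : E3) {r : ℝ} (hr : 0 < r) :
    ∫ σ in Ioi (0 : ℝ), fanIntegrand m ((dirDeriv j)^[m + 1] f) j u α r σ =
      m.factorial * (f (u + r • α) * r ^ 1) := by
  have h1 := integral_pow_mul_dirDeriv hf j (u + r • α) m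
  have h2 := integral_comp_mul_left_Ioi (fun p => p ^ m * (dirDeriv j)^[m + 1] f
      (u + r • α - p • EuclideanSpace.single j (1 : ℝ))) 0 hr
  rw [mul_zero, h1] at h2
  have h3 : ∀ σ, fanIntegrand m ((dirDeriv j)^[m + 1] f) j u α r σ = r ^ 2 * ((r * σ) ^ m *
      (dirDeriv j)^[m + 1] f (u + r • α - (r * σ) • EuclideanSpace.single j (1 : ℝ))) := by
    intro σ
    rw [fanIntegrand, smul_sub, smul_smul, add_sub_assoc]
    ring
  simp only [h3]
  rw [integral_const_mul, h2, smul_eq_mul]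
  field_simp

theorem setIntegral_Iio_sub (φ : ℝ → ℝ) (a : ℝ) :
    ∫ q in Iio a, φ (a - q) = ∫ σ in Ioi 0, φ σ := by
  have h := (Measure.measurePreserving_sub_left (volume : Measure ℝ) a).setIntegral_preimage_emb
    (Homeomorph.subLeft a).measurableEmbedding φ (Ioi 0)
  rw [← h]
  congr 2
  ext q; simp

theorem integrableOn_Iio_sub {φ : ℝ → ℝ} (hφ : IntegrableOn φ (Ioi 0)) (a : ℝ) :
    IntegrableOn (fun q => φ (a - q)) (Iio a) := by
  have h := ((Measure.measurePreserving_sub_left (volume : Measure ℝ) a).integrableOn_comp_preimage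
    (Homeomorph.subLeft a).measurableEmbedding).2 hφ
  convert! h using 1
  ext q; simp

theorem lineIntegrand_eq (hf : IsTest f) (m : ℕ) {j : Fin 3} {u : E3} (hu : u ∈ sensorLine j)
    (α : E3) (q : ℝ) : lineIntegrand (m + 2) f j u α q = 4 * Real.pi *
      ∫ r in Ioi (0 : ℝ), fanIntegrand m ((dirDeriv j)^[m + 1] f) j u α r (α j - q) := by
  rw [lineIntegrand, axisIntegral_eq hf _ hu, setCoord_eq, rayIntegral]
  simp only [fanIntegrand, Nat.add_sub_cancel, show m + 2 - 1 = m + 1 by omega]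
  rw [integral_const_mul]
  ring

theorem lineIntegrand_eq_zero (hf : IsTest f) (k : ℕ) {j : Fin 3} {u : E3}
    (hu : u ∈ sensorLine j) {α : E3} (hα : α (missing j) ≤ 0) (q : ℝ) :
    lineIntegrand k f j u α q = 0 := by
  rw [lineIntegrand, axisIntegral_eq hf _ hu, rayIntegral_eq_zero (hf.dirDeriv_iterate j _) k
    (hu.2 _ (missing_ne j)), mul_zero, mul_zero]
  simpa [setCoord, missing_ne j] using hα

theorem integrableOn_lineIntegrand (hf : IsTest f) {k : ℕ} (hk : 2 ≤ k) {j : Fin 3} {u : E3}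
    (hu : u ∈ sensorLine j) (α : E3) : IntegrableOn (lineIntegrand k f j u α) (Iio (α j)) := by
  obtain ⟨m, rfl⟩ := Nat.exists_eq_add_of_le' hk
  rcases lt_or_ge 0 (α (missing j)) with hα | hα
  · rw [funext (lineIntegrand_eq hf m hu α)]
    have h := (integrable_fanIntegrand (hf.dirDeriv_iterate j (m + 1)) m hu hα).integral_prod_right
    exact integrableOn_Iio_sub (φ := fun σ => 4 * Real.pi *
      ∫ r in Ioi (0 : ℝ), fanIntegrand m ((dirDeriv j)^[m + 1] f) j u α r σ) (h.const_mul _) (α j)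
  · rw [funext (lineIntegrand_eq_zero hf _ hu hα)]
    exact integrableOn_zero

theorem lineIntegral_eq (hf : IsTest f) {k : ℕ} (hk : 1 ≤ k) {j : Fin 3} {u : E3}
    (hu : u ∈ sensorLine j) (α : E3) : lineIntegral k f j u α =
      4 * Real.pi * (k - 2).factorial * rayIntegral 1 f u α := by
  rw [lineIntegral]
  split_ifs with h1
  -- There are no derivatives here, and truncated subtraction reads `(1 - 2)!` as `0! = 1`.
  · subst h1
    rw [axisIntegral_eq hf _ hu]
    simp
  · obtain ⟨m, rfl⟩ := Nat.exists_eq_add_of_le' (show 2 ≤ k by omega)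
    rcases lt_or_ge 0 (α (missing j)) with hα | hα
    · simp only [lineIntegrand_eq hf m hu α]
      rw [setIntegral_Iio_sub (fun σ => 4 * Real.pi *
        ∫ r in Ioi (0 : ℝ), fanIntegrand m ((dirDeriv j)^[m + 1] f) j u α r σ), integral_const_mul,
        ← integral_integral_swap
          (integrable_fanIntegrand (hf.dirDeriv_iterate j (m + 1)) m hu hα),
        setIntegral_congr_fun measurableSet_Ioi
          (fun r hr => integral_fanIntegrand hf m j u α hr), integral_const_mul, rayIntegral,
        Nat.add_sub_cancel]
      ring
    · simp only [lineIntegrand_eq_zero hf _ hu hα]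
      rw [rayIntegral_eq_zero hf 1 (hu.2 _ (missing_ne j)) hα]
      simp

end LineIntegral

/-! ### From rays to planes -/

section PlaneIntegral

variable {f : E3 → ℝ}

/-- The Lebesgue measure of the plane `perp n`. -/
noncomputable abbrev planeVolume (n : S2) : Measure (perp n) :=
  @volume (perp n) measureSpaceOfInnerProductSpace

theorem finrank_perp (n : S2) : Module.finrank ℝ (perp n) = 2 := by
  have : Fact (Module.finrank ℝ E3 = 2 + 1) := ⟨by simp⟩
  exact Submodule.finrank_orthogonal_span_singleton (fun h => by
    have := norm_eq_of_mem_sphere n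
    rw [h, norm_zero] at this
    exact zero_ne_one this)

instance (n : S2) : Nontrivial (perp n) :=
  Module.nontrivial_of_finrank_pos (R := ℝ) (by rw [finrank_perp]; norm_num)

instance (n : S2) : IsFiniteMeasure (arcGreatCircle n) := by
  unfold arcGreatCircle; infer_instance

theorem continuous_rayIntegral_circle (hf : IsTest f) (k : ℕ) (u : E3) (n : S2) :
    Continuous fun α : GreatCircle n => rayIntegral k f u ((α : perp n) : E3) := by
  have hn : ∀ α : GreatCircle n, ‖((α : perp n) : E3)‖ = 1 := fun α => norm_eq_of_mem_sphere α
  have e : (fun α : GreatCircle n => rayIntegral k f u ((α : perp n) : E3)) = fun α : GreatCircle n =>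
      ∫ r in (0 : ℝ)..(1 + ‖u‖), f (u + r • ((α : perp n) : E3)) * r ^ k := by
    ext α
    exact rayIntegral_eq_interval hf k (by positivity) (by rw [hn, mul_one])
  rw [e]
  have := hf.contDiff.continuous
  refine intervalIntegral.continuous_parametric_intervalIntegral_of_continuous'
    (f := fun (α : GreatCircle n) r => f (u + r • ((α : perp n) : E3)) * r ^ k) ?_ _ _
  unfold Function.uncurry
  fun_prop

theorem integrable_lineIntegral (hf : IsTest f) {k : ℕ} (hk : 1 ≤ k) {j : Fin 3} {u : E3}
    (hu : u ∈ sensorLine j) (n : S2) : Integrable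
        (fun α : GreatCircle n => lineIntegral k f j u ((α : perp n) : E3))
        (arcGreatCircle n) := by
  simp only [lineIntegral_eq hf hk hu]
  exact (continuous_const.mul (continuous_rayIntegral_circle hf 1 u n)).integrable_of_hasCompactSupport
    (HasCompactSupport.of_compactSpace _)

theorem integrable_comp_perp (hf : IsTest f) (x : E3) (n : S2) :
    Integrable (fun y : perp n => f (x + y)) (planeVolume n) := by
  have := hf.contDiff.continuous
  refine Continuous.integrable_of_hasCompactSupport (by fun_prop) ?_
  refine HasCompactSupport.of_support_subset_isCompact
    (isCompact_closedBall (0 : perp n) (1 + ‖x‖)) fun y hy => ?_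
  have h1 := IsTest.norm_le_one_of_mem_simplex (hf.mem_simplex hy)
  have h2 : ‖(y : E3)‖ ≤ ‖x + y‖ + ‖x‖ := by simpa using norm_sub_le (x + (y : E3)) x
  rw [mem_closedBall_zero_iff]
  have h3 : ‖y‖ = ‖(y : E3)‖ := rfl
  linarith

/-- The integral of `f` over the plane through `x` with normal `n`. -/
noncomputable def planeRadon (f : E3 → ℝ) (x : E3) (n : S2) : ℝ :=
  ∫ y, f (x + (y : E3)) ∂(planeVolume n)

/-- The weight `r` of the ray integrals is exactly the density of polar coordinates in a plane. -/
theorem planeIntegral_eq (hf : IsTest f) {k : ℕ} (hk : 1 ≤ k) {j : Fin 3} {u : E3}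
    (hu : u ∈ sensorLine j) (n : S2) : planeIntegral k f j u n =
      4 * Real.pi * (k - 2).factorial * planeRadon f u n := by
  rw [planeIntegral]
  simp only [lineIntegral_eq hf hk hu]
  rw [integral_const_mul, planeRadon, integral_polar (planeVolume n) (integrable_comp_perp hf u n),
    finrank_perp]
  congr 1
  refine integral_congr_ae (.of_forall fun α => ?_)
  refine setIntegral_congr_fun measurableSet_Ioi fun r _ => ?_
  simp only [Submodule.coe_smul, Nat.add_one_sub_one]
  ring

/-- Translation by `x - u`, a vector of the plane `perp n`. This makes the result independent of the
chosen vertex. -/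
theorem planeRadon_eq_of_inner (f : E3 → ℝ) {x u : E3} {n : S2} (h : ⟪x - u, (n : E3)⟫_ℝ = 0) :
    planeRadon f u n = planeRadon f x n := by
  have hm : x - u ∈ perp n := by
    rw [Submodule.mem_orthogonal_singleton_iff_inner_right, real_inner_comm]
    exact h
  rw [planeRadon, planeRadon, ← integral_add_left_eq_self _ (⟨x - u, hm⟩ : perp n)]
  congr 1
  ext y
  simp only [Submodule.coe_add]
  congr 1
  abel

end PlaneIntegral

instance : IsFiniteMeasure areaS2 := by unfold areaS2; infer_instance

/-! ### Gaussian integrals and majorants -/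

section Gaussian

theorem integral_exp_neg_norm_sq {V : Type*} [NormedAddCommGroup V] [InnerProductSpace ℝ V]
    [FiniteDimensional ℝ V] [MeasurableSpace V] [BorelSpace V] :
    ∫ v : V, Real.exp (-‖v‖ ^ 2) = Real.pi ^ (Module.finrank ℝ V / 2 : ℝ) := by
  have := GaussianFourier.integral_rexp_neg_mul_sq_norm (V := V) one_pos
  simpa using this

/-- Read off from the positive value of the integral: without integrability it would be zero. -/
theorem integrable_exp_neg_norm_sq {V : Type*} [NormedAddCommGroup V] [InnerProductSpace ℝ V]
    [FiniteDimensional ℝ V] [MeasurableSpace V] [BorelSpace V] :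
    Integrable fun v : V => Real.exp (-‖v‖ ^ 2) := by
  by_contra h
  have h1 := integral_undef h
  rw [integral_exp_neg_norm_sq] at h1
  exact (Real.rpow_pos_of_pos Real.pi_pos _).ne' h1

/-- A radial Gaussian majorant restricts to every plane with the same integral, so it serves all
normals at once. -/
theorem IsTest.gaussian_bound {f : E3 → ℝ} (hf : IsTest f) (x : E3) :
    ∃ C, 0 ≤ C ∧ ∀ y, ‖f (x + y)‖ ≤ C * Real.exp (-‖y‖ ^ 2) := by
  obtain ⟨M, hM⟩ := hf.contDiff.continuous.bounded_above_of_compact_support hf.hasCompactSupport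
  have hM0 : 0 ≤ M := (norm_nonneg _).trans (hM 0)
  refine ⟨M * Real.exp ((1 + ‖x‖) ^ 2), by positivity, fun y => ?_⟩
  by_cases h : f (x + y) = 0
  · rw [h, norm_zero]; positivity
  · have h1 := IsTest.norm_le_one_of_mem_simplex (hf.mem_simplex h)
    have h2 : ‖y‖ ≤ ‖x + y‖ + ‖x‖ := by simpa using norm_sub_le (x + y) x
    have h3 : ‖y‖ ^ 2 ≤ (1 + ‖x‖) ^ 2 := by gcongr; linarith
    rw [mul_assoc, ← Real.exp_add]
    refine (hM _).trans (le_mul_of_one_le_right hM0 (Real.one_le_exp ?_))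
    linarith

end Gaussian

/-! ### Splitting space into a line and its orthogonal plane -/

section Decomposition

/-- The isometry of the product of a line and its orthogonal plane onto the space. -/
noncomputable def planeIsometry (n : S2) : WithLp 2 (ℝ × perp n) →ₗᵢ[ℝ] E3 where
  toFun p := p.fst • (n : E3) + (p.snd : E3)
  map_add' a b := by
    simp only [WithLp.add_fst, WithLp.add_snd, Submodule.coe_add]; module
  map_smul' c a := by
    simp [smul_smul]
  norm_map' p := by
    have hn : ‖(n : E3)‖ = 1 := norm_eq_of_mem_sphere n
    have h : ⟪(n : E3), (p.snd : E3)⟫_ℝ = 0 :=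
      Submodule.mem_orthogonal_singleton_iff_inner_right.1 p.snd.2
    have h1 : ‖p.fst • (n : E3) + (p.snd : E3)‖ ^ 2 = ‖p‖ ^ 2 := by
      rw [norm_add_sq_real, inner_smul_left, h, norm_smul, hn, WithLp.prod_norm_sq_eq_of_L2]
      simp
    exact (sq_eq_sq₀ (norm_nonneg _) (norm_nonneg _)).1 h1

theorem measurePreserving_isometry {V : Type*} [NormedAddCommGroup V] [InnerProductSpace ℝ V]
    [FiniteDimensional ℝ V] [MeasurableSpace V] [BorelSpace V] (e : WithLp 2 (ℝ × V) ≃ₗᵢ[ℝ] E3) :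
    MeasurePreserving (fun p : ℝ × V => e (WithLp.toLp 2 p)) (volume.prod volume) volume :=
  e.measurePreserving.comp (WithLp.volume_preserving_toLp ℝ V)

theorem measurePreserving_plane (n : S2) :
    MeasurePreserving (fun p : ℝ × perp n => p.1 • (n : E3) + (p.2 : E3))
      (volume.prod (planeVolume n)) volume :=
  measurePreserving_isometry ((planeIsometry n).toLinearIsometryEquiv (by
    rw [(WithLp.linearEquiv 2 ℝ (ℝ × perp n)).finrank_eq, Module.finrank_prod, finrank_perp]
    simp))

theorem measurableEmbedding_plane (n : S2) :
    MeasurableEmbedding (fun p : ℝ × perp n => p.1 • (n : E3) + (p.2 : E3)) := by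
  have e : IsClosedEmbedding (fun p : ℝ × perp n => planeIsometry n (WithLp.toLp 2 p)) :=
    (planeIsometry n).isometry.isClosedEmbedding.comp
      (WithLp.homeomorphProd 2 ℝ (perp n)).symm.isClosedEmbedding
  exact e.measurableEmbedding

theorem integral_plane_decomposition (n : S2) (H : E3 → ℝ) :
    ∫ y, H y = ∫ p : ℝ × perp n, H (p.1 • (n : E3) + (p.2 : E3)) ∂(volume.prod (planeVolume n)) :=
  ((measurePreserving_plane n).integral_comp (measurableEmbedding_plane n) H).symm

theorem integrable_plane_decomposition (n : S2) {H : E3 → ℝ} (hH : Integrable H) :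
    Integrable (fun p : ℝ × perp n => H (p.1 • (n : E3) + (p.2 : E3)))
      (volume.prod (planeVolume n)) :=
  ((measurePreserving_plane n).integrable_comp_emb (measurableEmbedding_plane n)).2 hH

theorem inner_plane (n : S2) (t : ℝ) (z : perp n) : ⟪t • (n : E3) + (z : E3), (n : E3)⟫_ℝ = t := by
  have hn : ‖(n : E3)‖ = 1 := norm_eq_of_mem_sphere n
  have h : ⟪(z : E3), (n : E3)⟫_ℝ = 0 := by
    rw [real_inner_comm]
    exact Submodule.mem_orthogonal_singleton_iff_inner_right.1 z.2
  rw [inner_add_left, inner_smul_left, h, real_inner_self_eq_norm_sq, hn]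
  simp

theorem norm_plane_sq (n : S2) (t : ℝ) (z : perp n) :
    ‖t • (n : E3) + (z : E3)‖ ^ 2 = t ^ 2 + ‖z‖ ^ 2 := by
  have h := (planeIsometry n).norm_map (WithLp.toLp 2 (t, z))
  have h2 : ‖t • (n : E3) + (z : E3)‖ = ‖(WithLp.toLp 2 (t, z) : WithLp 2 (ℝ × perp n))‖ := h
  rw [h2, WithLp.prod_norm_sq_eq_of_L2]
  simp

end Decomposition

/-! ### The mean of all plane integrals through a point -/

section Band

/-- The profile of an approximate unit, with integral `2`. -/
noncomputable def bump (t : ℝ) : ℝ := ((1 + t ^ 2) * √(1 + t ^ 2))⁻¹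

theorem bump_pos (t : ℝ) : 0 < bump t := by unfold bump; positivity

theorem continuous_bump : Continuous bump := by
  unfold bump
  refine Continuous.inv₀ (by fun_prop) fun t => ?_
  positivity

theorem hasDerivAt_bump (t : ℝ) : HasDerivAt (fun t => t / √(1 + t ^ 2)) (bump t) t := by
  have hp : 0 < 1 + t ^ 2 := by positivity
  have hs := (Real.sqrt_pos.2 hp).ne'
  have h1 : HasDerivAt (fun t : ℝ => √(1 + t ^ 2)) (t / √(1 + t ^ 2)) t := by
    refine (((hasDerivAt_pow 2 t).const_add 1).sqrt hp.ne').congr_deriv ?_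
    rw [pow_one, Nat.cast_ofNat, mul_div_mul_left _ _ two_ne_zero]
  refine ((hasDerivAt_id t).div h1 hs).congr_deriv ?_
  have h2 : √(1 + t ^ 2) ^ 2 = 1 + t ^ 2 := Real.sq_sqrt hp.le
  rw [bump, id]
  field_simp
  rw [h2]
  ring

theorem tendsto_div_sqrt : Tendsto (fun t : ℝ => t / √(1 + t ^ 2)) atTop (𝓝 1) := by
  have h1 : Tendsto (fun t : ℝ => (√(1 + (t⁻¹) ^ 2))⁻¹) atTop (𝓝 1) := by
    have hc : Continuous fun s : ℝ => (√(1 + s ^ 2))⁻¹ :=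
      Continuous.inv₀ (by fun_prop) fun s => by positivity
    have h0 : (√(1 + (0 : ℝ) ^ 2))⁻¹ = 1 := by simp
    have h2 := (hc.tendsto 0).comp tendsto_inv_atTop_zero
    rw [h0] at h2
    exact h2
  refine h1.congr' ?_
  filter_upwards [eventually_gt_atTop 0] with t ht
  have : √(1 + t⁻¹ ^ 2) = √(1 + t ^ 2) / t := by
    rw [eq_div_iff ht.ne', ← Real.sqrt_sq ht.le, ← Real.sqrt_mul (by positivity), Real.sqrt_sq ht.le]
    congr 1
    field_simp
    ring
  rw [this, inv_div]

theorem integrableOn_bump : IntegrableOn bump (Ioi 0) :=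
  integrableOn_Ioi_deriv_of_nonneg' (fun t _ => hasDerivAt_bump t) (fun t _ => (bump_pos t).le)
    tendsto_div_sqrt

theorem bump_abs (t : ℝ) : bump |t| = bump t := by simp [bump]

theorem integrable_bump : Integrable bump := by
  refine integrable_inv_one_add_sq.mono' continuous_bump.aestronglyMeasurable (.of_forall fun t => ?_)
  rw [Real.norm_of_nonneg (bump_pos t).le, bump]
  have : 1 ≤ √(1 + t ^ 2) := Real.one_le_sqrt.2 (by nlinarith [sq_nonneg t])
  exact inv_anti₀ (by positivity) (le_mul_of_one_le_right (by positivity) this)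

theorem integral_bump : ∫ t, bump t = 2 := by
  have h := integral_comp_abs (f := bump)
  simp only [bump_abs] at h
  rw [h, integral_Ioi_of_hasDerivAt_of_tendsto' (fun t _ => hasDerivAt_bump t) integrableOn_bump
    tendsto_div_sqrt]
  simp

theorem integral_sq_mul_exp {b : ℝ} (hb : 0 < b) :
    ∫ r in Ioi (0 : ℝ), r ^ 2 * Real.exp (-b * r ^ 2) = √Real.pi / 4 * (b * √b)⁻¹ := by
  have h := integral_rpow_mul_exp_neg_mul_rpow (p := 2) (q := 2) (b := b) two_pos (by norm_num) hb
  have hG : Real.Gamma ((2 + 1) / 2) = √Real.pi / 2 := by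
    rw [show ((2 : ℝ) + 1) / 2 = 1 / 2 + 1 by norm_num, Real.Gamma_add_one (by norm_num),
      Real.Gamma_one_half_eq]
    ring
  have hb' : b ^ (-((2 : ℝ) + 1) / 2) = (b * √b)⁻¹ := by
    rw [show -((2 : ℝ) + 1) / 2 = -(1 + 1 / 2) by norm_num, Real.rpow_neg hb.le,
      Real.rpow_add hb, Real.rpow_one, Real.sqrt_eq_rpow]
  rw [hG, hb'] at h
  simp only [Real.rpow_two] at h
  rw [h]
  ring

/-- Along `c` the exponent has the coefficient `1 + ‖c‖²`, across it the coefficient `1`; the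
integral factors. -/
theorem integral_gaussian_inner (c : E3) :
    ∫ v : E3, Real.exp (-(‖v‖ ^ 2 + ⟪c, v⟫_ℝ ^ 2)) =
      Real.pi * √Real.pi / √(1 + ‖c‖ ^ 2) := by
  obtain ⟨n, hn⟩ : ∃ n : S2, c = ‖c‖ • (n : E3) := by
    by_cases hc : c = 0
    · exact ⟨⟨EuclideanSpace.single 0 1, by simp⟩, by simp [hc]⟩
    · refine ⟨⟨‖c‖⁻¹ • c, ?_⟩, ?_⟩
      · rw [mem_sphere_zero_iff_norm, norm_smul, norm_inv, norm_norm,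
          inv_mul_cancel₀ (norm_ne_zero_iff.2 hc)]
      · rw [smul_smul, mul_inv_cancel₀ (norm_ne_zero_iff.2 hc), one_smul]
  rw [integral_plane_decomposition n]
  have e : ∀ p : ℝ × perp n, Real.exp (-(‖p.1 • (n : E3) + (p.2 : E3)‖ ^ 2 +
      ⟪c, p.1 • (n : E3) + (p.2 : E3)⟫_ℝ ^ 2)) =
      Real.exp (-(1 + ‖c‖ ^ 2) * p.1 ^ 2) * Real.exp (-‖p.2‖ ^ 2) := by
    intro p
    rw [norm_plane_sq, ← Real.exp_add]
    have : ⟪c, p.1 • (n : E3) + (p.2 : E3)⟫_ℝ = ‖c‖ * p.1 := by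
      conv_lhs => rw [hn]
      rw [real_inner_smul_left, real_inner_comm, inner_plane]
    rw [this]
    congr 1
    ring
  simp only [e]
  rw [integral_prod_mul (fun t : ℝ => Real.exp (-(1 + ‖c‖ ^ 2) * t ^ 2))
    (fun z : perp n => Real.exp (-‖z‖ ^ 2)), integral_gaussian, integral_exp_neg_norm_sq,
    finrank_perp, Real.sqrt_div Real.pi_pos.le]
  simp
  ring

/-- In polar coordinates the Gaussian integral of `integral_gaussian_inner` has the radial part `√π
/ 4 * bump ⟪c, n⟫`. The form of `bump` is chosen for this: its spherical mean is a regularized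
Newton kernel in closed form. -/
theorem integral_bump_inner (c : E3) :
    ∫ n : S2, bump ⟪c, (n : E3)⟫_ℝ ∂areaS2 = 4 * Real.pi / √(1 + ‖c‖ ^ 2) := by
  have hi : Integrable fun v : E3 => Real.exp (-(‖v‖ ^ 2 + ⟪c, v⟫_ℝ ^ 2)) := by
    refine (integrable_exp_neg_norm_sq (V := E3)).mono' (by fun_prop) (.of_forall fun v => ?_)
    rw [Real.norm_of_nonneg (Real.exp_pos _).le]
    refine Real.exp_le_exp.2 ?_
    nlinarith [sq_nonneg ⟪c, v⟫_ℝ]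
  have h := integral_polar (volume : Measure E3) hi
  rw [integral_gaussian_inner] at h
  have e : ∀ n : S2, ∫ r in Ioi (0 : ℝ), r ^ (Module.finrank ℝ E3 - 1) *
      Real.exp (-(‖r • (n : E3)‖ ^ 2 + ⟪c, r • (n : E3)⟫_ℝ ^ 2)) =
      √Real.pi / 4 * bump ⟪c, (n : E3)⟫_ℝ := by
    intro n
    rw [bump, ← integral_sq_mul_exp (by positivity)]
    refine setIntegral_congr_fun measurableSet_Ioi fun r hr => ?_
    have hn : ‖(n : E3)‖ = 1 := norm_eq_of_mem_sphere n
    simp only [finrank_euclideanSpace, Fintype.card_fin, Nat.add_one_sub_one, norm_smul, hn,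
      inner_smul_right, mul_one, Real.norm_eq_abs, sq_abs]
    congr 2
    ring
  simp only [e] at h
  rw [integral_const_mul] at h
  have hp : √Real.pi ≠ 0 := (Real.sqrt_pos.2 Real.pi_pos).ne'
  rw [areaS2]
  field_simp at h ⊢
  linarith

variable {f : E3 → ℝ}

theorem IsTest.norm_planeRadon_le {x : E3} {C : ℝ} (hC : 0 ≤ C)
    (hb : ∀ y, ‖f (x + y)‖ ≤ C * Real.exp (-‖y‖ ^ 2)) (n : S2) (t : ℝ) (z : perp n) :
    ‖f (x + (t • (n : E3) + (z : E3)))‖ ≤ C * Real.exp (-‖z‖ ^ 2) := by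
  refine (hb _).trans ?_
  rw [norm_plane_sq]
  gcongr
  nlinarith [sq_nonneg t]

/-- The integrals of `f` over the planes with normal `n`. -/
noncomputable def slicedIntegral (f : E3 → ℝ) (x : E3) (n : S2) (t : ℝ) : ℝ :=
  ∫ z, f (x + (t • (n : E3) + (z : E3))) ∂(planeVolume n)

theorem slicedIntegral_zero (f : E3 → ℝ) (x : E3) (n : S2) :
    slicedIntegral f x n 0 = planeRadon f x n := by
  simp [slicedIntegral, planeRadon]

theorem continuous_slicedIntegral (hf : IsTest f) (x : E3) (n : S2) :
    Continuous (slicedIntegral f x n) := by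
  obtain ⟨C, hC, hb⟩ := hf.gaussian_bound x
  have hc := hf.contDiff.continuous
  refine continuous_of_dominated (bound := fun z : perp n => C * Real.exp (-‖z‖ ^ 2)) ?_ ?_ ?_ ?_
  · exact fun t => (by fun_prop : Continuous _).aestronglyMeasurable
  · exact fun t => .of_forall fun z => IsTest.norm_planeRadon_le hC hb n t z
  · exact (integrable_exp_neg_norm_sq (V := perp n)).const_mul C
  · exact .of_forall fun z => by fun_prop

theorem norm_slicedIntegral_le {x : E3} {C : ℝ} (hC : 0 ≤ C)
    (hb : ∀ y, ‖f (x + y)‖ ≤ C * Real.exp (-‖y‖ ^ 2)) (n : S2) (t : ℝ) :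
    ‖slicedIntegral f x n t‖ ≤ C * Real.pi := by
  refine (norm_integral_le_of_norm_le ((integrable_exp_neg_norm_sq (V := perp n)).const_mul C)
    (.of_forall fun z => IsTest.norm_planeRadon_le hC hb n t z)).trans ?_
  rw [integral_const_mul, integral_exp_neg_norm_sq, finrank_perp]
  simp

/-- A smooth approximation of `planeRadon`. -/
noncomputable def bandIntegral (f : E3 → ℝ) (x : E3) (ε : ℝ) (n : S2) : ℝ :=
  (2 * ε)⁻¹ * ∫ y, f (x + y) * bump ⟪ε⁻¹ • y, (n : E3)⟫_ℝ

theorem integrable_band (hf : IsTest f) (x : E3) (ε : ℝ) (n : S2) :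
    Integrable fun y => f (x + y) * bump ⟪ε⁻¹ • y, (n : E3)⟫_ℝ := by
  have h1 := hf.contDiff.continuous
  have h2 := continuous_bump
  refine Continuous.integrable_of_hasCompactSupport (by fun_prop) ?_
  exact (hf.hasCompactSupport.comp_homeomorph (Homeomorph.addLeft x)).mul_right

/-- Slicing by the planes `t = ε τ` shows an approximate unit acting on the plane integrals; the
factor `1 / 2` normalizes `∫ bump = 2`. -/
theorem bandIntegral_eq (hf : IsTest f) (x : E3) {ε : ℝ} (hε : 0 < ε) (n : S2) :
    bandIntegral f x ε n = 2⁻¹ * ∫ τ, bump τ * slicedIntegral f x n (ε * τ) := by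
  have hi := integrable_plane_decomposition n (integrable_band hf x ε n)
  rw [bandIntegral, integral_plane_decomposition n, integral_prod _ hi]
  have e : ∀ t, ∫ z, f (x + (t • (n : E3) + (z : E3))) *
      bump ⟪ε⁻¹ • (t • (n : E3) + (z : E3)), (n : E3)⟫_ℝ ∂(planeVolume n) =
      bump (ε⁻¹ * t) * slicedIntegral f x n t := by
    intro t
    rw [slicedIntegral, ← integral_const_mul]
    refine integral_congr_ae (.of_forall fun z => ?_)
    simp only
    rw [inner_smul_left, inner_plane, mul_comm]
    rfl
  simp only [e]
  have h := Measure.integral_comp_mul_left (fun t => bump (ε⁻¹ * t) * slicedIntegral f x n t) ε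
  simp only [inv_mul_cancel_left₀ hε.ne', abs_of_pos (inv_pos.2 hε), smul_eq_mul] at h
  rw [h]
  ring

theorem norm_bandIntegral_le (hf : IsTest f) {x : E3} {C : ℝ} (hC : 0 ≤ C)
    (hb : ∀ y, ‖f (x + y)‖ ≤ C * Real.exp (-‖y‖ ^ 2)) {ε : ℝ} (hε : 0 < ε) (n : S2) :
    ‖bandIntegral f x ε n‖ ≤ C * Real.pi := by
  rw [bandIntegral_eq hf x hε, norm_mul]
  have h := norm_integral_le_of_norm_le (integrable_bump.mul_const (C * Real.pi))
    (f := fun τ => bump τ * slicedIntegral f x n (ε * τ)) (.of_forall fun τ => by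
      rw [norm_mul, Real.norm_of_nonneg (bump_pos τ).le]
      exact mul_le_mul_of_nonneg_left (norm_slicedIntegral_le hC hb n _) (bump_pos τ).le)
  rw [integral_mul_const, integral_bump] at h
  rw [norm_inv, Real.norm_two]
  linarith

theorem tendsto_bandIntegral (hf : IsTest f) (x : E3) (n : S2) :
    Tendsto (fun ε => bandIntegral f x ε n) (𝓝[>] 0) (𝓝 (planeRadon f x n)) := by
  obtain ⟨C, hC, hb⟩ := hf.gaussian_bound x
  have hs := continuous_slicedIntegral hf x n
  have hbc := continuous_bump
  have h : Tendsto (fun ε => ∫ τ, bump τ * slicedIntegral f x n (ε * τ)) (𝓝[>] (0 : ℝ))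
      (𝓝 (∫ τ, bump τ * slicedIntegral f x n 0)) := by
    refine tendsto_integral_filter_of_dominated_convergence (fun τ => bump τ * (C * Real.pi))
      (.of_forall fun ε => (by fun_prop : Continuous _).aestronglyMeasurable)
      (.of_forall fun ε => .of_forall fun τ => ?_) (integrable_bump.mul_const _)
      (.of_forall fun τ => ?_)
    · rw [norm_mul, Real.norm_of_nonneg (bump_pos τ).le]
      exact mul_le_mul_of_nonneg_left (norm_slicedIntegral_le hC hb n _) (bump_pos τ).le
    · have : Continuous fun ε => bump τ * slicedIntegral f x n (ε * τ) := by fun_prop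
      have h1 := (this.tendsto 0).mono_left (nhdsWithin_le_nhds (s := Ioi 0))
      rwa [zero_mul] at h1
  rw [integral_mul_const, integral_bump, slicedIntegral_zero] at h
  have h2 := h.const_mul (2⁻¹ : ℝ)
  rw [inv_mul_cancel_left₀ two_ne_zero] at h2
  refine h2.congr' ?_
  filter_upwards [self_mem_nhdsWithin] with ε hε
  exact (bandIntegral_eq hf x hε n).symm

theorem integrable_uncurry_band (hf : IsTest f) (x : E3) (ε : ℝ) :
    Integrable (Function.uncurry fun (n : S2) (y : E3) => f (x + y) * bump ⟪ε⁻¹ • y, (n : E3)⟫_ℝ)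
      (areaS2.prod volume) := by
  have h1 := hf.contDiff.continuous
  have h2 := continuous_bump
  refine Continuous.integrable_of_hasCompactSupport (by unfold Function.uncurry; fun_prop) ?_
  refine HasCompactSupport.of_support_subset_isCompact
    (isCompact_univ.prod (isCompact_closedBall (0 : E3) (1 + ‖x‖))) fun p hp => ⟨trivial, ?_⟩
  have h3 : f (x + p.2) ≠ 0 := fun h => hp (by simp [Function.uncurry, h])
  have h4 := IsTest.norm_le_one_of_mem_simplex (hf.mem_simplex h3)
  have h5 : ‖p.2‖ ≤ ‖x + p.2‖ + ‖x‖ := by simpa using norm_sub_le (x + p.2) x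
  rw [mem_closedBall_zero_iff]
  linarith

theorem integrable_bandIntegral (hf : IsTest f) (x : E3) (ε : ℝ) :
    Integrable (bandIntegral f x ε) areaS2 :=
  (integrable_uncurry_band hf x ε).integral_prod_left.const_mul _

theorem integral_bandIntegral (hf : IsTest f) (x : E3) {ε : ℝ} (hε : 0 < ε) :
    ∫ n, bandIntegral f x ε n ∂areaS2 =
      2 * Real.pi * ∫ y, f (x + y) * (√(ε ^ 2 + ‖y‖ ^ 2))⁻¹ := by
  simp only [bandIntegral]
  rw [integral_const_mul, integral_integral_swap (integrable_uncurry_band hf x ε),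
    ← integral_const_mul, ← integral_const_mul]
  refine integral_congr_ae (.of_forall fun y => ?_)
  simp only
  rw [integral_const_mul, integral_bump_inner]
  have h : √(1 + ‖ε⁻¹ • y‖ ^ 2) = √(ε ^ 2 + ‖y‖ ^ 2) / ε := by
    rw [norm_smul, norm_inv, Real.norm_of_nonneg hε.le, eq_div_iff hε.ne']
    nth_rewrite 2 [← Real.sqrt_sq hε.le]
    rw [← Real.sqrt_mul (by positivity)]
    congr 1
    field_simp
  rw [h]
  have : 0 < √(ε ^ 2 + ‖y‖ ^ 2) := by positivity
  field_simp
  ring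

/-- Measurability in `n` is not immediate because the plane and its measure vary with `n`; it is
inherited from the band integrals, which are integrals over the fixed space. -/
theorem integrable_planeRadon (hf : IsTest f) (x : E3) : Integrable (planeRadon f x) areaS2 := by
  obtain ⟨C, hC, hb⟩ := hf.gaussian_bound x
  have hm : AEStronglyMeasurable (planeRadon f x) areaS2 :=
    aestronglyMeasurable_of_tendsto_ae (𝓝[>] (0 : ℝ))
      (fun ε => (integrable_bandIntegral hf x ε).aestronglyMeasurable)
      (.of_forall fun n => tendsto_bandIntegral hf x n)
  refine Integrable.mono' (integrable_const (C * Real.pi)) hm (.of_forall fun n => ?_)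
  rw [← slicedIntegral_zero]
  exact norm_slicedIntegral_le hC hb n 0

theorem tendsto_integral_planeRadon (hf : IsTest f) (x : E3) :
    Tendsto (fun ε => 2 * Real.pi * ∫ y, f (x + y) * (√(ε ^ 2 + ‖y‖ ^ 2))⁻¹) (𝓝[>] (0 : ℝ))
      (𝓝 (∫ n, planeRadon f x n ∂areaS2)) := by
  obtain ⟨C, hC, hb⟩ := hf.gaussian_bound x
  have h : Tendsto (fun ε => ∫ n, bandIntegral f x ε n ∂areaS2) (𝓝[>] (0 : ℝ))
      (𝓝 (∫ n, planeRadon f x n ∂areaS2)) := by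
    refine tendsto_integral_filter_of_dominated_convergence (fun _ => C * Real.pi)
      (.of_forall fun ε => (integrable_bandIntegral hf x ε).aestronglyMeasurable) ?_
      (integrable_const _) (.of_forall fun n => tendsto_bandIntegral hf x n)
    filter_upwards [self_mem_nhdsWithin] with ε hε
    exact .of_forall fun n => norm_bandIntegral_le hf hC hb hε n
  refine h.congr' ?_
  filter_upwards [self_mem_nhdsWithin] with ε hε
  exact integral_bandIntegral hf x hε

end Band

/-! ### The Newton potential and its Laplacian -/

section Newton

theorem locallyIntegrable_inv_norm : LocallyIntegrable (fun y : E3 => ‖y‖⁻¹) := by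
  rw [locallyIntegrable_iff]
  intro K hK
  obtain ⟨r, hr⟩ := hK.isBounded.subset_ball (0 : E3)
  refine IntegrableOn.mono_set ?_ hr
  refine (integrableOn_fun_norm_addHaar (volume : Measure E3) (f := fun t : ℝ => t⁻¹)).2 ?_
  have h : IntegrableOn (fun t : ℝ => t) (Ioo 0 r) :=
    (continuous_id.integrableOn_Icc (a := 0) (b := r)).mono_set Ioo_subset_Icc_self
  refine h.congr_fun (fun t ht => ?_) measurableSet_Ioo
  have : t ≠ 0 := ht.1.ne'
  simp only [finrank_euclideanSpace, Fintype.card_fin, Nat.add_one_sub_one, smul_eq_mul]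
  field_simp

/-- The Newton potential, without its usual normalization. -/
noncomputable def newton (f : E3 → ℝ) : E3 → ℝ :=
  convolution (fun y : E3 => ‖y‖⁻¹) f (ContinuousLinearMap.lsmul ℝ ℝ) volume

variable {f : E3 → ℝ}

theorem contDiff_newton (hf : IsTest f) : ContDiff ℝ ∞ (newton f) :=
  hf.hasCompactSupport.contDiff_convolution_right _ locallyIntegrable_inv_norm hf.contDiff

theorem dirDeriv_newton (hf : IsTest f) (i : Fin 3) :
    dirDeriv i (newton f) = newton (dirDeriv i f) := by
  funext x
  have h1 : ContDiff ℝ 1 f := hf.contDiff.of_le (by simp)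
  rw [dirDeriv, newton, (hf.hasCompactSupport.hasFDerivAt_convolution_right _
    locallyIntegrable_inv_norm h1 x).fderiv, convolution_precompR_apply _
    locallyIntegrable_inv_norm (hf.hasCompactSupport.fderiv ℝ) (h1.continuous_fderiv one_ne_zero)]
  rfl

theorem dirDeriv_dirDeriv {g : E3 → ℝ} (hg : ContDiff ℝ 2 g) (i : Fin 3) (x : E3) :
    dirDeriv i (dirDeriv i g) x = iteratedFDeriv ℝ 2 g x
      ![EuclideanSpace.single i 1, EuclideanSpace.single i 1] := by
  have h : DifferentiableAt ℝ (fderiv ℝ g) x :=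
    (hg.fderiv_right (m := 1) le_rfl).differentiable one_ne_zero x
  rw [iteratedFDeriv_two_apply]
  simp only [Matrix.cons_val_zero, Matrix.cons_val_one]
  have e : dirDeriv i g = fun y => fderiv ℝ g y (EuclideanSpace.single i 1) := rfl
  rw [e, dirDeriv, fderiv_clm_apply h (differentiableAt_const _)]
  simp

theorem laplacian_eq_sum_dirDeriv {g : E3 → ℝ} (hg : ContDiff ℝ 2 g) (x : E3) :
    (Δ g) x = ∑ i, dirDeriv i (dirDeriv i g) x := by
  rw [InnerProductSpace.laplacian_eq_iteratedFDeriv_orthonormalBasis g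
    (EuclideanSpace.basisFun (Fin 3) ℝ)]
  simp only [EuclideanSpace.basisFun_apply, dirDeriv_dirDeriv hg]

/-- The powers of the regularized Newton kernel. -/
noncomputable def softKernel (ε : ℝ) (m : ℕ) (y : E3) : ℝ := (√(ε ^ 2 + ‖y‖ ^ 2))⁻¹ ^ m

theorem softKernel_nonneg (ε : ℝ) (m : ℕ) (y : E3) : 0 ≤ softKernel ε m y := by
  unfold softKernel; positivity

theorem hasFDerivAt_softKernel {ε : ℝ} (hε : 0 < ε) (m : ℕ) (y : E3) :
    HasFDerivAt (softKernel ε m) ((-m * softKernel ε (m + 2) y) • innerSL ℝ y) y := by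
  have hp : 0 < ε ^ 2 + ‖y‖ ^ 2 := by positivity
  have hs := Real.sqrt_pos.2 hp
  have h1 : HasFDerivAt (fun y : E3 => ε ^ 2 + ‖y‖ ^ 2) (2 • (innerSL ℝ) y) y :=
    (hasStrictFDerivAt_norm_sq y).hasFDerivAt.const_add _
  have h2 := ((Real.hasDerivAt_sqrt hp.ne').inv hs.ne').pow m
  refine (h2.comp_hasFDerivAt y h1).congr_fderiv ?_
  rw [← Nat.cast_smul_eq_nsmul ℝ, smul_smul]
  congr 1
  rcases m with - | m
  · simp
  · simp only [softKernel, Nat.add_sub_cancel, Pi.inv_apply]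
    push_cast
    simp only [inv_pow, pow_add]
    field_simp

theorem contDiff_softKernel {ε : ℝ} (hε : 0 < ε) (m : ℕ) : ContDiff ℝ ∞ (softKernel ε m) := by
  unfold softKernel
  have hp : ∀ y : E3, ε ^ 2 + ‖y‖ ^ 2 ≠ 0 := fun y => by positivity
  have h1 : ContDiff ℝ ∞ fun y : E3 => √(ε ^ 2 + ‖y‖ ^ 2) :=
    (contDiff_const.add (contDiff_norm_sq ℝ)).sqrt hp
  exact (h1.inv fun y => by positivity).pow m

theorem dirDeriv_softKernel {ε : ℝ} (hε : 0 < ε) (i : Fin 3) (m : ℕ) (y : E3) :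
    dirDeriv i (softKernel ε m) y = -m * softKernel ε (m + 2) y * y i := by
  rw [dirDeriv, (hasFDerivAt_softKernel hε m y).fderiv]
  simp [EuclideanSpace.inner_single_right]

theorem dirDeriv_dirDeriv_softKernel {ε : ℝ} (hε : 0 < ε) (i : Fin 3) (y : E3) :
    dirDeriv i (dirDeriv i (softKernel ε 1)) y =
      3 * softKernel ε 5 y * y i ^ 2 - softKernel ε 3 y := by
  have e : dirDeriv i (softKernel ε 1) = fun y => -(softKernel ε 3 y * y i) := by
    funext y; rw [dirDeriv_softKernel hε]; push_cast; ring
  have hp : HasFDerivAt (fun y : E3 => y i) (EuclideanSpace.proj i : E3 →L[ℝ] ℝ) y :=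
    (EuclideanSpace.proj i : E3 →L[ℝ] ℝ).hasFDerivAt
  have h : HasFDerivAt (fun y => -(softKernel ε 3 y * y i)) _ y :=
    ((hasFDerivAt_softKernel hε 3 y).mul hp).neg
  rw [e, dirDeriv, h.fderiv]
  simp [EuclideanSpace.inner_single_right]
  ring

/-- The terms `3 ‖y‖²` and `-3 (ε² + ‖y‖²)` cancel up to `-3 ε²`; what remains is an approximate
unit times `-4π`. -/
theorem sum_dirDeriv_softKernel {ε : ℝ} (hε : 0 < ε) (y : E3) :
    ∑ i, dirDeriv i (dirDeriv i (softKernel ε 1)) y = -3 * ε ^ 2 * softKernel ε 5 y := by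
  have hp : 0 < ε ^ 2 + ‖y‖ ^ 2 := by positivity
  have hs := Real.sqrt_pos.2 hp
  have hn : ‖y‖ ^ 2 = y 0 ^ 2 + y 1 ^ 2 + y 2 ^ 2 := by
    rw [EuclideanSpace.real_norm_sq_eq, Fin.sum_univ_three]
  have h2 : √(ε ^ 2 + ‖y‖ ^ 2) ^ 2 = ε ^ 2 + ‖y‖ ^ 2 := Real.sq_sqrt hp.le
  have h3 : softKernel ε 3 y = (ε ^ 2 + ‖y‖ ^ 2) * softKernel ε 5 y := by
    rw [softKernel, softKernel, ← h2, Real.sqrt_sq hs.le]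
    field_simp
  simp only [dirDeriv_dirDeriv_softKernel hε, Fin.sum_univ_three]
  rw [h3, hn]
  ring

theorem integral_dirDeriv_mul (hf : IsTest f) {K : E3 → ℝ} (hK : ContDiff ℝ 1 K) (i : Fin 3)
    (x : E3) : ∫ y, dirDeriv i f (x + y) * K y = -∫ y, f (x + y) * dirDeriv i K y := by
  have h1 : ContDiff ℝ 1 fun y => f (x + y) :=
    (hf.contDiff.of_le (by simp)).comp (contDiff_const.add contDiff_id)
  have hd : ∀ y, dirDeriv i f (x + y) =
      fderiv ℝ (fun y => f (x + y)) y (EuclideanSpace.single i 1) := fun y => by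
    rw [fderiv_comp_add_left]; rfl
  have hcf : HasCompactSupport fun y => f (x + y) :=
    hf.hasCompactSupport.comp_homeomorph (Homeomorph.addLeft x)
  have hcd : HasCompactSupport fun y => dirDeriv i f (x + y) :=
    (hf.dirDeriv i).hasCompactSupport.comp_homeomorph (Homeomorph.addLeft x)
  have hcD := (hf.dirDeriv i).contDiff.continuous
  have hcK : Continuous (dirDeriv i K) :=
    (hK.continuous_fderiv one_ne_zero).clm_apply continuous_const
  have hi1 : Integrable fun y => dirDeriv i f (x + y) * K y :=
    Continuous.integrable_of_hasCompactSupport (by have := hK.continuous; fun_prop) hcd.mul_right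
  have hi2 : Integrable fun y => f (x + y) * dirDeriv i K y :=
    Continuous.integrable_of_hasCompactSupport (h1.continuous.mul hcK) hcf.mul_right
  have hi3 : Integrable fun y => f (x + y) * K y :=
    Continuous.integrable_of_hasCompactSupport (h1.continuous.mul hK.continuous) hcf.mul_right
  simp only [hd] at hi1 ⊢
  rw [eq_neg_iff_add_eq_zero, add_comm, ← eq_neg_iff_add_eq_zero]
  exact integral_mul_fderiv_eq_neg_fderiv_mul_of_integrable hi1 hi2 hi3
    (fun y _ => h1.differentiable one_ne_zero y) (fun y _ => hK.differentiable one_ne_zero y)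

theorem integral_softKernel (hf : IsTest f) {ε : ℝ} (hε : 0 < ε) (x : E3) :
    ∑ i, ∫ y, dirDeriv i (dirDeriv i f) (x + y) * softKernel ε 1 y =
      -3 * ε ^ 2 * ∫ y, f (x + y) * softKernel ε 5 y := by
  have hK := contDiff_softKernel hε 1
  have hD : ∀ {K : E3 → ℝ} (i : Fin 3), ContDiff ℝ ∞ K → ContDiff ℝ ∞ (dirDeriv i K) :=
    fun i h => (h.fderiv_right (m := ∞) (by simp)).clm_apply contDiff_const
  have h1 : ∀ i, ∫ y, dirDeriv i (dirDeriv i f) (x + y) * softKernel ε 1 y =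
      ∫ y, f (x + y) * dirDeriv i (dirDeriv i (softKernel ε 1)) y := fun i => by
    rw [integral_dirDeriv_mul (hf.dirDeriv i) (hK.of_le (by simp)),
      integral_dirDeriv_mul hf ((hD i hK).of_le (by simp)), neg_neg]
  have hcf : HasCompactSupport fun y => f (x + y) :=
    hf.hasCompactSupport.comp_homeomorph (Homeomorph.addLeft x)
  simp only [h1]
  rw [← integral_finsetSum, ← integral_const_mul]
  · refine integral_congr_ae (.of_forall fun y => ?_)
    simp only
    rw [← Finset.mul_sum, sum_dirDeriv_softKernel hε]
    ring
  · intro i _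
    have h2 := hf.contDiff.continuous
    have h3 := (hD i (hD i hK)).continuous
    exact Continuous.integrable_of_hasCompactSupport (by fun_prop) hcf.mul_right

theorem hasDerivAt_softProfile (t : ℝ) :
    HasDerivAt (fun t => (t / √(1 + t ^ 2)) ^ 3 / 3) (t ^ 2 * (√(1 + t ^ 2))⁻¹ ^ 5) t := by
  have hp : 0 < 1 + t ^ 2 := by positivity
  have hs := (Real.sqrt_pos.2 hp).ne'
  have h2 : √(1 + t ^ 2) ^ 2 = 1 + t ^ 2 := Real.sq_sqrt hp.le
  refine (((hasDerivAt_bump t).pow 3).div_const 3).congr_deriv ?_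
  rw [bump]
  nth_rewrite 2 [← h2]
  field_simp
  norm_num
  field_simp

theorem integrableOn_softProfile :
    IntegrableOn (fun t : ℝ => t ^ 2 * (√(1 + t ^ 2))⁻¹ ^ 5) (Ioi 0) :=
  integrableOn_Ioi_deriv_of_nonneg' (fun t _ => hasDerivAt_softProfile t) (fun t _ => by positivity)
    ((tendsto_div_sqrt.pow 3).div_const 3)

theorem integrable_softKernel : Integrable (softKernel 1 5) := by
  have h := (integrable_fun_norm_addHaar (volume : Measure E3)
    (f := fun t : ℝ => (√(1 + t ^ 2))⁻¹ ^ 5)).2 (by simpa using integrableOn_softProfile)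
  have e : softKernel 1 5 = fun x => (√(1 + ‖x‖ ^ 2))⁻¹ ^ 5 := by
    funext y; simp [softKernel]
  rwa [e]

theorem integral_softKernel_one : ∫ y, softKernel 1 5 y = 4 * Real.pi / 3 := by
  have h := integral_fun_norm_addHaar (volume : Measure E3) (fun t : ℝ => (√(1 + t ^ 2))⁻¹ ^ 5)
  simp only [finrank_euclideanSpace, Fintype.card_fin, Nat.add_one_sub_one, smul_eq_mul] at h
  rw [integral_Ioi_of_hasDerivAt_of_tendsto' (fun t _ => hasDerivAt_softProfile t)
    integrableOn_softProfile ((tendsto_div_sqrt.pow 3).div_const 3)] at h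
  have e : softKernel 1 5 = fun x => (√(1 + ‖x‖ ^ 2))⁻¹ ^ 5 := by
    funext y; simp [softKernel]
  rw [e, h, Measure.real, EuclideanSpace.volume_ball_fin_three, ENNReal.toReal_mul,
    ENNReal.toReal_pow, ENNReal.toReal_ofReal one_pos.le, ENNReal.toReal_ofReal (by positivity)]
  simp
  ring

theorem softKernel_smul {ε : ℝ} (hε : 0 < ε) (y : E3) :
    softKernel ε 5 (ε • y) = ε⁻¹ ^ 5 * softKernel 1 5 y := by
  have h : √(ε ^ 2 + ‖ε • y‖ ^ 2) = ε * √(1 ^ 2 + ‖y‖ ^ 2) := by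
    rw [norm_smul, Real.norm_of_nonneg hε.le]
    nth_rewrite 3 [← Real.sqrt_sq hε.le]
    rw [← Real.sqrt_mul (by positivity)]
    congr 1
    ring
  rw [softKernel, softKernel, h, mul_inv, mul_pow]

/-- Rescaling `y` by `ε` gives `ε² ε³ ε⁻⁵ = 1`, and the mass of `softKernel 1 5` is `4π/3`. -/
theorem tendsto_integral_softKernel (hf : IsTest f) (x : E3) :
    Tendsto (fun ε => -3 * ε ^ 2 * ∫ y, f (x + y) * softKernel ε 5 y) (𝓝[>] (0 : ℝ))
      (𝓝 (-(4 * Real.pi) * f x)) := by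
  obtain ⟨M, hM⟩ := hf.contDiff.continuous.bounded_above_of_compact_support hf.hasCompactSupport
  have hc := hf.contDiff.continuous
  have hK := (contDiff_softKernel one_pos 5).continuous
  have h : Tendsto (fun ε : ℝ => ∫ y, f (x + ε • y) * softKernel 1 5 y) (𝓝[>] (0 : ℝ))
      (𝓝 (∫ y, f x * softKernel 1 5 y)) := by
    refine tendsto_integral_filter_of_dominated_convergence (fun y => M * softKernel 1 5 y)
      (.of_forall fun ε => (by fun_prop : Continuous _).aestronglyMeasurable)
      (.of_forall fun ε => .of_forall fun y => ?_) (integrable_softKernel.const_mul _)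
      (.of_forall fun y => ?_)
    · rw [norm_mul, Real.norm_of_nonneg (softKernel_nonneg 1 5 y)]
      exact mul_le_mul_of_nonneg_right (hM _) (softKernel_nonneg 1 5 y)
    · have : Continuous fun ε : ℝ => f (x + ε • y) * softKernel 1 5 y := by fun_prop
      have h1 := (this.tendsto 0).mono_left (nhdsWithin_le_nhds (s := Ioi 0))
      rwa [zero_smul, add_zero] at h1
  rw [integral_const_mul, integral_softKernel_one] at h
  have h2 := h.const_mul (-3)
  have e : -3 * (f x * (4 * Real.pi / 3)) = -(4 * Real.pi) * f x := by ring
  rw [e] at h2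
  refine h2.congr' ?_
  filter_upwards [self_mem_nhdsWithin] with ε hε
  have hε : 0 < ε := hε
  have h3 := Measure.integral_comp_smul (volume : Measure E3)
    (fun y => f (x + y) * softKernel ε 5 y) ε
  simp only [softKernel_smul hε, finrank_euclideanSpace, Fintype.card_fin, smul_eq_mul,
    abs_of_pos (inv_pos.2 (pow_pos hε 3)), mul_left_comm _ (ε⁻¹ ^ 5)] at h3
  rw [integral_const_mul] at h3
  have h4 : ∫ y, f (x + y) * softKernel ε 5 y =
      ε ^ 3 * (ε⁻¹ ^ 5 * ∫ y, f (x + ε • y) * softKernel 1 5 y) := by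
    rw [h3, ← mul_assoc, mul_inv_cancel₀ (by positivity), one_mul]
  rw [h4]
  field_simp

theorem tendsto_newton (hf : IsTest f) (x : E3) :
    Tendsto (fun ε => ∫ y, f (x + y) * softKernel ε 1 y) (𝓝[>] (0 : ℝ)) (𝓝 (newton f x)) := by
  have hc := hf.contDiff.continuous
  have h0 : ∀ᵐ y : E3, y ≠ 0 := Measure.ae_ne volume 0
  have h : Tendsto (fun ε => ∫ y, softKernel ε 1 y * f (x - y)) (𝓝[>] (0 : ℝ))
      (𝓝 (newton f x)) := by
    refine tendsto_integral_filter_of_dominated_convergence (fun y => ‖‖y‖⁻¹ • f (x - y)‖) ?_ ?_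
      (hf.hasCompactSupport.convolutionExists_right (ContinuousLinearMap.lsmul ℝ ℝ)
        locallyIntegrable_inv_norm hc x).norm ?_
    · filter_upwards [self_mem_nhdsWithin] with ε hε
      have := (contDiff_softKernel hε 1).continuous
      exact (by fun_prop : Continuous _).aestronglyMeasurable
    · refine .of_forall fun ε => ?_
      filter_upwards [h0] with y hy
      rw [norm_mul, norm_smul, Real.norm_of_nonneg (softKernel_nonneg ε 1 y), norm_inv, norm_norm]
      refine mul_le_mul_of_nonneg_right ?_ (norm_nonneg _)
      rw [softKernel, pow_one]
      refine inv_anti₀ (norm_pos_iff.2 hy) (Real.le_sqrt_of_sq_le ?_)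
      linarith [sq_nonneg ε]
    · filter_upwards [h0] with y hy
      have h1 : ContinuousAt (fun ε : ℝ => softKernel ε 1 y * f (x - y)) 0 := by
        unfold softKernel
        refine ContinuousAt.mul (((Continuous.continuousAt (by fun_prop)).inv₀ ?_).pow 1)
          continuousAt_const
        have := norm_pos_iff.2 hy
        positivity
      have h2 := h1.tendsto.mono_left (nhdsWithin_le_nhds (s := Ioi 0))
      simpa [softKernel, Real.sqrt_sq (norm_nonneg y)] using h2
  refine h.congr fun ε => ?_
  rw [← integral_neg_eq_self]
  refine integral_congr_ae (.of_forall fun y => ?_)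
  simp [softKernel, mul_comm]

/-- Both derivatives first fall on `f`. With the regularized kernel they are moved to the kernel by
parts, and the two expressions have the same limit as `ε` tends to `0`. -/
theorem laplacian_newton (hf : IsTest f) (x : E3) : (Δ (newton f)) x = -(4 * Real.pi) * f x := by
  rw [laplacian_eq_sum_dirDeriv (contDiff_infty.1 (contDiff_newton hf) 2)]
  simp only [dirDeriv_newton hf, dirDeriv_newton (hf.dirDeriv _)]
  have h := tendsto_finsetSum Finset.univ fun i _ => tendsto_newton ((hf.dirDeriv i).dirDeriv i) x
  refine tendsto_nhds_unique h ((tendsto_integral_softKernel hf x).congr' ?_)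
  filter_upwards [self_mem_nhdsWithin] with ε hε
  exact (integral_softKernel hf hε x).symm

theorem integral_planeRadon (hf : IsTest f) (x : E3) :
    ∫ n, planeRadon f x n ∂areaS2 = 2 * Real.pi * newton f x := by
  refine tendsto_nhds_unique (tendsto_integral_planeRadon hf x) ?_
  simpa only [softKernel, pow_one] using (tendsto_newton hf x).const_mul (2 * Real.pi)

end Newton

/-! ### The simplex and the inversion formula -/

section Inversion

variable {f : E3 → ℝ} {k : ℕ} {J : E3 → S2 → Fin 3} {Λ : E3 → S2 → E3}

theorem planeIntegral_vertex (hf : IsTest f) (hk : 1 ≤ k) (h : IsVertexChoice J Λ) {x : E3}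
    (hx : x ∈ simplex) (n : S2) : planeIntegral k f (J x n) (Λ x n) n =
      4 * Real.pi * (k - 2).factorial * planeRadon f x n := by
  rw [planeIntegral_eq hf hk (h x hx n).1, planeRadon_eq_of_inner f (h x hx n).2]

theorem backprojection_eq (hf : IsTest f) (hk : 1 ≤ k) (h : IsVertexChoice J Λ) :
    EqOn (backprojection k f J Λ)
      ((4 * Real.pi * (k - 2).factorial * (2 * Real.pi)) • newton f) simplex := by
  intro x hx
  rw [backprojection]
  simp only [planeIntegral_vertex hf hk h hx]
  rw [integral_const_mul, integral_planeRadon hf]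
  simp [mul_assoc]

theorem inversionConst_mul_laplacian (hf : IsTest f) (k : ℕ) (x : E3) :
    f x = inversionConst k *
      (Δ ((4 * Real.pi * (k - 2).factorial * (2 * Real.pi)) • newton f)) x := by
  rw [InnerProductSpace.laplacian_smul _ (contDiff_infty.1 (contDiff_newton hf) 2).contDiffAt,
    laplacian_newton hf, inversionConst]
  have := Real.pi_ne_zero
  have := Nat.cast_ne_zero (R := ℝ).2 (k - 2).factorial_ne_zero
  simp only [smul_eq_mul]
  field_simp
  ring

theorem convex_simplex : Convex ℝ simplex := by
  intro x hx y hy a b ha hb hab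
  refine ⟨fun i => ?_, ?_⟩
  · exact convex_Icc (0 : ℝ) 1 (hx.1 i) (hy.1 i) ha hb hab
  · have h1 := mul_le_mul_of_nonneg_left hx.2 ha
    have h2 := mul_le_mul_of_nonneg_left hy.2 hb
    simp only [PiLp.add_apply, PiLp.smul_apply, smul_eq_mul]
    linarith

theorem interior_simplex_nonempty : (interior simplex).Nonempty := by
  have ho : IsOpen {x : E3 | (∀ i, 0 < x i) ∧ x 0 + x 1 + x 2 < 1} := by
    rw [ofPred_and, ofPred_forall]
    exact (isOpen_iInter_of_finite fun i => isOpen_lt (by fun_prop) (by fun_prop)).inter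
      (isOpen_lt (by fun_prop) (by fun_prop))
  refine ⟨!₂[1 / 4, 1 / 4, 1 / 4], interior_maximal ?_ ho ⟨fun i => ?_, ?_⟩⟩
  · rintro x ⟨hx, hs⟩
    have h0 := hx 0
    have h1 := hx 1
    have h2 := hx 2
    refine ⟨fun i => ⟨(hx i).le, ?_⟩, hs.le⟩
    fin_cases i <;> simp <;> linarith
  · fin_cases i <;> simp
  · simp; norm_num

/-- A point of the simplex is a convex combination of `0` and the unit vectors, so a positive value
of a linear functional is at most its largest value on the unit vectors. -/
theorem exists_inner_le {x : E3} (hx : x ∈ simplex) {n : E3} (h : 0 < ⟪x, n⟫_ℝ) :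
    ∃ j, 0 < n j ∧ ⟪x, n⟫_ℝ ≤ n j := by
  have hc : ⟪x, n⟫_ℝ = x 0 * n 0 + x 1 * n 1 + x 2 * n 2 := by
    simp [PiLp.inner_apply, Fin.sum_univ_three, mul_comm]
  obtain ⟨j, hj⟩ := Finite.exists_max fun i => n i
  have h0 := hx.1 0
  have h1 := hx.1 1
  have h2 := hx.1 2
  have hle : ⟪x, n⟫_ℝ ≤ (x 0 + x 1 + x 2) * n j := by
    rw [hc, add_mul, add_mul]
    exact add_le_add_three (mul_le_mul_of_nonneg_left (hj 0) h0.1)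
      (mul_le_mul_of_nonneg_left (hj 1) h1.1) (mul_le_mul_of_nonneg_left (hj 2) h2.1)
  have hn : 0 < n j :=
    pos_of_mul_pos_right (h.trans_le hle) (add_nonneg (add_nonneg h0.1 h1.1) h2.1)
  exact ⟨j, hn, hle.trans (mul_le_of_le_one_left hn.le hx.2)⟩

/-- On the segment `j` the functional `⟪·, n⟫` takes all values between `0` and `n j`; some segment
reaches the value at `x`. -/
theorem exists_mem_sensorLine {x : E3} (hx : x ∈ simplex) (n : E3) :
    ∃ j, ∃ y ∈ sensorLine j, ⟪x - y, n⟫_ℝ = 0 := by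
  have key : ∀ j, ∀ t ∈ Icc (0 : ℝ) 1, t * n j = ⟪x, n⟫_ℝ →
      ∃ j, ∃ y ∈ sensorLine j, ⟪x - y, n⟫_ℝ = 0 := fun j t ht h =>
    ⟨j, EuclideanSpace.single j t, ⟨by simpa using ht, fun i hi => by simp [hi]⟩, by
      rw [inner_sub_left, EuclideanSpace.inner_single_left, ← h]; simp⟩
  rcases lt_trichotomy ⟪x, n⟫_ℝ 0 with h | h | h
  · obtain ⟨j, hn, hj⟩ := exists_inner_le hx (n := -n) (by rwa [inner_neg_right, neg_pos])
    rw [inner_neg_right, PiLp.neg_apply, neg_le_neg_iff] at hj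
    rw [PiLp.neg_apply, neg_pos] at hn
    exact key j (⟪x, n⟫_ℝ / n j) ⟨div_nonneg_of_nonpos h.le hn.le, (div_le_one_of_neg hn).2 hj⟩
      (div_mul_cancel₀ _ hn.ne)
  · exact key 0 0 ⟨le_rfl, zero_le_one⟩ (by rw [h, zero_mul])
  · obtain ⟨j, hn, hj⟩ := exists_inner_le hx h
    exact key j (⟪x, n⟫_ℝ / n j) ⟨by positivity, (div_le_one hn).2 hj⟩ (div_mul_cancel₀ _ hn.ne')

end Inversion

end TripleLine

theorem theorem1 (k : ℕ) (hk : 1 ≤ k) (f : TripleLine.E3 → ℝ) (hf : ContDiff ℝ ∞ f)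
    (hsupp : tsupport f ⊆ TripleLine.simplex) :
    -- every plane through a point of the simplex meets the sensor
    (∀ x ∈ TripleLine.simplex, ∀ n : TripleLine.S2,
      ∃ j, ∃ y ∈ TripleLine.sensorLine j, ⟪x - y, (n : TripleLine.E3)⟫_ℝ = 0) ∧
    -- the derivatives and the Hilbert transform in the formula exist
    (∀ j, ∀ u ∈ TripleLine.sensorLine j, ∀ b : TripleLine.S1,
      Differentiable ℝ (TripleLine.conicalRadon k f j u b) ∧
      ∀ s, Tendsto (TripleLine.truncatedHilbert (deriv (TripleLine.conicalRadon k f j u b)) s)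
        (𝓝[>] (0 : ℝ)) (𝓝 (TripleLine.filteredData k f j u b s))) ∧
    (∀ j, ∀ (b : TripleLine.S1) (s : ℝ),
      ContDiffOn ℝ ((k - 1 : ℕ) : WithTop ℕ∞)
        (fun t => TripleLine.filteredData k f j (EuclideanSpace.single j t) b s) (Icc 0 1)) ∧
    -- the iterated integral over axes, repeated integration variable and directions exists
    (∀ j, ∀ u ∈ TripleLine.sensorLine j,
      (∀ w, Integrable (TripleLine.axisIntegrand k f j u w) TripleLine.arcS1) ∧
      (2 ≤ k → ∀ α, IntegrableOn (TripleLine.lineIntegrand k f j u α) (Iio (α j))) ∧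
      ∀ n : TripleLine.S2, Integrable
        (fun α : TripleLine.GreatCircle n =>
          TripleLine.lineIntegral k f j u ((α : TripleLine.perp n) : TripleLine.E3))
        (TripleLine.arcGreatCircle n)) ∧
    -- the inversion formula, for every choice of the vertices
    ∀ (J : TripleLine.E3 → TripleLine.S2 → Fin 3) (Λ : TripleLine.E3 → TripleLine.S2 → TripleLine.E3),
      TripleLine.IsVertexChoice J Λ →
      (∀ x ∈ TripleLine.simplex, Integrable
        (fun n => TripleLine.planeIntegral k f (J x n) (Λ x n) n) TripleLine.areaS2) ∧
      ContDiffOn ℝ 2 (TripleLine.backprojection k f J Λ) TripleLine.simplex ∧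
      (∀ x ∈ TripleLine.simplex,
        f x = TripleLine.inversionConst k *
          (Δ[TripleLine.simplex] (TripleLine.backprojection k f J Λ)) x) ∧
      ∀ x ∈ interior TripleLine.simplex,
        f x = TripleLine.inversionConst k *
          (Δ (TripleLine.backprojection k f J Λ)) x := by
  have ht : TripleLine.IsTest f := ⟨hf, hsupp⟩
  refine ⟨fun x hx n => TripleLine.exists_mem_sensorLine hx n, fun j u hu b => ?_,
    fun j b s => TripleLine.contDiffOn_filteredData ht k j b s (k - 1), fun j u hu =>
    ⟨TripleLine.integrable_axisIntegrand ht k hu,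
      fun h2 => TripleLine.integrableOn_lineIntegrand ht h2 hu,
      TripleLine.integrable_lineIntegral ht hk hu⟩, fun J Λ h => ?_⟩
  · have hu' : u = TripleLine.axis j (u j • TripleLine.planeDir j) := by
      rw [TripleLine.axis_smul_planeDir]
      exact TripleLine.eq_single_of_mem_sensorLine hu
    have hq : ‖u j • TripleLine.planeDir j‖ ≤ 1 := by
      rw [TripleLine.norm_smul_planeDir, abs_of_nonneg hu.1.1]
      exact hu.1.2
    rw [hu']
    exact ⟨TripleLine.differentiable_conicalRadon ht k j hq b,
      TripleLine.tendsto_filteredData ht k j hq b⟩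
  · have heq := TripleLine.backprojection_eq ht hk h
    have hN : ContDiff ℝ 2 ((4 * Real.pi * (k - 2).factorial * (2 * Real.pi)) •
        TripleLine.newton f) :=
      contDiff_const.smul (contDiff_infty.1 (TripleLine.contDiff_newton ht) 2)
    -- A convex set with interior points determines derivatives at its boundary, so the relative
    -- Laplacian of the backprojection is that of its smooth extension.
    have hU : UniqueDiffOn ℝ TripleLine.simplex :=
      uniqueDiffOn_convex TripleLine.convex_simplex TripleLine.interior_simplex_nonempty
    refine ⟨fun x hx => ?_, hN.contDiffOn.congr heq, fun x hx => ?_, fun x hx => ?_⟩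
    · simp only [TripleLine.planeIntegral_vertex ht hk h hx]
      exact (TripleLine.integrable_planeRadon ht x).const_mul _
    · have v := EuclideanSpace.basisFun (Fin 3) ℝ
      rw [InnerProductSpace.laplacianWithin_eq_iteratedFDerivWithin_orthonormalBasis _ hU hx v,
        iteratedFDerivWithin_congr heq hx, iteratedFDerivWithin_eq_iteratedFDeriv hU
          hN.contDiffAt hx]
      refine (TripleLine.inversionConst_mul_laplacian ht k x).trans ?_
      rw [InnerProductSpace.laplacian_eq_iteratedFDeriv_orthonormalBasis _ v]
    · have hev : TripleLine.backprojection k f J Λ =ᶠ[𝓝 x]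
          (4 * Real.pi * (k - 2).factorial * (2 * Real.pi)) • TripleLine.newton f :=
        heq.eventuallyEq_of_mem (mem_interior_iff_mem_nhds.1 hx)
      rw [(InnerProductSpace.laplacian_congr_nhds hev).eq_of_nhds]
      exact TripleLine.inversionConst_mul_laplacian ht k x
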